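/- Let $H$ and $V$ be real separable Hilbert spaces with $V$ continuously and densely embedded in $H$; identify $H$ with its dual, so that $V\hookrightarrow H=H'\hookrightarrow V'$. Let $A_2:V\to V'$ be given by $\langle A_2u,v\rangle=(u,v)_V$. For $j=1,\dots,J$ let $(X_j,\mathcal A_j,\mu_j)$ be a measure space with $\mu_j(X_j)<\infty$, let $U_j$ be a closed subspace of $L^2(X_j,\mu_j)^{N_j}$, and let $g_j:\mathbb R^{N_j}\to\mathbb R^{N_j}$ be continuous with $(g_j(x)-g_j(y))\cdot(x-y)\ge 0$ for all $x,y$, $g_j(0)=0$, and $|g_j(x)|\le M(1+|x|)$ for all $x$ and some constant $M>0$. Let $J_U:V\to U=\prod_{j=1}^J U_j$ be linear and continuous, and define the nonlinear operator $B_2:V\to V'$ by $$\langle B_2u,v\rangle=\sum_{j=1}^J\int_{X_j}g_j\big((J_Uu)_j(x)\big)\cdot(J_Uv)_j(x)\,d\mu_j(x),\qquad u,v\in V.$$ Let $\alpha\in C^1([0,\infty),(0,\infty))$ be such that $\alpha'$ is Lipschitz continuous on $[0,T]$ for every $T>0$. Then for all $(u_0,u_1)\in V\times V$ with $A_2u_0+\alpha(0)B_2u_1\in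 H$, the problem $$u''(t)+A_2u(t)+\alpha(t)B_2u'(t)=0\ \text{ in }H,\ t\ge 0,\qquad u(0)=u_0,\quad u'(0)=u_1,$$ has a unique solution $u\in C([0,\infty),V)\cap C^1([0,\infty),H)$, in the following sense: $u(0)=u_0$, $u'(0)=u_1$; for every $t\ge0$, $u'(t)\in V$ and $A_2u(t)+\alpha(t)B_2u'(t)\in H$; and for all $t\ge 0$ outside a countable set (which may depend on $u$), the second derivative $u''(t)=-A_2u(t)-\alpha(t)B_2u'(t)$ exists in $H$ and the function $s\mapsto A_2u(s)+\alpha(s)B_2u'(s)\in H$ is continuous at $t$. -/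

import Mathlib

open Set MeasureTheory
open scoped RealInnerProductSpace

noncomputable section

/-- A feedback `g : ℝⁿ → ℝⁿ`: continuous, monotone, vanishing at `0`, of at most linear growth. -/
structure Feedback (n : ℕ) where
  toFun : EuclideanSpace ℝ (Fin n) → EuclideanSpace ℝ (Fin n)
  continuous_toFun : Continuous toFun
  monotone : ∀ x y, 0 ≤ ⟪toFun x - toFun y, x - y⟫
  map_zero : toFun 0 = 0
  growth : ∃ M : ℝ, 0 < M ∧ ∀ x, ‖toFun x‖ ≤ M * (1 + ‖x‖)

/-- The space `L²(X, μ)ⁿ` of square integrable functions with values in `ℝⁿ`. -/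
abbrev L2 {X : Type*} [MeasurableSpace X] (μ : Measure X) (n : ℕ) : Type _ :=
  Lp (EuclideanSpace ℝ (Fin n)) 2 μ

/-- On a finite measure space, `g ∘ f` is square integrable whenever `f` is. -/
theorem Feedback.memLp_comp {X : Type*} [MeasurableSpace X] {μ : Measure X} [IsFiniteMeasure μ]
    {n : ℕ} (g : Feedback n) (f : L2 μ n) : MemLp (fun x => g.toFun (f x)) 2 μ := by
  obtain ⟨M, hM, hg⟩ := g.growth
  have h1 : MemLp (fun x => M * (1 + ‖f x‖)) 2 μ :=
    ((memLp_const (1 : ℝ)).add (Lp.memLp f).norm).const_mul M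
  refine h1.mono (g.continuous_toFun.comp_aestronglyMeasurable (Lp.memLp f).1) ?_
  refine Filter.Eventually.of_forall fun x => (hg (f x)).trans ?_
  exact le_abs_self _

/-- The superposition operator `f ↦ g ∘ f` on `L²(X, μ)ⁿ`. -/
def Feedback.superposition {X : Type*} [MeasurableSpace X] {μ : Measure X} [IsFiniteMeasure μ]
    {n : ℕ} (g : Feedback n) (f : L2 μ n) : L2 μ n :=
  (g.memLp_comp f).toLp

/-- The operator `A₂ : V → V'`, `⟨A₂ u, v⟩ = (u, v)_V`. -/
def stiffness (V : Type*) [NormedAddCommGroup V] [InnerProductSpace ℝ V] :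
    V →L[ℝ] StrongDual ℝ V :=
  innerSL ℝ

/-- The nonlinear operator `B₂ : V → V'` attached to feedbacks `g j` and to a continuous linear map
`JU : V → U = ∏ j, U j`, where `U j` is a subspace of `L²(X j, μ j)^(N j)`.
See `damping_apply` for the integral formula. -/
def damping {V : Type*} [NormedAddCommGroup V] [InnerProductSpace ℝ V] {J : ℕ}
    {X : Fin J → Type*} [∀ j, MeasurableSpace (X j)] {μ : ∀ j, Measure (X j)}
    [∀ j, IsFiniteMeasure (μ j)] {N : Fin J → ℕ} {U : ∀ j, Submodule ℝ (L2 (μ j) (N j))}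
    (g : ∀ j, Feedback (N j)) (JU : V →L[ℝ] (∀ j, U j)) (u : V) : StrongDual ℝ V :=
  ∑ j, (innerSL ℝ ((g j).superposition (JU u j : L2 (μ j) (N j)))) ∘L
    (U j).subtypeL ∘L (ContinuousLinearMap.proj j) ∘L JU

/-- `⟨B₂ u, v⟩ = ∑ j, ∫_{X j} g j ((JU u) j x) · (JU v) j x dμ j(x)`. -/
theorem damping_apply {V : Type*} [NormedAddCommGroup V] [InnerProductSpace ℝ V] {J : ℕ}
    {X : Fin J → Type*} [∀ j, MeasurableSpace (X j)] {μ : ∀ j, Measure (X j)}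
    [∀ j, IsFiniteMeasure (μ j)] {N : Fin J → ℕ} {U : ∀ j, Submodule ℝ (L2 (μ j) (N j))}
    (g : ∀ j, Feedback (N j)) (JU : V →L[ℝ] (∀ j, U j)) (u v : V) :
    damping g JU u v =
      ∑ j, ∫ x, ⟪(g j).toFun ((JU u j : L2 (μ j) (N j)) x), (JU v j : L2 (μ j) (N j)) x⟫
        ∂(μ j) := by
  simp only [damping, sum_apply]
  refine Finset.sum_congr rfl fun j _ => ?_
  change ⟪(g j).superposition (JU u j : L2 (μ j) (N j)), (JU v j : L2 (μ j) (N j))⟫ = _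
  rw [L2.inner_def]
  refine integral_congr_ae ?_
  filter_upwards [((g j).memLp_comp (JU u j : L2 (μ j) (N j))).coeFn_toLp] with x hx
  simp only [Feedback.superposition]
  rw [hx]

/-- The inclusion `H = H' → V'` dual to the embedding `ι : V → H`: `⟨h, v⟩ = (h, ι v)_H`. -/
def pivot {V H : Type*} [NormedAddCommGroup V] [InnerProductSpace ℝ V]
    [NormedAddCommGroup H] [InnerProductSpace ℝ H] (ι : V →L[ℝ] H) (h : H) : StrongDual ℝ V :=
  (innerSL ℝ h) ∘L ι

/-- `u ∈ C([0,∞), V) ∩ C¹([0,∞), H)` solves `u'' + A u + α(t) B u' = 0` in `H`, `u(0) = u₀`,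
`u'(0) = u₁`. Here `v = u'`, which takes its values in `V`, and `f(t) ∈ H` is the element
`A u(t) + α(t) B u'(t)` of `V'`, which lies in `H` for all `t ≥ 0`; for all `t ≥ 0` outside a
countable set, `u''(t) = -f(t)` exists in `H` and is continuous at `t`.
Only the values of `u` on `[0,∞)` matter, and derivatives at `0` are one-sided. -/
def IsSolution {V H : Type*} [NormedAddCommGroup V] [InnerProductSpace ℝ V]
    [NormedAddCommGroup H] [InnerProductSpace ℝ H] (ι : V →L[ℝ] H)
    (A B : V → StrongDual ℝ V) (α : ℝ → ℝ) (u₀ u₁ : V) (u : ℝ → V) : Prop :=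
  ContinuousOn u (Ici 0) ∧ u 0 = u₀ ∧
  ∃ v : ℝ → V,
    (∀ t ∈ Ici (0 : ℝ), HasDerivWithinAt (fun s => ι (u s)) (ι (v t)) (Ici 0) t) ∧
    ContinuousOn (fun t => ι (v t)) (Ici 0) ∧ v 0 = u₁ ∧
    ∃ f : ℝ → H,
      (∀ t ∈ Ici (0 : ℝ), pivot ι (f t) = A (u t) + α t • B (v t)) ∧
      ∃ S : Set ℝ, S.Countable ∧ ∀ t ∈ Ici (0 : ℝ) \ S,
        HasDerivWithinAt (fun s => ι (v s)) (-f t) (Ici 0) t ∧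
        ContinuousWithinAt f (Ici 0) t

end

/-!
Existence is obtained from the backward Euler scheme. Each step is solvable because `1 + T`
vanishes somewhere for every monotone hemicontinuous `T`: minimise the Fitzpatrick function of `T`
plus half the squared norm. The energy `‖u‖² + ‖v‖²` decreases along the scheme. Dividing
`A u + α B v = f` by `α` frees the monotone term from the time-dependent factor, so that
monotonicity can be applied between two different times; with `γ = (1 / α)'`, the quantity
`‖α⁻¹ v + γ u‖² + ‖α⁻¹ f‖²` therefore satisfies a discrete Gronwall inequality, which bounds `v` in
`V` and `f` in `H`. Halving the step `h` changes the scheme by `O(√h)`, so the dyadic schemes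
converge, and Minty's argument identifies the limit.

For uniqueness, the energy of the difference of two solutions does not increase as long as both
velocities are bounded in `V`. A solution therefore coincides with the one constructed from any of
its states for as long as it stays bounded, which propagates bounds forward in time, and Baire's
theorem gives local boundedness everywhere. The Lyapunov quantity above, shifted by a constant and
multiplied by a decreasing exponential, is then antitone in time, hence continuous off a countable
set; there, weak convergence and convergence of norms make `f` continuous, and `v' = -f` holds
strongly.
-/

noncomputable section

open Filter Topology

section MonotoneOperators

variable {V : Type*} [NormedAddCommGroup V] [NormedSpace ℝ V]

/-- Monotonicity of an operator from a normed space to its dual. -/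
def IsMonotoneOperator (B : V → StrongDual ℝ V) : Prop :=
  ∀ x y, 0 ≤ (B x - B y) (x - y)

/-- Hemicontinuity in the weak form that Minty's lemma needs: right continuity along every ray,
tested only in the direction of that ray. -/
def Hemicontinuous (B : V → StrongDual ℝ V) : Prop :=
  ∀ x h : V, Tendsto (fun t : ℝ => B (x + t • h) h) (𝓝[>] 0) (𝓝 (B x h))

theorem Hemicontinuous.eq_of_monotonically_related {B : V → StrongDual ℝ V}
    (hB : Hemicontinuous B) {l : StrongDual ℝ V} {v : V} (h : ∀ p, 0 ≤ (l - B p) (v - p)) :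
    l = B v := by
  have hle : ∀ y, l y ≤ B v y := by
    intro y
    refine ge_of_tendsto (hB v y) ?_
    filter_upwards [self_mem_nhdsWithin] with t (ht : 0 < t)
    have ht' := h (v + t • y)
    simp only [sub_add_cancel_left, map_neg, map_smul, sub_apply, smul_eq_mul] at ht'
    exact le_of_mul_le_mul_left (by linarith) ht
  ext y
  refine le_antisymm (hle y) ?_
  simpa only [map_neg, neg_le_neg_iff] using hle (-y)

end MonotoneOperators

section Minimisation

variable {E : Type*} [NormedAddCommGroup E] [InnerProductSpace ℝ E] {K : Set (E × ℝ)}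

/-- The functional `(x, r) ↦ r + ‖x‖² / 2`; its minimisers over the epigraph of a convex function
`φ` are given by the proximal point of `φ` at the origin. -/
def proximalCost (p : E × ℝ) : ℝ :=
  p.2 + ‖p.1‖ ^ 2 / 2

theorem norm_sub_sq_le_of_le_proximalCost (hK : Convex ℝ K) {m : ℝ}
    (hm : ∀ p ∈ K, m ≤ proximalCost p) {p q : E × ℝ} (hp : p ∈ K) (hq : q ∈ K) :
    ‖p.1 - q.1‖ ^ 2 ≤ 4 * ((proximalCost p - m) + (proximalCost q - m)) := by
  have hmid := hm _ (hK.midpoint_mem hp hq)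
  have hpar := parallelogram_law_with_norm ℝ p.1 q.1
  have hnorm : ‖(midpoint ℝ p q).1‖ ^ 2 = ‖p.1 + q.1‖ ^ 2 / 4 := by
    rw [midpoint_eq_smul_add, Prod.smul_fst, Prod.fst_add, norm_smul, mul_pow, invOf_eq_inv]
    norm_num
    ring
  have hsnd : (midpoint ℝ p q).2 = (p.2 + q.2) / 2 := by
    rw [midpoint_eq_smul_add, Prod.smul_snd, Prod.snd_add, invOf_eq_inv, smul_eq_mul]
    ring
  rw [proximalCost, hnorm, hsnd] at hmid
  simp only [proximalCost]
  linarith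

theorem exists_isMinOn_proximalCost [CompleteSpace E] (hne : K.Nonempty) (hcl : IsClosed K)
    (hK : Convex ℝ K) (hbdd : BddBelow (proximalCost '' K)) :
    ∃ p ∈ K, IsMinOn proximalCost K p := by
  have hm : ∀ p ∈ K, sInf (proximalCost '' K) ≤ proximalCost p := fun p hp =>
    csInf_le hbdd ⟨p, hp, rfl⟩
  obtain ⟨c, hanti, hc, hmem⟩ := exists_seq_tendsto_sInf (hne.image proximalCost) hbdd
  set m := sInf (proximalCost '' K)
  choose s hsK hsc using hmem
  have hcauchy : CauchySeq fun n => (s n).1 := by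
    refine cauchySeq_of_le_tendsto_0' (fun n => √(8 * (c n - m))) (fun n k hnk => ?_) ?_
    · rw [dist_eq_norm]
      refine Real.le_sqrt_of_sq_le
        ((norm_sub_sq_le_of_le_proximalCost hK hm (hsK n) (hsK k)).trans ?_)
      rw [hsc, hsc]
      linarith [hanti hnk]
    · simpa only [sub_self, mul_zero, Real.sqrt_zero] using ((hc.sub_const m).const_mul 8).sqrt
  obtain ⟨x, hx⟩ := cauchySeq_tendsto_of_complete hcauchy
  have hr : Tendsto (fun n => (s n).2) atTop (𝓝 (m - ‖x‖ ^ 2 / 2)) := by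
    refine (hc.sub ((hx.norm.pow 2).div_const 2)).congr fun n => ?_
    rw [← hsc, proximalCost, add_sub_cancel_right]
  refine ⟨(x, m - ‖x‖ ^ 2 / 2),
    hcl.mem_of_tendsto (hx.prodMk_nhds hr) (Eventually.of_forall hsK), fun q hq => ?_⟩
  simpa [proximalCost] using hm q hq

theorem sub_add_inner_nonneg_of_isMinOn_proximalCost (hK : Convex ℝ K) {p q : E × ℝ}
    (hp : p ∈ K) (hmin : IsMinOn proximalCost K p) (hq : q ∈ K) :
    0 ≤ q.2 - p.2 + ⟪p.1, q.1 - p.1⟫ := by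
  have hlim : Tendsto (fun t : ℝ => q.2 - p.2 + ⟪p.1, q.1 - p.1⟫ + t * (‖q.1 - p.1‖ ^ 2 / 2))
      (𝓝[>] 0) (𝓝 (q.2 - p.2 + ⟪p.1, q.1 - p.1⟫)) := by
    refine Tendsto.mono_left ?_ nhdsWithin_le_nhds
    exact Continuous.tendsto' (by fun_prop) 0 _ (by rw [zero_mul, add_zero])
  refine ge_of_tendsto hlim ?_
  filter_upwards [Ioo_mem_nhdsGT (zero_lt_one' ℝ)] with t ht
  have ht' : proximalCost p ≤ proximalCost (p + t • (q - p)) :=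
    hmin (hK.add_smul_sub_mem hp hq ⟨ht.1.le, ht.2.le⟩)
  simp only [proximalCost, Prod.fst_add, Prod.snd_add, Prod.smul_fst, Prod.smul_snd, Prod.fst_sub,
    Prod.snd_sub, norm_add_sq_real, norm_smul, inner_smul_right, smul_eq_mul, mul_pow,
    Real.norm_eq_abs, sq_abs] at ht'
  exact nonneg_of_mul_nonneg_right (by linarith) ht.1

theorem exists_forall_sub_add_inner_nonneg [CompleteSpace E] (hne : K.Nonempty) (hcl : IsClosed K)
    (hK : Convex ℝ K) (hbdd : BddBelow (proximalCost '' K)) :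
    ∃ p ∈ K, ∀ q ∈ K, 0 ≤ q.2 - p.2 + ⟪p.1, q.1 - p.1⟫ := by
  obtain ⟨p, hp, hmin⟩ := exists_isMinOn_proximalCost hne hcl hK hbdd
  exact ⟨p, hp, fun q hq => sub_add_inner_nonneg_of_isMinOn_proximalCost hK hp hmin hq⟩

end Minimisation

section Fitzpatrick

variable {V : Type*} [NormedAddCommGroup V] [InnerProductSpace ℝ V] {T : V → StrongDual ℝ V}

/-- The epigraph of the Fitzpatrick function `(x, y) ↦ ⨆ z, (T z x + ⟪z, y⟫ - T z z)` of `T`,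
where the second variable is a functional represented by a vector. -/
def fitzpatrickEpigraph (T : V → StrongDual ℝ V) : Set (WithLp 2 (V × V) × ℝ) :=
  {p | ∀ z, T z p.1.fst + ⟪z, p.1.snd⟫ - T z z ≤ p.2}

theorem isClosed_fitzpatrickEpigraph : IsClosed (fitzpatrickEpigraph T) := by
  simp only [fitzpatrickEpigraph, ofPred_forall]
  exact isClosed_iInter fun z => isClosed_le (by fun_prop) (by fun_prop)

theorem convex_fitzpatrickEpigraph : Convex ℝ (fitzpatrickEpigraph T) := by
  intro p hp q hq a b ha hb hab z
  have hpz := mul_le_mul_of_nonneg_left (hp z) ha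
  have hqz := mul_le_mul_of_nonneg_left (hq z) hb
  have hTz : T z z = a * T z z + b * T z z := by rw [← add_mul, hab, one_mul]
  simp only [Prod.fst_add, Prod.snd_add, Prod.smul_fst, Prod.smul_snd, WithLp.add_fst,
    WithLp.add_snd, WithLp.smul_fst, WithLp.smul_snd, map_add, map_smul, inner_add_right,
    inner_smul_right, smul_eq_mul]
  linarith

theorem inner_le_of_mem_fitzpatrickEpigraph {p : WithLp 2 (V × V) × ℝ}
    (hp : p ∈ fitzpatrickEpigraph T) : ⟪p.1.fst, p.1.snd⟫ ≤ p.2 := by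
  linarith [hp p.1.fst]

theorem bddBelow_proximalCost_fitzpatrickEpigraph :
    BddBelow (proximalCost '' fitzpatrickEpigraph T) := by
  refine ⟨0, forall_mem_image.2 fun p hp => ?_⟩
  have hle := inner_le_of_mem_fitzpatrickEpigraph hp
  have hsq := norm_add_sq_real p.1.fst p.1.snd
  rw [proximalCost, WithLp.prod_norm_sq_eq_of_L2]
  linarith [sq_nonneg ‖p.1.fst + p.1.snd‖]

variable [CompleteSpace V]

theorem IsMonotoneOperator.graph_mem_fitzpatrickEpigraph (hT : IsMonotoneOperator T) (z : V) :
    (WithLp.toLp 2 (z, (InnerProductSpace.toDual ℝ V).symm (T z)), T z z) ∈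
      fitzpatrickEpigraph T := by
  intro w
  have hzw := hT z w
  simp only [sub_apply, map_sub] at hzw
  change T w z + ⟪w, (InnerProductSpace.toDual ℝ V).symm (T z)⟫ - T w w ≤ T z z
  rw [real_inner_comm, InnerProductSpace.toDual_symm_apply]
  linarith

/-- At a minimiser of `proximalCost` on the epigraph of the Fitzpatrick function, the variational
inequality, tested on the graph of `T`, completes a square. -/
theorem IsMonotoneOperator.exists_norm_add_sq_le (hT : IsMonotoneOperator T) :
    ∃ x y : V, ∀ z, ‖x + y‖ ^ 2 ≤ (innerSL ℝ x + T z) (z + y) := by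
  obtain ⟨⟨⟨x, y⟩, r⟩, hp, hvar⟩ := exists_forall_sub_add_inner_nonneg
    ⟨_, hT.graph_mem_fitzpatrickEpigraph 0⟩ isClosed_fitzpatrickEpigraph convex_fitzpatrickEpigraph
    bddBelow_proximalCost_fitzpatrickEpigraph
  refine ⟨x, y, fun z => ?_⟩
  have hvar := hvar _ (hT.graph_mem_fitzpatrickEpigraph z)
  have hle : ⟪x, y⟫ ≤ r := inner_le_of_mem_fitzpatrickEpigraph hp
  simp only [WithLp.prod_inner_apply, inner_sub_right, real_inner_self_eq_norm_sq,
    real_inner_comm ((InnerProductSpace.toDual ℝ V).symm (T z)),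
    InnerProductSpace.toDual_symm_apply] at hvar
  rw [norm_add_sq_real]
  simp only [add_apply, innerSL_apply_apply, map_add]
  linarith

theorem IsMonotoneOperator.exists_innerSL_add_eq_zero (hT : IsMonotoneOperator T)
    (hTh : Hemicontinuous T) : ∃ x, innerSL ℝ x + T x = 0 := by
  obtain ⟨x, y, hxy⟩ := hT.exists_norm_add_sq_le
  have hgraph : -innerSL ℝ x = T (-y) := hTh.eq_of_monotonically_related fun z => by
    have hz := (sq_nonneg _).trans (hxy z)
    rw [← neg_add', ← neg_add', neg_apply, map_neg, neg_neg, add_comm y]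
    exact hz
  have hsum : x + y = 0 := by
    have hy := hxy (-y)
    rw [neg_add_cancel, map_zero] at hy
    exact norm_eq_zero.1 (pow_eq_zero_iff two_ne_zero |>.1 (hy.antisymm (sq_nonneg _)))
  rw [← eq_neg_of_add_eq_zero_left hsum] at hgraph
  exact ⟨x, by rw [← hgraph, add_neg_cancel]⟩

end Fitzpatrick

section WeakConvergence

variable {E : Type*} [NormedAddCommGroup E] [InnerProductSpace ℝ E] {I : Type*} {F : Filter I}
  {x : I → E} {y : E}

/-- Weak convergence of a family in a Hilbert space along a filter. -/
def WeaklyTendsto (x : I → E) (F : Filter I) (y : E) : Prop :=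
  ∀ z, Tendsto (fun i => ⟪x i, z⟫) F (𝓝 ⟪y, z⟫)

theorem WeaklyTendsto.of_tendsto (h : Tendsto x F (𝓝 y)) : WeaklyTendsto x F y :=
  fun _ => h.inner tendsto_const_nhds

theorem WeaklyTendsto.mono_left {F' : Filter I} (h : WeaklyTendsto x F y) (hF : F' ≤ F) :
    WeaklyTendsto x F' y :=
  fun z => (h z).mono_left hF

theorem WeaklyTendsto.add {x' : I → E} {y' : E} (h : WeaklyTendsto x F y)
    (h' : WeaklyTendsto x' F y') : WeaklyTendsto (fun i => x i + x' i) F (y + y') := fun z => by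
  simpa only [inner_add_left] using (h z).add (h' z)

theorem WeaklyTendsto.smul {c : I → ℝ} {a : ℝ} (hc : Tendsto c F (𝓝 a))
    (h : WeaklyTendsto x F y) : WeaklyTendsto (fun i => c i • x i) F (a • y) := fun z => by
  simpa only [real_inner_smul_left] using hc.mul (h z)

theorem WeaklyTendsto.unique [F.NeBot] {y' : E} (h : WeaklyTendsto x F y)
    (h' : WeaklyTendsto x F y') : y = y' :=
  ext_inner_right ℝ fun z => tendsto_nhds_unique (h z) (h' z)

theorem WeaklyTendsto.inner {w : I → E} {z : E} {L : ℝ} (h : WeaklyTendsto x F y)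
    (hL : ∀ᶠ i in F, ‖x i‖ ≤ L) (hw : Tendsto w F (𝓝 z)) :
    Tendsto (fun i => ⟪x i, w i⟫) F (𝓝 ⟪y, z⟫) := by
  have hzero : Tendsto (fun i => ⟪x i, w i - z⟫) F (𝓝 0) := by
    have hbound : Tendsto (fun i => L * ‖w i - z‖) F (𝓝 0) := by
      simpa only [mul_zero] using (tendsto_iff_norm_sub_tendsto_zero.1 hw).const_mul L
    refine squeeze_zero_norm' ?_ hbound
    filter_upwards [hL] with i hi
    exact (norm_inner_le_norm _ _).trans (mul_le_mul_of_nonneg_right hi (norm_nonneg _))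
  simpa only [← inner_add_right, add_sub_cancel, add_zero] using (h z).add hzero

theorem WeaklyTendsto.apply [CompleteSpace E] (h : WeaklyTendsto x F y) (l : StrongDual ℝ E) :
    Tendsto (fun i => l (x i)) F (𝓝 (l y)) := by
  have hl := h ((InnerProductSpace.toDual ℝ E).symm l)
  simpa only [real_inner_comm ((InnerProductSpace.toDual ℝ E).symm l),
    InnerProductSpace.toDual_symm_apply] using hl

theorem weaklyTendsto_of_ultrafilter
    (h : ∀ 𝒰 : Ultrafilter I, (𝒰 : Filter I) ≤ F → WeaklyTendsto x 𝒰 y) : WeaklyTendsto x F y :=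
  fun z => (tendsto_iff_ultrafilter _ _ _).2 fun 𝒰 h𝒰 => h 𝒰 h𝒰 z

theorem exists_weaklyTendsto_ultrafilter [CompleteSpace E] {𝒰 : Ultrafilter I} {L : ℝ}
    (hL : ∀ᶠ i in (𝒰 : Filter I), ‖x i‖ ≤ L) : ∃ y, ‖y‖ ≤ L ∧ WeaklyTendsto x 𝒰 y := by
  set X : I → WeakDual ℝ E := fun i =>
    StrongDual.toWeakDual (InnerProductSpace.toDual ℝ E (x i))
  have hX : ∀ᶠ i in (𝒰 : Filter I), X i ∈ WeakDual.toStrongDual ⁻¹' Metric.closedBall 0 L := by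
    filter_upwards [hL] with i hi
    rw [mem_preimage, mem_closedBall_zero_iff]
    exact ((InnerProductSpace.toDual ℝ E).norm_map (x i)).trans_le hi
  obtain ⟨l, hl, hlim⟩ :=
    (WeakDual.isCompact_closedBall (0 : StrongDual ℝ E) L).ultrafilter_le_nhds (𝒰.map X)
      (le_principal_iff.2 hX)
  refine ⟨(InnerProductSpace.toDual ℝ E).symm (WeakDual.toStrongDual l), ?_, fun z => ?_⟩
  · rw [LinearIsometryEquiv.norm_map]
    exact mem_closedBall_zero_iff.1 hl
  · rw [InnerProductSpace.toDual_symm_apply]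
    exact ((WeakDual.eval_continuous z).tendsto l).comp hlim

section Pairs

variable {E' : Type*} [NormedAddCommGroup E'] [InnerProductSpace ℝ E'] {x' : I → E'} {y' : E'}

theorem WeaklyTendsto.norm_sq_add_norm_sq_le [F.NeBot] {C : I → ℝ} {c : ℝ}
    (h : WeaklyTendsto x F y) (h' : WeaklyTendsto x' F y')
    (hle : ∀ᶠ i in F, ‖x i‖ ^ 2 + ‖x' i‖ ^ 2 ≤ C i) (hC : Tendsto C F (𝓝 c)) :
    ‖y‖ ^ 2 + ‖y'‖ ^ 2 ≤ c := by
  have hlim := le_of_tendsto_of_tendsto ((h y).add (h' y'))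
    ((hC.div_const 2).add_const ((‖y‖ ^ 2 + ‖y'‖ ^ 2) / 2)) (by
      filter_upwards [hle] with i hi
      linarith [norm_sub_sq_real (x i) y, norm_sub_sq_real (x' i) y', sq_nonneg ‖x i - y‖,
        sq_nonneg ‖x' i - y'‖])
  simp only [real_inner_self_eq_norm_sq] at hlim
  linarith

theorem WeaklyTendsto.tendsto_snd_of_norm_sq_add_norm_sq (h : WeaklyTendsto x F y)
    (h' : WeaklyTendsto x' F y')
    (hnorm : Tendsto (fun i => ‖x i‖ ^ 2 + ‖x' i‖ ^ 2) F (𝓝 (‖y‖ ^ 2 + ‖y'‖ ^ 2))) :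
    Tendsto x' F (𝓝 y') := by
  have hlim := (hnorm.sub (((h y).add (h' y')).const_mul 2)).add_const (‖y‖ ^ 2 + ‖y'‖ ^ 2)
  have hsq : Tendsto (fun i => ‖x' i - y'‖ ^ 2) F (𝓝 0) := by
    refine squeeze_zero (fun i => sq_nonneg _) (fun i => ?_) (hlim.trans_eq ?_)
    · linarith [norm_sub_sq_real (x i) y, norm_sub_sq_real (x' i) y', sq_nonneg ‖x i - y‖]
    · simp only [real_inner_self_eq_norm_sq]
      congr 1
      ring
  rw [tendsto_iff_norm_sub_tendsto_zero]
  simpa only [Real.sqrt_sq (norm_nonneg _), Real.sqrt_zero] using hsq.sqrt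

end Pairs

section Map

variable {E' : Type*} [NormedAddCommGroup E'] [InnerProductSpace ℝ E'] [CompleteSpace E]
  [CompleteSpace E'] {L : E →L[ℝ] E'}

theorem WeaklyTendsto.map (L : E →L[ℝ] E') (h : WeaklyTendsto x F y) :
    WeaklyTendsto (fun i => L (x i)) F (L y) := fun z => by
  simpa only [ContinuousLinearMap.adjoint_inner_right] using h (L.adjoint z)

theorem WeaklyTendsto.of_map (hL : Function.Injective L) {c : ℝ} (hc : ∀ᶠ i in F, ‖x i‖ ≤ c)
    (h : WeaklyTendsto (fun i => L (x i)) F (L y)) : WeaklyTendsto x F y := by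
  refine weaklyTendsto_of_ultrafilter fun 𝒰 h𝒰 => ?_
  obtain ⟨y', -, hy'⟩ := exists_weaklyTendsto_ultrafilter (hc.filter_mono h𝒰)
  rwa [← hL ((hy'.map L).unique (h.mono_left h𝒰))]

theorem denseRange_adjoint (hL : Function.Injective L) : DenseRange L.adjoint := by
  refine Submodule.dense_iff_topologicalClosure_eq_top.2
    ((Submodule.topologicalClosure_eq_top_iff (K := L.adjoint.range)).2 ?_)
  rw [ContinuousLinearMap.orthogonal_range, ContinuousLinearMap.adjoint_adjoint]
  exact LinearMap.ker_eq_bot.2 hL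

end Map

end WeakConvergence

section StateEquation

variable {V H : Type*} [NormedAddCommGroup V] [InnerProductSpace ℝ V]
  [NormedAddCommGroup H] [InnerProductSpace ℝ H] {ι : V →L[ℝ] H} {B : V → StrongDual ℝ V}
  {I : Type*} {F : Filter I}

/-- The identity `f = A u + a • B v` in `V'` for `f ∈ H`, where `A` is the Riesz isomorphism
of `V`. -/
def StateEq (ι : V →L[ℝ] H) (B : V → StrongDual ℝ V) (a : ℝ) (u v : V) (f : H) : Prop :=
  ∀ x, ⟪f, ι x⟫ = ⟪u, x⟫ + a * B v x

theorem pivot_eq_iff_stateEq {a : ℝ} {u v : V} {f : H} :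
    pivot ι f = stiffness V u + a • B v ↔ StateEq ι B a u v f :=
  ContinuousLinearMap.ext_iff

theorem StateEq.unique {a : ℝ} {u v : V} {f f' : H} (hι : DenseRange ι)
    (h : StateEq ι B a u v f) (h' : StateEq ι B a u v f') : f = f' :=
  hι.eq_of_inner_left ℝ fun x => by rw [h, h']

theorem StateEq.inner_sub_le (hB : IsMonotoneOperator B) {a a' : ℝ} {u v u' v' : V} {f f' : H}
    (ha : 0 ≤ a) (h : StateEq ι B a u v f) (h' : StateEq ι B a' u' v' f') :
    ⟪u - u', v - v'⟫ - ⟪f - f', ι (v - v')⟫ ≤ |a - a'| * (‖B v'‖ * ‖v - v'‖) := by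
  have hmono := mul_nonneg ha (hB v v')
  have hcoeff : -((a - a') * B v' (v - v')) ≤ |a - a'| * (‖B v'‖ * ‖v - v'‖) := by
    refine (neg_le_abs _).trans ?_
    rw [abs_mul]
    exact mul_le_mul_of_nonneg_left ((B v').le_opNorm _) (abs_nonneg _)
  rw [sub_apply] at hmono
  rw [inner_sub_left, inner_sub_left, h, h']
  linarith

variable {a : I → ℝ} {u v : I → V} {f : I → H} {a₀ : ℝ} {u₀ v₀ : V} {f₀ : H} {L : ℝ}

theorem StateEq.of_monotonically_related (hBh : Hemicontinuous B) (ha₀ : 0 < a₀)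
    (h : ∀ p, 0 ≤ ⟪f₀, ι (v₀ - p)⟫ - ⟪u₀, v₀ - p⟫ - a₀ * B p (v₀ - p)) :
    StateEq ι B a₀ u₀ v₀ f₀ := by
  have hgraph : a₀⁻¹ • (pivot ι f₀ - innerSL ℝ u₀) = B v₀ :=
    hBh.eq_of_monotonically_related fun p => by
      have hp := mul_nonneg (inv_nonneg.2 ha₀.le) (h p)
      rw [mul_sub, inv_mul_cancel_left₀ ha₀.ne'] at hp
      exact hp
  refine pivot_eq_iff_stateEq.1 ?_
  rw [← hgraph, smul_inv_smul₀ ha₀.ne']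
  exact (add_sub_cancel _ _).symm

variable [CompleteSpace V]

theorem StateEq.of_weaklyTendsto [F.NeBot] (hB : IsMonotoneOperator B) (hBh : Hemicontinuous B)
    (h : ∀ᶠ i in F, StateEq ι B (a i) (u i) (v i) (f i))
    (hvL : ∀ᶠ i in F, ‖v i‖ ≤ L) (hfL : ∀ᶠ i in F, ‖f i‖ ≤ L)
    (hu : Tendsto u F (𝓝 u₀)) (hv : WeaklyTendsto v F v₀)
    (hιv : Tendsto (fun i => ι (v i)) F (𝓝 (ι v₀))) (hf : WeaklyTendsto f F f₀)
    (ha : Tendsto a F (𝓝 a₀)) (ha₀ : 0 < a₀) : StateEq ι B a₀ u₀ v₀ f₀ := by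
  refine StateEq.of_monotonically_related hBh ha₀ fun p => ?_
  have huv : Tendsto (fun i => ⟪u i, v i - p⟫) F (𝓝 ⟪u₀, v₀ - p⟫) := by
    have hlim := (hv.inner hvL hu).sub (hu.inner (tendsto_const_nhds (x := p)))
    simpa only [inner_sub_right, real_inner_comm] using hlim
  have hfv := hf.inner hfL (hιv.sub_const (ι p))
  have hBv := ha.mul ((hv.apply (B p)).sub_const (B p p))
  simp only [← map_sub] at hfv hBv
  refine ge_of_tendsto ((hfv.sub huv).sub hBv) ?_
  filter_upwards [h, ha.eventually (lt_mem_nhds ha₀)] with i hi hai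
  have hmono := mul_nonneg hai.le (hB (v i) p)
  rw [sub_apply] at hmono
  rw [hi]
  linarith

variable [CompleteSpace H]

theorem StateEq.exists_limit_ultrafilter (hB : IsMonotoneOperator B) (hBh : Hemicontinuous B)
    {𝒰 : Ultrafilter I} {y : H} (h : ∀ᶠ i in (𝒰 : Filter I), StateEq ι B (a i) (u i) (v i) (f i))
    (hvL : ∀ᶠ i in (𝒰 : Filter I), ‖v i‖ ≤ L) (hfL : ∀ᶠ i in (𝒰 : Filter I), ‖f i‖ ≤ L)
    (hu : Tendsto u 𝒰 (𝓝 u₀)) (hy : Tendsto (fun i => ι (v i)) 𝒰 (𝓝 y))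
    (ha : Tendsto a 𝒰 (𝓝 a₀)) (ha₀ : 0 < a₀) :
    ∃ v₀ f₀, ι v₀ = y ∧ ‖v₀‖ ≤ L ∧ ‖f₀‖ ≤ L ∧ StateEq ι B a₀ u₀ v₀ f₀ ∧ WeaklyTendsto f 𝒰 f₀ := by
  obtain ⟨v₀, hv₀, hv⟩ := exists_weaklyTendsto_ultrafilter hvL
  obtain ⟨f₀, hf₀, hf⟩ := exists_weaklyTendsto_ultrafilter hfL
  obtain rfl : ι v₀ = y := (hv.map ι).unique (.of_tendsto hy)
  exact ⟨v₀, f₀, rfl, hv₀, hf₀, .of_weaklyTendsto hB hBh h hvL hfL hu hv hy hf ha ha₀, hf⟩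

theorem StateEq.exists_limit [F.NeBot] (hB : IsMonotoneOperator B) (hBh : Hemicontinuous B)
    {y : H} (h : ∀ᶠ i in F, StateEq ι B (a i) (u i) (v i) (f i))
    (hvL : ∀ᶠ i in F, ‖v i‖ ≤ L) (hfL : ∀ᶠ i in F, ‖f i‖ ≤ L)
    (hu : Tendsto u F (𝓝 u₀)) (hy : Tendsto (fun i => ι (v i)) F (𝓝 y))
    (ha : Tendsto a F (𝓝 a₀)) (ha₀ : 0 < a₀) :
    ∃ v₀ f₀, ι v₀ = y ∧ ‖v₀‖ ≤ L ∧ ‖f₀‖ ≤ L ∧ StateEq ι B a₀ u₀ v₀ f₀ := by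
  have hF := Ultrafilter.of_le F
  obtain ⟨v₀, f₀, hy₀, hv₀, hf₀, hstate, -⟩ := StateEq.exists_limit_ultrafilter hB hBh
    (h.filter_mono hF) (hvL.filter_mono hF) (hfL.filter_mono hF) (hu.mono_left hF)
    (hy.mono_left hF) (ha.mono_left hF) ha₀
  exact ⟨v₀, f₀, hy₀, hv₀, hf₀, hstate⟩

theorem StateEq.weaklyTendsto (hι : Function.Injective ι) (hιd : DenseRange ι)
    (hB : IsMonotoneOperator B) (hBh : Hemicontinuous B)
    (h : ∀ᶠ i in F, StateEq ι B (a i) (u i) (v i) (f i))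
    (hvL : ∀ᶠ i in F, ‖v i‖ ≤ L) (hfL : ∀ᶠ i in F, ‖f i‖ ≤ L)
    (hu : Tendsto u F (𝓝 u₀)) (hιv : Tendsto (fun i => ι (v i)) F (𝓝 (ι v₀)))
    (ha : Tendsto a F (𝓝 a₀)) (ha₀ : 0 < a₀) (h₀ : StateEq ι B a₀ u₀ v₀ f₀) :
    WeaklyTendsto v F v₀ ∧ WeaklyTendsto f F f₀ := by
  refine ⟨.of_map hι hvL (.of_tendsto hιv), weaklyTendsto_of_ultrafilter fun 𝒰 hF => ?_⟩
  obtain ⟨v₁, f₁, hv₁, -, -, hstate, hf⟩ := StateEq.exists_limit_ultrafilter hB hBh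
    (h.filter_mono hF) (hvL.filter_mono hF) (hfL.filter_mono hF) (hu.mono_left hF)
    (hιv.mono_left hF) (ha.mono_left hF) ha₀
  obtain rfl := hι hv₁
  rwa [h₀.unique hιd hstate]

end StateEquation

section OperatorAlgebra

variable {V : Type*} [NormedAddCommGroup V] [NormedSpace ℝ V] {B B' : V → StrongDual ℝ V}

theorem IsMonotoneOperator.add (hB : IsMonotoneOperator B) (hB' : IsMonotoneOperator B') :
    IsMonotoneOperator (B + B') := fun x y => by
  have h := add_nonneg (hB x y) (hB' x y)
  rwa [← add_apply, sub_add_sub_comm] at h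

theorem IsMonotoneOperator.const_smul (hB : IsMonotoneOperator B) {c : ℝ} (hc : 0 ≤ c) :
    IsMonotoneOperator (c • B) := fun x y => by
  have h := mul_nonneg hc (hB x y)
  rwa [← smul_eq_mul, ← smul_apply, smul_sub] at h

theorem Hemicontinuous.add (hB : Hemicontinuous B) (hB' : Hemicontinuous B') :
    Hemicontinuous (B + B') :=
  fun x h => (hB x h).add (hB' x h)

theorem Hemicontinuous.const_smul (hB : Hemicontinuous B) (c : ℝ) : Hemicontinuous (c • B) :=
  fun x h => (hB x h).const_mul c

theorem Hemicontinuous.of_continuous (hB : Continuous B) : Hemicontinuous B := fun x h =>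
  Tendsto.mono_left (Continuous.tendsto' (by fun_prop) 0 _ (by rw [zero_smul, add_zero]))
    nhdsWithin_le_nhds

end OperatorAlgebra

section EulerScheme

variable {V H : Type*} [NormedAddCommGroup V] [InnerProductSpace ℝ V]
  [NormedAddCommGroup H] [InnerProductSpace ℝ H] {ι : V →L[ℝ] H} {B : V → StrongDual ℝ V}

theorem isMonotoneOperator_pivot_sub_add (ι : V →L[ℝ] H) (w : H) (l : StrongDual ℝ V) :
    IsMonotoneOperator fun x => pivot ι (ι x - w) + l := fun x y => by
  have hdiff : (pivot ι (ι x - w) + l) - (pivot ι (ι y - w) + l) = pivot ι (ι (x - y)) := by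
    ext z
    simp only [pivot, sub_apply, add_apply, ContinuousLinearMap.comp_apply, innerSL_apply_apply,
      map_sub]
    ring
  rw [hdiff]
  exact real_inner_self_nonneg

theorem continuous_pivot_sub_add (ι : V →L[ℝ] H) (w : H) (l : StrongDual ℝ V) :
    Continuous fun x => pivot ι (ι x - w) + l := by
  unfold pivot
  fun_prop

theorem exists_backward_euler_step [CompleteSpace V] (hB : IsMonotoneOperator B)
    (hBh : Hemicontinuous B) {h a : ℝ} (hh : 0 < h) (ha : 0 < a) (u v : V) :
    ∃ v' f, StateEq ι B a (u + h • v') v' f ∧ ι v' = ι v - h • f := by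
  set Q : V → StrongDual ℝ V := fun x => pivot ι (ι x - ι v) + h • innerSL ℝ u
  have hmono : IsMonotoneOperator ((h ^ 2)⁻¹ • Q + (a / h) • B) :=
    ((isMonotoneOperator_pivot_sub_add ι _ _).const_smul (by positivity)).add
      (hB.const_smul (by positivity))
  have hhemi : Hemicontinuous ((h ^ 2)⁻¹ • Q + (a / h) • B) :=
    ((Hemicontinuous.of_continuous (continuous_pivot_sub_add ι _ _)).const_smul _).add
      (hBh.const_smul _)
  obtain ⟨v', hv'⟩ := hmono.exists_innerSL_add_eq_zero hhemi
  refine ⟨v', (-h⁻¹) • (ι v' - ι v), fun x => ?_, ?_⟩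
  · have hx : ⟪v', x⟫ + ((h ^ 2)⁻¹ * (⟪ι v' - ι v, ι x⟫ + h * ⟪u, x⟫) + a / h * B v' x) = 0 :=
      congrArg (fun l : StrongDual ℝ V => l x) hv'
    rw [real_inner_smul_left, inner_add_left, real_inner_smul_left]
    field_simp at hx ⊢
    linarith
  · rw [neg_smul, smul_neg, smul_inv_smul₀ hh.ne', sub_neg_eq_add, add_sub_cancel]

/-- The backward Euler scheme of step `h` for the first order system `u' = v`, `v' = -f`,
`f = A u + α B v`. -/
structure IsScheme (ι : V →L[ℝ] H) (B : V → StrongDual ℝ V) (α : ℝ → ℝ) (h : ℝ)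
    (u v : ℕ → V) (f : ℕ → H) : Prop where
  state : ∀ n : ℕ, StateEq ι B (α (n * h)) (u n) (v n) (f n)
  step_u : ∀ n, u (n + 1) = u n + h • v (n + 1)
  step_v : ∀ n, ι (v (n + 1)) = ι (v n) - h • f (n + 1)

variable {α : ℝ → ℝ} {h : ℝ}

theorem exists_isScheme [CompleteSpace V] (hB : IsMonotoneOperator B) (hBh : Hemicontinuous B)
    (hα : ∀ t ∈ Ici (0 : ℝ), 0 < α t) {u₀ v₀ : V} {f₀ : H} (h₀ : StateEq ι B (α 0) u₀ v₀ f₀)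
    (hh : 0 < h) : ∃ u v f, IsScheme ι B α h u v f ∧ u 0 = u₀ ∧ v 0 = v₀ ∧ f 0 = f₀ := by
  have hpos : ∀ n : ℕ, 0 < α ((n + 1 : ℕ) * h) := fun n => hα _ (mem_Ici.2 (by positivity))
  choose nextV nextF hstate hstep using fun (n : ℕ) (p : V × V × H) =>
    exists_backward_euler_step (ι := ι) hB hBh hh (hpos n) p.1 p.2.1
  set z : ℕ → V × V × H := fun n => Nat.rec (u₀, v₀, f₀)
    (fun n p => (p.1 + h • nextV n p, nextV n p, nextF n p)) n
  refine ⟨fun n => (z n).1, fun n => (z n).2.1, fun n => (z n).2.2,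
    ⟨?_, fun n => rfl, fun n => hstep n (z n)⟩, rfl, rfl, rfl⟩
  rintro (_ | n)
  · rw [Nat.cast_zero, zero_mul]
    exact h₀
  · exact hstate n (z n)

theorem norm_sq_sub_norm_sq_le_two_inner {E : Type*} [NormedAddCommGroup E]
    [InnerProductSpace ℝ E] (x y : E) : ‖x‖ ^ 2 - ‖y‖ ^ 2 ≤ 2 * ⟪x, x - y⟫ := by
  rw [inner_sub_right, real_inner_self_eq_norm_sq]
  linarith [norm_sub_sq_real x y, sq_nonneg ‖x - y‖]

variable {u v : ℕ → V} {f : ℕ → H}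

theorem IsScheme.energy_succ_le (hB : IsMonotoneOperator B) (hB0 : B 0 = 0)
    (hα : ∀ t ∈ Ici (0 : ℝ), 0 < α t) (hh : 0 ≤ h) (hs : IsScheme ι B α h u v f) (n : ℕ) :
    ‖u (n + 1)‖ ^ 2 + ‖ι (v (n + 1))‖ ^ 2 ≤ ‖u n‖ ^ 2 + ‖ι (v n)‖ ^ 2 := by
  have hu := norm_sq_sub_norm_sq_le_two_inner (u (n + 1)) (u n)
  have hv := norm_sq_sub_norm_sq_le_two_inner (ι (v (n + 1))) (ι (v n))
  have hdu : u (n + 1) - u n = h • v (n + 1) := sub_eq_of_eq_add' (hs.step_u n)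
  have hdv : ι (v (n + 1)) - ι (v n) = -(h • f (n + 1)) := by
    rw [hs.step_v, sub_sub_cancel_left]
  rw [hdu, inner_smul_right] at hu
  rw [hdv, inner_neg_right, inner_smul_right, real_inner_comm, hs.state] at hv
  have hBv := hB (v (n + 1)) 0
  rw [hB0, sub_zero, sub_zero] at hBv
  have hdiss := mul_nonneg hh
    (mul_nonneg (hα ((n + 1 : ℕ) * h) (mem_Ici.2 (by positivity))).le hBv)
  linarith

theorem IsScheme.energy_le (hB : IsMonotoneOperator B) (hB0 : B 0 = 0)
    (hα : ∀ t ∈ Ici (0 : ℝ), 0 < α t) (hh : 0 ≤ h) (hs : IsScheme ι B α h u v f) (n : ℕ) :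
    ‖u n‖ ^ 2 + ‖ι (v n)‖ ^ 2 ≤ ‖u 0‖ ^ 2 + ‖ι (v 0)‖ ^ 2 :=
  antitone_nat_of_succ_le (f := fun n => ‖u n‖ ^ 2 + ‖ι (v n)‖ ^ 2)
    (hs.energy_succ_le hB hB0 hα hh) n.zero_le

end EulerScheme

section Coefficient

/-- Bounds with constant `C` on `[0, T]` for a coefficient `α` and for the derivative `γ` of
`1 / α`. -/
structure CoeffBound (α γ : ℝ → ℝ) (T C : ℝ) : Prop where
  one_le : 1 ≤ C
  pos : ∀ t ∈ Icc 0 T, 0 < α t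
  le : ∀ t ∈ Icc 0 T, α t ≤ C
  inv_le : ∀ t ∈ Icc 0 T, (α t)⁻¹ ≤ C
  abs_deriv_le : ∀ t ∈ Icc 0 T, |γ t| ≤ C
  lipschitz : ∀ s ∈ Icc 0 T, ∀ t ∈ Icc 0 T, |α t - α s| ≤ C * |t - s|
  lipschitz_inv : ∀ s ∈ Icc 0 T, ∀ t ∈ Icc 0 T, |(α t)⁻¹ - (α s)⁻¹| ≤ C * |t - s|
  lipschitz_deriv : ∀ s ∈ Icc 0 T, ∀ t ∈ Icc 0 T, |γ t - γ s| ≤ C * |t - s|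
  taylor : ∀ s ∈ Icc 0 T, ∀ t ∈ Icc 0 T,
    |(α t)⁻¹ - (α s)⁻¹ - γ t * (t - s)| ≤ C * (t - s) ^ 2

/-- The bounds that `CoeffBound` gives between two times at distance `h`, where `α` takes the
values `a` and `a'`, and `γ` the values `c` and `c'`. -/
structure CoeffStep (C h a c a' c' : ℝ) : Prop where
  one_le : 1 ≤ C
  pos : 0 < a
  pos' : 0 < a'
  le : a ≤ C
  le' : a' ≤ C
  inv_le' : a'⁻¹ ≤ C
  abs_deriv_le : |c| ≤ C
  abs_deriv_le' : |c'| ≤ C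
  abs_inv_sub_le : |a'⁻¹ - a⁻¹| ≤ C * h
  abs_deriv_sub_le : |c' - c| ≤ C * h
  taylor : |a'⁻¹ - a⁻¹ - c' * h| ≤ C * h ^ 2

theorem CoeffBound.coeffStep {α γ : ℝ → ℝ} {T C s t : ℝ} (hC : CoeffBound α γ T C)
    (hs : s ∈ Icc 0 T) (ht : t ∈ Icc 0 T) (hst : s ≤ t) :
    CoeffStep C (t - s) (α s) (γ s) (α t) (γ t) := by
  have habs : |t - s| = t - s := abs_of_nonneg (sub_nonneg.2 hst)
  exact ⟨hC.one_le, hC.pos s hs, hC.pos t ht, hC.le s hs, hC.le t ht, hC.inv_le t ht,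
    hC.abs_deriv_le s hs, hC.abs_deriv_le t ht, habs ▸ hC.lipschitz_inv s hs t ht,
    habs ▸ hC.lipschitz_deriv s hs t ht, hC.taylor s hs t ht⟩

theorem CoeffStep.nonneg {C h a c a' c' : ℝ} (hC : CoeffStep C h a c a' c') : 0 ≤ C :=
  zero_le_one.trans hC.one_le

end Coefficient

section Rate

variable {V H : Type*} [NormedAddCommGroup V] [InnerProductSpace ℝ V]
  [NormedAddCommGroup H] [InnerProductSpace ℝ H] {ι : V →L[ℝ] H} {B : V → StrongDual ℝ V}

/-- The Lyapunov function `‖v / α + (1 / α)' u‖² + ‖f / α‖²`, for the values `a` of `α` and `c` of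
`(1 / α)'`. Its first term is the squared norm of `(u / α)'`. -/
def rate (a c : ℝ) (u v : V) (f : H) : ℝ := ‖a⁻¹ • v + c • u‖ ^ 2 + ‖a⁻¹ • f‖ ^ 2

theorem rate_nonneg (a c : ℝ) (u v : V) (f : H) : 0 ≤ rate a c u v f :=
  add_nonneg (sq_nonneg _) (sq_nonneg _)

theorem norm_le_norm_inv_smul_add {a c C : ℝ} (hC : 1 ≤ C) (ha : 0 < a) (haC : a ≤ C)
    (hc : |c| ≤ C) (u v : V) : ‖v‖ ≤ C ^ 2 * (‖a⁻¹ • v + c • u‖ + ‖u‖) := by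
  have : 0 ≤ C := zero_le_one.trans hC
  have hCC : C ≤ C ^ 2 := le_self_pow₀ hC two_ne_zero
  calc ‖v‖ = ‖a • (a⁻¹ • v + c • u) - (a * c) • u‖ := by
        rw [smul_add, smul_inv_smul₀ ha.ne', smul_smul, add_sub_cancel_right]
    _ ≤ a * ‖a⁻¹ • v + c • u‖ + a * |c| * ‖u‖ := by
        refine (norm_sub_le _ _).trans_eq ?_
        rw [norm_smul, norm_smul, Real.norm_eq_abs, Real.norm_eq_abs, abs_mul, abs_of_pos ha]
    _ ≤ C ^ 2 * ‖a⁻¹ • v + c • u‖ + C * C * ‖u‖ := by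
        gcongr
        exact haC.trans hCC
    _ = C ^ 2 * (‖a⁻¹ • v + c • u‖ + ‖u‖) := by ring

theorem norm_le_of_rate_le {a c C M : ℝ} {u v : V} {f : H} (hC : 1 ≤ C) (ha : 0 < a)
    (haC : a ≤ C) (hc : |c| ≤ C) (h : rate a c u v f ≤ M ^ 2) (hu : ‖u‖ ≤ M) :
    ‖v‖ ≤ 2 * C ^ 2 * M ∧ ‖f‖ ≤ 2 * C ^ 2 * M := by
  have hM : 0 ≤ M := (norm_nonneg _).trans hu
  have hp : ‖a⁻¹ • v + c • u‖ ≤ M :=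
    le_of_sq_le_sq ((le_add_of_nonneg_right (sq_nonneg _)).trans h) hM
  have hf : ‖a⁻¹ • f‖ ≤ M :=
    le_of_sq_le_sq ((le_add_of_nonneg_left (sq_nonneg _)).trans h) hM
  constructor
  · calc ‖v‖ ≤ C ^ 2 * (‖a⁻¹ • v + c • u‖ + ‖u‖) := norm_le_norm_inv_smul_add hC ha haC hc u v
      _ ≤ C ^ 2 * (M + M) := by gcongr
      _ = 2 * C ^ 2 * M := by ring
  · calc ‖f‖ = a * ‖a⁻¹ • f‖ := by
          rw [← Real.norm_of_nonneg ha.le, ← norm_smul, Real.norm_of_nonneg ha.le,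
            smul_inv_smul₀ ha.ne']
      _ ≤ C ^ 2 * M := by
          gcongr
          exact haC.trans (le_self_pow₀ hC two_ne_zero)
      _ ≤ 2 * C ^ 2 * M := by linarith [mul_nonneg (sq_nonneg C) hM]

theorem norm_smul_add_smul_add_smul_le {x y z K : ℝ} (hx : |x| ≤ K) (hy : |y| ≤ K)
    (hz : |z| ≤ K) (p q r : V) : ‖x • p + y • q + z • r‖ ≤ K * (‖p‖ + ‖q‖ + ‖r‖) := by
  calc ‖x • p + y • q + z • r‖ ≤ |x| * ‖p‖ + |y| * ‖q‖ + |z| * ‖r‖ := by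
        simpa only [norm_smul, Real.norm_eq_abs] using
          norm_add₃_le (a := x • p) (b := y • q) (c := z • r)
    _ ≤ K * ‖p‖ + K * ‖q‖ + K * ‖r‖ := by gcongr
    _ = K * (‖p‖ + ‖q‖ + ‖r‖) := by ring

theorem norm_sq_add_norm_sq_sub_le_of_inner_nonpos {p p' e r : V} {g g' : H}
    (h : ⟪p' + e, p' - p - r⟫ + ⟪g', g' - g⟫ ≤ 0) :
    ‖p'‖ ^ 2 + ‖g'‖ ^ 2 - (‖p‖ ^ 2 + ‖g‖ ^ 2) ≤ 2 * (‖p'‖ * ‖r‖ + ‖e‖ * ‖p' - p - r‖) := by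
  rw [inner_add_left, inner_sub_right p'] at h
  have he : -⟪e, p' - p - r⟫ ≤ ‖e‖ * ‖p' - p - r‖ :=
    (neg_le_abs _).trans (abs_real_inner_le_norm _ _)
  linarith [norm_sq_sub_norm_sq_le_two_inner p' p, norm_sq_sub_norm_sq_le_two_inner g' g,
    real_inner_le_norm p' r]

theorem StateEq.inv_smul {a : ℝ} {u v : V} {f : H} (ha : a ≠ 0) (h : StateEq ι B a u v f) :
    StateEq ι B 1 (a⁻¹ • u) v (a⁻¹ • f) := fun x => by
  rw [real_inner_smul_left, real_inner_smul_left, h, mul_add, inv_mul_cancel_left₀ ha, one_mul]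

variable {a c a' c' C h : ℝ} {u v u' v' : V} {f f' : H}

theorem StateEq.inner_euler_step_le (hB : IsMonotoneOperator B) (ha : a ≠ 0) (ha' : a' ≠ 0)
    (hs : StateEq ι B a u v f) (hs' : StateEq ι B a' u' v' f') (hv : ι v' = ι v - h • f') :
    ⟪a'⁻¹ • u' - a⁻¹ • u, v' - v⟫ + h * ⟪f', a'⁻¹ • f' - a⁻¹ • f⟫ ≤ 0 := by
  have hmono := (hs'.inv_smul ha').inner_sub_le hB zero_le_one (hs.inv_smul ha)
  rwa [sub_self, abs_zero, zero_mul, map_sub, hv, sub_sub_cancel_left, inner_neg_right,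
    sub_neg_eq_add, inner_smul_right, real_inner_comm f'] at hmono

theorem StateEq.inner_perturbed_euler_step_le (hB : IsMonotoneOperator B) (hh : 0 < h)
    (ha : a ≠ 0) (ha' : 0 < a') (hs : StateEq ι B a u v f) (hs' : StateEq ι B a' u' v' f')
    (hv : ι v' = ι v - h • f') {p p' e r : V} (hpos : a'⁻¹ • u' - a⁻¹ • u = h • (p' + e))
    (hvel : a'⁻¹ • (v' - v) = p' - p - r) :
    ⟪p' + e, p' - p - r⟫ + ⟪a'⁻¹ • f', a'⁻¹ • f' - a⁻¹ • f⟫ ≤ 0 := by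
  have hmono := hs.inner_euler_step_le hB ha ha'.ne' hs' hv
  rw [hpos, real_inner_smul_left, ← mul_add] at hmono
  rw [← hvel, inner_smul_right, real_inner_smul_left, ← mul_add]
  exact mul_nonpos_of_nonneg_of_nonpos (inv_pos.2 ha').le (nonpos_of_mul_nonpos_right hmono hh)

theorem rate_sub_le (hB : IsMonotoneOperator B) (hC : CoeffStep C h a c a' c') (hh : 0 < h)
    (hs : StateEq ι B a u v f) (hs' : StateEq ι B a' u' v' f') (hu : u' = u + h • v')
    (hv : ι v' = ι v - h • f') :
    rate a' c' u' v' f' - rate a c u v f ≤ 4 * C ^ 2 * h * (‖u'‖ + ‖v'‖ + ‖v‖) ^ 2 := by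
  have hC₀ := hC.nonneg
  have hChn : 0 ≤ C * h := by positivity
  obtain rfl : u = u' - h • v' := by rw [hu, add_sub_cancel_right]
  set p := a⁻¹ • v + c • (u' - h • v') with hp
  set p' := a'⁻¹ • v' + c' • u' with hp'
  set e := (h⁻¹ * (a'⁻¹ - a⁻¹ - c' * h)) • u' + (-(a'⁻¹ - a⁻¹)) • v' + (0 : ℝ) • v with he
  set r := (c' - c) • u' + (c * h) • v' + (a'⁻¹ - a⁻¹) • v with hr
  set S := ‖u'‖ + ‖v'‖ + ‖v‖
  have hposition : a'⁻¹ • u' - a⁻¹ • (u' - h • v') = h • (p' + e) := by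
    rw [he, hp']
    match_scalars <;> field_simp <;> ring
  have hvelocity : a'⁻¹ • (v' - v) = p' - p - r := by
    rw [hp, hp', hr]
    match_scalars <;> ring
  have he_norm : ‖e‖ ≤ C * h * S := by
    refine norm_smul_add_smul_add_smul_le ?_ ((abs_neg _).trans_le hC.abs_inv_sub_le)
      (abs_zero.trans_le hChn) _ _ _
    rw [abs_mul, abs_of_pos (inv_pos.2 hh), inv_mul_le_iff₀ hh]
    exact hC.taylor.trans_eq (by ring)
  have hr_norm : ‖r‖ ≤ C * h * S := by
    refine norm_smul_add_smul_add_smul_le hC.abs_deriv_sub_le ?_ hC.abs_inv_sub_le _ _ _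
    rw [abs_mul, abs_of_pos hh]
    exact mul_le_mul_of_nonneg_right hC.abs_deriv_le hh.le
  have ha'_inv : |a'⁻¹| ≤ C := (abs_of_pos (inv_pos.2 hC.pos')).trans_le hC.inv_le'
  have hp'_norm : ‖p'‖ ≤ C * S := by
    have hle := norm_smul_add_smul_add_smul_le hC.abs_deriv_le' ha'_inv
      (abs_zero.trans_le hC₀) u' v' v
    rwa [zero_smul, add_zero, add_comm (c' • u')] at hle
  have hvel_norm : ‖p' - p - r‖ ≤ C * S := by
    have hle := norm_smul_add_smul_add_smul_le (abs_zero.trans_le hC₀) ha'_inv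
      ((abs_neg _).trans_le ha'_inv) u' v' v
    rwa [zero_smul, zero_add, neg_smul, ← sub_eq_add_neg, ← smul_sub, hvelocity] at hle
  calc rate a' c' u' v' f' - rate a c (u' - h • v') v f
      ≤ 2 * (‖p'‖ * ‖r‖ + ‖e‖ * ‖p' - p - r‖) :=
        norm_sq_add_norm_sq_sub_le_of_inner_nonpos
          (hs.inner_perturbed_euler_step_le hB hh hC.pos.ne' hC.pos' hs' hv hposition hvelocity)
    _ ≤ 2 * (C * S * (C * h * S) + C * h * S * (C * S)) := by gcongr
    _ = 4 * C ^ 2 * h * S ^ 2 := by ring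

theorem norm_add_norm_add_norm_le (hC : CoeffStep C h a c a' c') (u v u' v' : V) :
    ‖u'‖ + ‖v'‖ + ‖v‖ ≤
      2 * C ^ 2 * (‖a'⁻¹ • v' + c' • u'‖ + ‖u'‖ + ‖a⁻¹ • v + c • u‖ + ‖u‖) := by
  have hv := norm_le_norm_inv_smul_add hC.one_le hC.pos hC.le hC.abs_deriv_le u v
  have hv' := norm_le_norm_inv_smul_add hC.one_le hC.pos' hC.le' hC.abs_deriv_le' u' v'
  have hu' : ‖u'‖ ≤ C ^ 2 * ‖u'‖ :=
    le_mul_of_one_le_left (norm_nonneg _) (one_le_pow₀ hC.one_le)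
  have hrest : 0 ≤ C ^ 2 * (‖a'⁻¹ • v' + c' • u'‖ + ‖a⁻¹ • v + c • u‖ + ‖u‖) := by positivity
  linarith

theorem sq_norm_add_norm_add_norm_le {K : ℝ} (hC : CoeffStep C h a c a' c')
    (hK : ‖u‖ ^ 2 ≤ K) (hK' : ‖u'‖ ^ 2 ≤ K) :
    (‖u'‖ + ‖v'‖ + ‖v‖) ^ 2 ≤
      16 * C ^ 4 * ((rate a' c' u' v' f' + K) + (rate a c u v f + K)) := by
  set P := ‖a⁻¹ • v + c • u‖ with hP
  set P' := ‖a'⁻¹ • v' + c' • u'‖ with hP'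
  have hsq : (P' + ‖u'‖ + P + ‖u‖) ^ 2 ≤
      4 * ((rate a' c' u' v' f' + K) + (rate a c u v f + K)) := by
    rw [rate, rate, ← hP, ← hP']
    linarith [sq_nonneg (P' - ‖u'‖), sq_nonneg (P' - P), sq_nonneg (P' - ‖u‖),
      sq_nonneg (‖u'‖ - P), sq_nonneg (‖u'‖ - ‖u‖), sq_nonneg (P - ‖u‖),
      sq_nonneg ‖a⁻¹ • f‖, sq_nonneg ‖a'⁻¹ • f'‖]
  calc (‖u'‖ + ‖v'‖ + ‖v‖) ^ 2 ≤ (2 * C ^ 2 * (P' + ‖u'‖ + P + ‖u‖)) ^ 2 :=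
        pow_le_pow_left₀ (by positivity) (norm_add_norm_add_norm_le hC u v u' v') 2
    _ = 4 * C ^ 4 * (P' + ‖u'‖ + P + ‖u‖) ^ 2 := by ring
    _ ≤ 4 * C ^ 4 * (4 * ((rate a' c' u' v' f' + K) + (rate a c u v f + K))) := by gcongr
    _ = 16 * C ^ 4 * ((rate a' c' u' v' f' + K) + (rate a c u v f + K)) := by ring

theorem rate_add_sub_le {K : ℝ} (hB : IsMonotoneOperator B) (hC : CoeffStep C h a c a' c')
    (hh : 0 < h) (hs : StateEq ι B a u v f) (hs' : StateEq ι B a' u' v' f')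
    (hu : u' = u + h • v') (hv : ι v' = ι v - h • f') (hK : ‖u‖ ^ 2 ≤ K) (hK' : ‖u'‖ ^ 2 ≤ K) :
    rate a' c' u' v' f' + K - (rate a c u v f + K) ≤
      64 * C ^ 6 * h * ((rate a' c' u' v' f' + K) + (rate a c u v f + K)) := by
  rw [add_sub_add_right_eq_sub]
  refine (rate_sub_le hB hC hh hs hs' hu hv).trans ?_
  calc 4 * C ^ 2 * h * (‖u'‖ + ‖v'‖ + ‖v‖) ^ 2
      ≤ 4 * C ^ 2 * h * (16 * C ^ 4 * ((rate a' c' u' v' f' + K) + (rate a c u v f + K))) := by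
        gcongr
        exact sq_norm_add_norm_add_norm_le hC hK hK'
    _ = 64 * C ^ 6 * h * ((rate a' c' u' v' f' + K) + (rate a c u v f + K)) := by ring

theorem le_exp_mul_of_sub_le {x y k : ℝ} (hk₀ : 0 ≤ k) (hk : k ≤ 1 / 2) (hx : 0 ≤ x)
    (h : y - x ≤ k * (y + x)) : y ≤ Real.exp (3 * k) * x := by
  have hexp : 1 + k ≤ Real.exp k := by linarith [Real.add_one_le_exp k]
  have hexp_inv : 1 ≤ (1 - k) * Real.exp (2 * k) := by
    nlinarith [Real.add_one_le_exp (2 * k)]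
  refine le_of_mul_le_mul_left ?_ (show 0 < 1 - k by linarith)
  calc (1 - k) * y ≤ (1 + k) * x := by linarith
    _ ≤ Real.exp k * x := by gcongr
    _ ≤ Real.exp k * x * ((1 - k) * Real.exp (2 * k)) :=
      le_mul_of_one_le_right (by positivity) hexp_inv
    _ = (1 - k) * (Real.exp (k + 2 * k) * x) := by rw [Real.exp_add]; ring
    _ = (1 - k) * (Real.exp (3 * k) * x) := by ring_nf

theorem IsScheme.rate_add_le {α γ : ℝ → ℝ} {T K : ℝ} {u v : ℕ → V} {f : ℕ → H}
    (hB : IsMonotoneOperator B) (hC : CoeffBound α γ T C) (hh : 0 < h)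
    (hhC : 64 * C ^ 6 * h ≤ 1 / 2) (hs : IsScheme ι B α h u v f) (hK : ∀ n, ‖u n‖ ^ 2 ≤ K) (n : ℕ)
    (hn : n * h ≤ T) :
    rate (α (n * h)) (γ (n * h)) (u n) (v n) (f n) + K ≤
      Real.exp (192 * C ^ 6 * (n * h)) * (rate (α 0) (γ 0) (u 0) (v 0) (f 0) + K) := by
  have : 0 ≤ C := zero_le_one.trans hC.one_le
  have hK₀ : 0 ≤ K := (sq_nonneg _).trans (hK 0)
  induction n with
  | zero => simp only [Nat.cast_zero, zero_mul, mul_zero, Real.exp_zero, one_mul, le_refl]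
  | succ n ih =>
    have hle : (n : ℝ) * h ≤ (n + 1 : ℕ) * h := by gcongr; exact n.le_succ
    have hstep := hC.coeffStep ⟨by positivity, hle.trans hn⟩ ⟨by positivity, hn⟩ hle
    rw [← sub_mul, Nat.cast_succ, add_sub_cancel_left, one_mul, ← Nat.cast_succ] at hstep
    have hrate := rate_add_sub_le hB hstep hh (hs.state n) (hs.state (n + 1)) (hs.step_u n)
      (hs.step_v n) (hK n) (hK (n + 1))
    calc _ ≤ Real.exp (3 * (64 * C ^ 6 * h)) *
          (rate (α (n * h)) (γ (n * h)) (u n) (v n) (f n) + K) :=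
          le_exp_mul_of_sub_le (by positivity) hhC (add_nonneg (rate_nonneg _ _ _ _ _) hK₀) hrate
      _ ≤ Real.exp (3 * (64 * C ^ 6 * h)) * (Real.exp (192 * C ^ 6 * (n * h)) *
          (rate (α 0) (γ 0) (u 0) (v 0) (f 0) + K)) := by
          gcongr
          exact ih (hle.trans hn)
      _ = _ := by
          rw [← mul_assoc, ← Real.exp_add]
          push_cast
          ring_nf

end Rate

section Halving

variable {V H : Type*} [NormedAddCommGroup V] [InnerProductSpace ℝ V]
  [NormedAddCommGroup H] [InnerProductSpace ℝ H] {ι : V →L[ℝ] H} {B : V → StrongDual ℝ V}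

theorem inner_sub_smul_le {E : Type*} [NormedAddCommGroup E] [InnerProductSpace ℝ E] {k : ℝ}
    (hk : 0 ≤ k) (x w d : E) : ⟪x - k • w, d⟫ ≤ ⟪x, d⟫ + k * (‖w‖ * ‖d‖) := by
  rw [inner_sub_left, real_inner_smul_left, sub_eq_add_neg, ← mul_neg]
  gcongr
  exact (neg_le_abs _).trans (abs_real_inner_le_norm _ _)

/-- One step of a coarse scheme against two steps of length `k` of a fine one: `x₀`, `x₁`, `x₂`
are the differences of the positions before and after each of the two fine steps, `d₁` and `d₂`
those of the velocities, `g₁` and `g₂` those of the forces, while `w` and `z` are the velocity and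
the force of the second fine step. -/
theorem energy_le_of_two_half_steps {k E : ℝ} (hk : 0 ≤ k) {x₀ x₁ x₂ d₁ d₂ w : V}
    {g₁ g₂ y₀ z : H} (hx : x₂ - x₀ = k • (d₁ + d₂)) (hy : ι d₂ - y₀ = -(k • (g₁ + g₂)))
    (hx₁ : x₂ = x₁ - k • w) (hy₁ : ι d₂ = ι d₁ + k • z) (h₁ : ⟪x₁, d₁⟫ - ⟪g₁, ι d₁⟫ ≤ E)
    (h₂ : ⟪x₂, d₂⟫ - ⟪g₂, ι d₂⟫ ≤ 0) :
    ‖x₂‖ ^ 2 + ‖ι d₂‖ ^ 2 ≤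
      ‖x₀‖ ^ 2 + ‖y₀‖ ^ 2 + 2 * (k * (E + k * (‖w‖ * ‖d₁‖ + ‖z‖ * ‖g₁‖))) := by
  have hposition := norm_sq_sub_norm_sq_le_two_inner x₂ x₀
  have hvelocity := norm_sq_sub_norm_sq_le_two_inner (ι d₂) y₀
  rw [hx, inner_smul_right, inner_add_right] at hposition
  rw [hy, inner_neg_right, inner_smul_right, inner_add_right, real_inner_comm g₂] at hvelocity
  have hx_cross : ⟪x₂, d₁⟫ ≤ ⟪x₁, d₁⟫ + k * (‖w‖ * ‖d₁‖) := hx₁ ▸ inner_sub_smul_le hk x₁ w d₁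
  have hy_cross : -⟪ι d₂, g₁⟫ ≤ -⟪g₁, ι d₁⟫ + k * (‖z‖ * ‖g₁‖) := by
    have hle := inner_sub_smul_le hk (-ι d₁) z g₁
    rwa [← neg_add', ← hy₁, inner_neg_left, inner_neg_left, real_inner_comm g₁ (ι d₁)] at hle
  have hsum : ⟪x₂, d₁⟫ + ⟪x₂, d₂⟫ - ⟪ι d₂, g₁⟫ - ⟪g₂, ι d₂⟫ ≤
      E + k * (‖w‖ * ‖d₁‖ + ‖z‖ * ‖g₁‖) := by linarith
  linarith [mul_le_mul_of_nonneg_left hsum hk]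

variable {α γ : ℝ → ℝ} {T C L R h : ℝ} {u v u' v' : ℕ → V} {f f' : ℕ → H}

theorem IsScheme.energy_sub_half_succ_le (hB : IsMonotoneOperator B) (hC : CoeffBound α γ T C)
    (hh : 0 ≤ h) (hs : IsScheme ι B α h u v f) (hs' : IsScheme ι B α (h / 2) u' v' f')
    (hL : ∀ n : ℕ, n * h ≤ T → ‖v n‖ ≤ L ∧ ‖f n‖ ≤ L)
    (hL' : ∀ n : ℕ, n * (h / 2) ≤ T → ‖v' n‖ ≤ L ∧ ‖f' n‖ ≤ L)
    (hR : ∀ x, ‖x‖ ≤ L → ‖B x‖ ≤ R) (n : ℕ) (hn : (n + 1 : ℕ) * h ≤ T) :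
    ‖u (n + 1) - u' (2 * n + 2)‖ ^ 2 + ‖ι (v (n + 1) - v' (2 * n + 2))‖ ^ 2 ≤
      ‖u n - u' (2 * n)‖ ^ 2 + ‖ι (v n - v' (2 * n))‖ ^ 2 +
        h * ((C * R * L + 2 * L ^ 2) * h) := by
  have ht₂ : ((2 * n + 2 : ℕ) : ℝ) * (h / 2) = (n + 1 : ℕ) * h := by push_cast; ring
  have ht₁ : ((n + 1 : ℕ) : ℝ) * h - (2 * n + 1 : ℕ) * (h / 2) = h / 2 := by push_cast; ring
  have hn_mem : ((n + 1 : ℕ) : ℝ) * h ∈ Icc 0 T := ⟨by positivity, hn⟩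
  have hm_mem : ((2 * n + 1 : ℕ) : ℝ) * (h / 2) ∈ Icc 0 T := ⟨by positivity, by linarith⟩
  obtain ⟨hv, hf⟩ := hL _ hn
  obtain ⟨hv₁, hf₁⟩ := hL' _ hm_mem.2
  obtain ⟨hv₂, hf₂⟩ := hL' (2 * n + 2) (ht₂.trans_le hn)
  have hL₀ : 0 ≤ L := (norm_nonneg _).trans hv
  have : 0 ≤ C := zero_le_one.trans hC.one_le
  have hR₀ : 0 ≤ R := (norm_nonneg _).trans (hR _ hv₁)
  have hdv : ‖v (n + 1) - v' (2 * n + 1)‖ ≤ 2 * L := (norm_sub_le _ _).trans (by linarith)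
  have hdf : ‖f (n + 1) - f' (2 * n + 1)‖ ≤ 2 * L := (norm_sub_le _ _).trans (by linarith)
  have hmono₁ := (hs.state (n + 1)).inner_sub_le hB (hC.pos _ hn_mem).le (hs'.state (2 * n + 1))
  have hmono₂ := (hs.state (n + 1)).inner_sub_le hB (hC.pos _ hn_mem).le (hs'.state (2 * n + 2))
  rw [ht₂, sub_self, abs_zero, zero_mul] at hmono₂
  have hcoeff := hC.lipschitz _ hm_mem _ hn_mem
  rw [ht₁, abs_of_nonneg (div_nonneg hh zero_le_two)] at hcoeff
  refine (energy_le_of_two_half_steps (k := h / 2) (w := v' (2 * n + 2)) (z := f' (2 * n + 2))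
    (x₀ := u n - u' (2 * n)) (y₀ := ι (v n - v' (2 * n))) (E := C * (h / 2) * (R * (2 * L)))
    (by positivity) ?_ ?_ ?_ ?_ (hmono₁.trans ?_) hmono₂).trans ?_
  · rw [hs.step_u, hs'.step_u (2 * n + 1), hs'.step_u (2 * n)]
    match_scalars <;> ring
  · rw [map_sub, map_sub, hs.step_v, hs'.step_v (2 * n + 1), hs'.step_v (2 * n)]
    match_scalars <;> ring
  · rw [hs'.step_u (2 * n + 1), sub_add_eq_sub_sub]
  · rw [map_sub, map_sub, hs'.step_v (2 * n + 1), sub_sub_eq_add_sub, sub_add_eq_add_sub]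
  · gcongr
    exact hR _ hv₁
  · have hcross : ‖v' (2 * n + 2)‖ * ‖v (n + 1) - v' (2 * n + 1)‖ +
        ‖f' (2 * n + 2)‖ * ‖f (n + 1) - f' (2 * n + 1)‖ ≤ L * (2 * L) + L * (2 * L) := by gcongr
    linarith [mul_le_mul_of_nonneg_left hcross (mul_nonneg hh hh)]

theorem IsScheme.energy_sub_half_le (hB : IsMonotoneOperator B) (hC : CoeffBound α γ T C)
    (hh : 0 ≤ h) (hs : IsScheme ι B α h u v f) (hs' : IsScheme ι B α (h / 2) u' v' f')
    (hL : ∀ n : ℕ, n * h ≤ T → ‖v n‖ ≤ L ∧ ‖f n‖ ≤ L)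
    (hL' : ∀ n : ℕ, n * (h / 2) ≤ T → ‖v' n‖ ≤ L ∧ ‖f' n‖ ≤ L)
    (hR : ∀ x, ‖x‖ ≤ L → ‖B x‖ ≤ R) (hu₀ : u 0 = u' 0) (hv₀ : v 0 = v' 0) (n : ℕ)
    (hn : n * h ≤ T) :
    ‖u n - u' (2 * n)‖ ^ 2 + ‖ι (v n - v' (2 * n))‖ ^ 2 ≤
      n * h * ((C * R * L + 2 * L ^ 2) * h) := by
  induction n with
  | zero =>
    rw [mul_zero, hu₀, hv₀, sub_self, sub_self, map_zero, norm_zero, norm_zero, Nat.cast_zero]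
    norm_num
  | succ n ih =>
    have hle : (n : ℝ) * h ≤ T := le_trans (by gcongr; exact n.le_succ) hn
    have hsucc := hs.energy_sub_half_succ_le hB hC hh hs' hL hL' hR n hn
    rw [mul_add_one, Nat.cast_succ]
    linarith [ih hle]

end Halving

section Dyadic

/-- The step `2⁻ᵏ` of the dyadic grid of level `k`. -/
def dyadicStep (k : ℕ) : ℝ := (1 / 2) ^ k

/-- The index of the last point of the dyadic grid of level `k` before the time `t`. -/
def dyadicIndex (k : ℕ) (t : ℝ) : ℕ := ⌊t / dyadicStep k⌋₊

/-- The piecewise constant interpolation of sequences on the dyadic grids, as a function of the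
level and of the time. -/
def dyadicInterpolation {E : Type*} (X : ℕ → ℕ → E) (p : ℕ × ℝ) : E :=
  X p.1 (dyadicIndex p.1 p.2)

/-- The filter of the pairs of a level tending to infinity and of a nonnegative time tending to
`s`. -/
def dyadicFilter (s : ℝ) : Filter (ℕ × ℝ) := atTop ×ˢ 𝓝[Ici 0] s

theorem dyadicStep_pos (k : ℕ) : 0 < dyadicStep k := pow_pos one_half_pos k

theorem dyadicStep_succ (k : ℕ) : dyadicStep (k + 1) = dyadicStep k / 2 := by
  rw [dyadicStep, pow_succ, mul_one_div, dyadicStep]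

theorem tendsto_dyadicStep : Tendsto dyadicStep atTop (𝓝 0) :=
  tendsto_pow_atTop_nhds_zero_of_lt_one one_half_pos.le one_half_lt_one

theorem dyadicIndex_mul_le (k : ℕ) {t : ℝ} (ht : 0 ≤ t) :
    dyadicIndex k t * dyadicStep k ≤ t :=
  (le_div_iff₀ (dyadicStep_pos k)).1 (Nat.floor_le (div_nonneg ht (dyadicStep_pos k).le))

theorem lt_dyadicIndex_add_one_mul (k : ℕ) (t : ℝ) :
    t < (dyadicIndex k t + 1) * dyadicStep k :=
  (div_lt_iff₀ (dyadicStep_pos k)).1 (Nat.lt_floor_add_one _)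

theorem dyadicIndex_natCast_mul (k n : ℕ) : dyadicIndex k (n * dyadicStep k) = n := by
  rw [dyadicIndex, mul_div_cancel_right₀ _ (dyadicStep_pos k).ne', Nat.floor_natCast]

theorem dyadicIndex_mono (k : ℕ) : Monotone (dyadicIndex k) := fun _ _ h =>
  Nat.floor_mono (div_le_div_of_nonneg_right h (dyadicStep_pos k).le)

theorem mul_dyadicStep_le_of_le_dyadicIndex {k n : ℕ} {t : ℝ} (ht : 0 ≤ t)
    (hn : n ≤ dyadicIndex k t) : n * dyadicStep k ≤ t :=
  (mul_le_mul_of_nonneg_right (Nat.cast_le.2 hn) (dyadicStep_pos k).le).trans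
    (dyadicIndex_mul_le k ht)

theorem dyadicIndex_succ (k : ℕ) (t : ℝ) :
    dyadicIndex (k + 1) t = 2 * dyadicIndex k t ∨
      dyadicIndex (k + 1) t = 2 * dyadicIndex k t + 1 := by
  have hdouble : t / dyadicStep (k + 1) / 2 = t / dyadicStep k := by
    rw [dyadicStep_succ]
    field_simp
  have hdiv : dyadicIndex (k + 1) t / 2 = dyadicIndex k t := by
    rw [dyadicIndex, dyadicIndex, ← hdouble, Nat.floor_div_ofNat]
  omega

theorem dyadicIndex_zero (k : ℕ) : dyadicIndex k 0 = 0 := by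
  rw [dyadicIndex, zero_div, Nat.floor_zero]

theorem dyadicFilter_neBot {s : ℝ} (hs : 0 ≤ s) : (dyadicFilter s).NeBot :=
  haveI : (𝓝[Ici 0] s).NeBot := mem_closure_iff_nhdsWithin_neBot.1 (subset_closure hs)
  inferInstanceAs (atTop ×ˢ 𝓝[Ici 0] s).NeBot

theorem eventually_mem_Icc_dyadicFilter {s T : ℝ} (hs : s < T) :
    ∀ᶠ p in dyadicFilter s, p.2 ∈ Icc 0 T :=
  tendsto_snd.eventually <| by
    filter_upwards [self_mem_nhdsWithin, nhdsWithin_le_nhds (Iic_mem_nhds hs)] with t h₀ hT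
    exact ⟨h₀, hT⟩

theorem eventually_level_dyadicFilter {P : ℕ → Prop} (h : ∀ᶠ k in atTop, P k) (s : ℝ) :
    ∀ᶠ p in dyadicFilter s, P p.1 :=
  tendsto_fst.eventually h

theorem tendsto_dyadicIndex_mul (s : ℝ) :
    Tendsto (fun p : ℕ × ℝ => dyadicIndex p.1 p.2 * dyadicStep p.1) (dyadicFilter s)
      (𝓝[Ici 0] s) := by
  have htime : Tendsto Prod.snd (dyadicFilter s) (𝓝 s) :=
    tendsto_snd.mono_right nhdsWithin_le_nhds
  have hprevious : Tendsto (fun p : ℕ × ℝ => p.2 - dyadicStep p.1) (dyadicFilter s) (𝓝 s) := by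
    simpa only [sub_zero, Function.comp_apply] using
      htime.sub (tendsto_dyadicStep.comp tendsto_fst)
  refine tendsto_nhdsWithin_iff.2 ⟨tendsto_of_tendsto_of_tendsto_of_le_of_le' hprevious htime ?_ ?_,
    .of_forall fun p => mul_nonneg (Nat.cast_nonneg _) (dyadicStep_pos p.1).le⟩
  · exact .of_forall fun p => by linarith [lt_dyadicIndex_add_one_mul p.1 p.2]
  · filter_upwards [eventually_mem_Icc_dyadicFilter (lt_add_one s)] with p hp
    exact dyadicIndex_mul_le p.1 hp.1

theorem tendsto_level_of_tendsto_dyadicFilter {E : Type*} {X : ℕ × ℝ → E} {F : Filter E} {s : ℝ}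
    (hs : 0 ≤ s) (h : Tendsto X (dyadicFilter s) F) : Tendsto (fun k => X (k, s)) atTop F :=
  h.comp (tendsto_id.prodMk (tendsto_const_pure.mono_right (pure_le_nhdsWithin hs)))

theorem continuousOn_of_tendsto_dyadicFilter {E : Type*} [TopologicalSpace E] [RegularSpace E]
    {X : ℕ × ℝ → E} {x : ℝ → E} (h : ∀ s ∈ Ici 0, Tendsto X (dyadicFilter s) (𝓝 (x s))) :
    ContinuousOn x (Ici 0) := fun s hs => by
  refine (closed_nhds_basis (x s)).tendsto_right_iff.2 fun W hW => ?_
  filter_upwards [self_mem_nhdsWithin, (eventually_swap_iff.1 ((h s hs).eventually hW.1)).curry]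
    with t ht hWt
  exact hW.2.mem_of_tendsto (tendsto_level_of_tendsto_dyadicFilter ht (h t ht)) hWt

section Limit

variable {E : Type*} [NormedAddCommGroup E]

theorem norm_sub_le_of_step_le {x : ℕ → E} {d : ℝ} {a b : ℕ} (hab : a ≤ b)
    (h : ∀ n, a ≤ n → n < b → ‖x (n + 1) - x n‖ ≤ d) : ‖x b - x a‖ ≤ (b - a : ℝ) * d := by
  induction b, hab using Nat.le_induction with
  | base => rw [sub_self, sub_self, norm_zero, zero_mul]
  | succ n hn ih =>
    calc ‖x (n + 1) - x a‖ ≤ ‖x (n + 1) - x n‖ + ‖x n - x a‖ := norm_sub_le_norm_sub_add_norm_sub ..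
      _ ≤ d + (n - a : ℝ) * d :=
        add_le_add (h n hn n.lt_succ_self) (ih fun m hm hmn => h m hm (hmn.trans n.lt_succ_self))
      _ = ((n + 1 : ℕ) - a : ℝ) * d := by push_cast; ring

/-- From level `k₀` on and up to time `T`, the sequences `X k` on the dyadic grids are Lipschitz
with constant `M`, and differ by at most `M r ^ k` from one level to the next. -/
structure DyadicBound (X : ℕ → ℕ → E) (r T M : ℝ) (k₀ : ℕ) : Prop where
  nonneg : 0 ≤ M
  step_le : ∀ k ≥ k₀, ∀ n : ℕ, (n + 1 : ℕ) * dyadicStep k ≤ T →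
    ‖X k (n + 1) - X k n‖ ≤ M * dyadicStep k
  refinement_le : ∀ k ≥ k₀, ∀ n : ℕ, n * dyadicStep k ≤ T →
    ‖X k n - X (k + 1) (2 * n)‖ ≤ M * r ^ k

namespace DyadicBound

variable {X : ℕ → ℕ → E} {r T M s t : ℝ} {k₀ k : ℕ}

theorem norm_interpolation_sub_le_of_le (h : DyadicBound X r T M k₀) (hk : k₀ ≤ k) (hst : s ≤ t)
    (ht : t ∈ Icc 0 T) :
    ‖dyadicInterpolation X (k, t) - dyadicInterpolation X (k, s)‖ ≤
      M * (t - s + dyadicStep k) := by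
  calc ‖X k (dyadicIndex k t) - X k (dyadicIndex k s)‖
      ≤ (dyadicIndex k t - dyadicIndex k s : ℝ) * (M * dyadicStep k) :=
        norm_sub_le_of_step_le (dyadicIndex_mono k hst) fun n _ hn =>
          h.step_le k hk n ((mul_dyadicStep_le_of_le_dyadicIndex ht.1 hn).trans ht.2)
    _ = M * (dyadicIndex k t * dyadicStep k - dyadicIndex k s * dyadicStep k) := by ring
    _ ≤ M * (t - s + dyadicStep k) := by
        refine mul_le_mul_of_nonneg_left ?_ h.nonneg
        linarith [dyadicIndex_mul_le k ht.1, lt_dyadicIndex_add_one_mul k s]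

theorem norm_interpolation_sub_le (h : DyadicBound X r T M k₀) (hk : k₀ ≤ k) (hs : s ∈ Icc 0 T)
    (ht : t ∈ Icc 0 T) :
    ‖dyadicInterpolation X (k, t) - dyadicInterpolation X (k, s)‖ ≤
      M * (|t - s| + dyadicStep k) := by
  rcases le_total s t with hst | hts
  · rw [abs_of_nonneg (sub_nonneg.2 hst)]
    exact h.norm_interpolation_sub_le_of_le hk hst ht
  · rw [norm_sub_rev, abs_sub_comm, abs_of_nonneg (sub_nonneg.2 hts)]
    exact h.norm_interpolation_sub_le_of_le hk hts hs

theorem norm_interpolation_sub_succ_le (h : DyadicBound X r T M k₀) (hr : 1 / 2 ≤ r)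
    (hk : k₀ ≤ k) (ht : t ∈ Icc 0 T) :
    ‖dyadicInterpolation X (k, t) - dyadicInterpolation X (k + 1, t)‖ ≤ 2 * M * r ^ k := by
  have hrefine := h.refinement_le k hk (dyadicIndex k t) ((dyadicIndex_mul_le k ht.1).trans ht.2)
  have hstep : M * dyadicStep (k + 1) ≤ M * r ^ k := by
    refine mul_le_mul_of_nonneg_left ?_ h.nonneg
    rw [dyadicStep_succ]
    exact (half_le_self (dyadicStep_pos k).le).trans (pow_le_pow_left₀ one_half_pos.le hr k)
  have hstep_nonneg : 0 ≤ M * dyadicStep (k + 1) := mul_nonneg h.nonneg (dyadicStep_pos _).le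
  rw [dyadicInterpolation, dyadicInterpolation]
  rcases dyadicIndex_succ k t with heven | hodd
  · rw [heven]
    linarith
  · have hlast := h.step_le (k + 1) (Nat.le_succ_of_le hk) (2 * dyadicIndex k t) (by
      rw [← hodd]
      exact (dyadicIndex_mul_le _ ht.1).trans ht.2)
    rw [norm_sub_rev] at hlast
    rw [hodd]
    linarith [norm_sub_le_norm_sub_add_norm_sub (X k (dyadicIndex k t))
      (X (k + 1) (2 * dyadicIndex k t)) (X (k + 1) (2 * dyadicIndex k t + 1))]

theorem exists_tendsto [CompleteSpace E] (h : DyadicBound X r T M k₀) (hr : 1 / 2 ≤ r) (hr₁ : r < 1)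
    (ht : t ∈ Icc 0 T) :
    ∃ x, Tendsto (fun k => dyadicInterpolation X (k, t)) atTop (𝓝 x) := by
  have hcauchy : CauchySeq fun k => dyadicInterpolation X (k + k₀, t) := by
    refine cauchySeq_of_le_geometric r (2 * M * r ^ k₀) hr₁ fun k => ?_
    rw [dist_eq_norm, Nat.add_right_comm, mul_assoc, ← pow_add, add_comm k₀]
    exact h.norm_interpolation_sub_succ_le hr (Nat.le_add_left _ _) ht
  obtain ⟨x, hx⟩ := cauchySeq_tendsto_of_complete hcauchy
  exact ⟨x, (tendsto_add_atTop_iff_nat k₀).1 hx⟩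

theorem tendsto_dyadicFilter (h : DyadicBound X r T M k₀) (hs : 0 ≤ s) (hsT : s < T) {x : E}
    (hx : Tendsto (fun k => dyadicInterpolation X (k, s)) atTop (𝓝 x)) :
    Tendsto (dyadicInterpolation X) (dyadicFilter s) (𝓝 x) := by
  have hbound : Tendsto (fun p : ℕ × ℝ => M * (|p.2 - s| + dyadicStep p.1)) (dyadicFilter s)
      (𝓝 0) := by
    have htime : Tendsto Prod.snd (dyadicFilter s) (𝓝 s) :=
      tendsto_snd.mono_right nhdsWithin_le_nhds
    simpa only [sub_self, abs_zero, add_zero, mul_zero, Function.comp_apply] using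
      ((htime.sub_const s).abs.add (tendsto_dyadicStep.comp tendsto_fst)).const_mul M
  have hdiff : Tendsto (fun p => dyadicInterpolation X p - dyadicInterpolation X (p.1, s))
      (dyadicFilter s) (𝓝 0) := by
    refine squeeze_zero_norm' ?_ hbound
    filter_upwards [eventually_mem_Icc_dyadicFilter hsT,
      eventually_level_dyadicFilter (eventually_ge_atTop k₀) s] with p hp hk
    exact h.norm_interpolation_sub_le hk ⟨hs, hsT.le⟩ hp
  simpa only [Function.comp_def, sub_add_cancel, zero_add] using hdiff.add (hx.comp tendsto_fst)

end DyadicBound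

theorem exists_dyadic_limit [CompleteSpace E] {X : ℕ → ℕ → E} {r : ℝ} (hr : 1 / 2 ≤ r) (hr₁ : r < 1)
    (hX : ∀ T > 0, ∃ M k₀, DyadicBound X r T M k₀) :
    ∃ x : ℝ → E, ∀ s ∈ Ici 0, Tendsto (dyadicInterpolation X) (dyadicFilter s) (𝓝 (x s)) := by
  have hlim : ∀ s ∈ Ici (0 : ℝ), ∃ x, Tendsto (dyadicInterpolation X) (dyadicFilter s) (𝓝 x) := by
    intro s hs
    obtain ⟨M, k₀, h⟩ := hX (s + 1) (add_pos_of_nonneg_of_pos hs one_pos)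
    obtain ⟨x, hx⟩ := h.exists_tendsto hr hr₁ ⟨hs, (lt_add_one s).le⟩
    exact ⟨x, h.tendsto_dyadicFilter hs (lt_add_one s) hx⟩
  choose! x hx using hlim
  exact ⟨x, hx⟩

end Limit

section Derivative

variable {E : Type*} [NormedAddCommGroup E] [NormedSpace ℝ E] {X G : ℕ → ℕ → E} {g : E}
  {c a b : ℝ}

theorem norm_interpolation_sub_sub_smul_le {k : ℕ}
    (hstep : ∀ n, X k (n + 1) = X k n + dyadicStep k • G k (n + 1)) (ha : 0 ≤ a) (hab : a ≤ b)
    (hG : ∀ t ∈ Icc a b, ‖dyadicInterpolation G (k, t) - g‖ ≤ c) :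
    ‖dyadicInterpolation X (k, b) - dyadicInterpolation X (k, a) -
        (dyadicIndex k b * dyadicStep k - dyadicIndex k a * dyadicStep k) • g‖ ≤
      c * (dyadicIndex k b * dyadicStep k - dyadicIndex k a * dyadicStep k) := by
  have hpos := dyadicStep_pos k
  have hsum := norm_sub_le_of_step_le (x := fun n => X k n - (n * dyadicStep k) • g)
    (d := c * dyadicStep k) (dyadicIndex_mono k hab) fun n hn hn' => by
      have hmem : (n + 1 : ℕ) * dyadicStep k ∈ Icc a b := by
        refine ⟨(lt_dyadicIndex_add_one_mul k a).le.trans ?_,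
          mul_dyadicStep_le_of_le_dyadicIndex (ha.trans hab) hn'⟩
        exact mul_le_mul_of_nonneg_right (by exact_mod_cast Nat.succ_le_succ hn) hpos.le
      have hincrement : X k (n + 1) - ((n + 1 : ℕ) * dyadicStep k) • g -
          (X k n - (n * dyadicStep k) • g) = dyadicStep k • (G k (n + 1) - g) := by
        rw [hstep]
        push_cast
        match_scalars <;> ring
      have hGn := hG _ hmem
      rw [dyadicInterpolation, dyadicIndex_natCast_mul] at hGn
      rw [hincrement, norm_smul, Real.norm_of_nonneg hpos.le, mul_comm]
      exact mul_le_mul_of_nonneg_right hGn hpos.le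
  calc _ = ‖X k (dyadicIndex k b) - (dyadicIndex k b * dyadicStep k) • g -
        (X k (dyadicIndex k a) - (dyadicIndex k a * dyadicStep k) • g)‖ := by
        rw [dyadicInterpolation, dyadicInterpolation, sub_smul, sub_sub_sub_comm]
    _ ≤ _ := hsum.trans_eq (by ring)

variable (hstep : ∀ k n, X k (n + 1) = X k n + dyadicStep k • G k (n + 1)) {x : ℝ → E}
  (hx : ∀ t ∈ Ici 0, Tendsto (dyadicInterpolation X) (dyadicFilter t) (𝓝 (x t)))
include hstep hx

theorem norm_dyadic_limit_sub_sub_smul_le (ha : 0 ≤ a) (hab : a ≤ b)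
    (hG : ∀ᶠ k in atTop, ∀ t ∈ Icc a b, ‖dyadicInterpolation G (k, t) - g‖ ≤ c) :
    ‖x b - x a - (b - a) • g‖ ≤ c * (b - a) := by
  have hx' : ∀ t, 0 ≤ t → Tendsto (fun k => dyadicInterpolation X (k, t)) atTop (𝓝 (x t)) :=
    fun t ht => tendsto_level_of_tendsto_dyadicFilter ht (hx t ht)
  have hgrid : ∀ t, 0 ≤ t → Tendsto (fun k => dyadicIndex k t * dyadicStep k) atTop (𝓝 t) :=
    fun t ht => (tendsto_level_of_tendsto_dyadicFilter ht (tendsto_dyadicIndex_mul t)).mono_right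
      nhdsWithin_le_nhds
  have hb := ha.trans hab
  have hlength := (hgrid b hb).sub (hgrid a ha)
  refine le_of_tendsto_of_tendsto (((hx' b hb).sub (hx' a ha)).sub (hlength.smul_const g)).norm
    (hlength.const_mul c) ?_
  filter_upwards [hG] with k hk
  exact norm_interpolation_sub_sub_smul_le (hstep k) ha hab hk

theorem hasDerivWithinAt_dyadic_limit {s : ℝ} (hs : 0 ≤ s)
    (hG : Tendsto (dyadicInterpolation G) (dyadicFilter s) (𝓝 g)) :
    HasDerivWithinAt x g (Ici 0) s := by
  rw [hasDerivWithinAt_iff_isLittleO, Asymptotics.isLittleO_iff]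
  intro c hc
  obtain ⟨⟨k₀, δ⟩, ⟨-, hδ⟩, hclose⟩ :=
    (atTop_basis.prod Metric.nhdsWithin_basis_ball).eventually_iff.1
      (hG.eventually (Metric.closedBall_mem_nhds g hc))
  have hG_near : ∀ t ∈ Metric.ball s δ ∩ Ici 0, ∀ t' ∈ Metric.ball s δ ∩ Ici 0,
      ∀ᶠ k in atTop, ∀ τ ∈ Icc t t', ‖dyadicInterpolation G (k, τ) - g‖ ≤ c := by
    intro t ht t' ht'
    filter_upwards [eventually_ge_atTop k₀] with k hk τ hτ
    exact mem_closedBall_iff_norm.1 <| @hclose (k, τ)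
      ⟨hk, ((convex_ball s δ).inter (convex_Ici 0)).ordConnected.out ht ht' hτ⟩
  have hs_mem : s ∈ Metric.ball s δ ∩ Ici 0 := ⟨Metric.mem_ball_self hδ, hs⟩
  filter_upwards [inter_mem (nhdsWithin_le_nhds (Metric.ball_mem_nhds s hδ)) self_mem_nhdsWithin]
    with t ht
  rcases le_total s t with hst | hts
  · rw [Real.norm_of_nonneg (sub_nonneg.2 hst)]
    exact norm_dyadic_limit_sub_sub_smul_le hstep hx hs hst (hG_near s hs_mem t ht)
  · rw [norm_sub_rev t s, Real.norm_of_nonneg (sub_nonneg.2 hts), ← norm_neg, neg_sub',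
      ← neg_smul, neg_sub (x t), neg_sub t]
    exact norm_dyadic_limit_sub_sub_smul_le hstep hx ht.2 hts (hG_near t ht s hs_mem)

end Derivative

end Dyadic

section Existence

variable {V H : Type*} [NormedAddCommGroup V] [InnerProductSpace ℝ V]
  [NormedAddCommGroup H] [InnerProductSpace ℝ H] {ι : V →L[ℝ] H} {B : V → StrongDual ℝ V}
  {α γ : ℝ → ℝ}

/-- The nonlinear operators admitted as damping: monotone and hemicontinuous, vanishing at the
origin, and bounded on bounded sets. -/
structure IsDampingOperator (B : V → StrongDual ℝ V) : Prop where
  monotone : IsMonotoneOperator B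
  hemicontinuous : Hemicontinuous B
  map_zero : B 0 = 0
  exists_bound : ∀ L : ℝ, ∃ R, ∀ x, ‖x‖ ≤ L → ‖B x‖ ≤ R

/-- The coefficients `α` for which the equation is solved on `[0, ∞)`, with `γ` the derivative of
`1 / α`: the bounds of `CoeffBound` hold on every `[0, T]`. -/
def IsAdmissibleCoefficient (α γ : ℝ → ℝ) : Prop :=
  ∀ T > 0, ∃ C, CoeffBound α γ T C

theorem continuousOn_Ici_of_lipschitz {a : ℝ → ℝ}
    (h : ∀ T > 0, ∃ C, ∀ s ∈ Icc 0 T, ∀ t ∈ Icc 0 T, |a t - a s| ≤ C * |t - s|) :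
    ContinuousOn a (Ici 0) := fun s (hs : 0 ≤ s) => by
  obtain ⟨C, hC⟩ := h (s + 1) (add_pos_of_nonneg_of_pos hs one_pos)
  have hcont : ContinuousOn a (Icc 0 (s + 1)) :=
    (LipschitzOnWith.of_dist_le' fun t ht r hr => hC r hr t ht).continuousOn
  exact (hcont s ⟨hs, (lt_add_one s).le⟩).mono_of_mem_nhdsWithin
    (inter_mem self_mem_nhdsWithin (nhdsWithin_le_nhds (Iic_mem_nhds (lt_add_one s))))

theorem IsAdmissibleCoefficient.pos (hα : IsAdmissibleCoefficient α γ) :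
    ∀ t ∈ Ici (0 : ℝ), 0 < α t := fun t ht => by
  obtain ⟨C, hC⟩ := hα (t + 1) (add_pos_of_nonneg_of_pos ht one_pos)
  exact hC.pos t ⟨ht, (lt_add_one t).le⟩

theorem IsAdmissibleCoefficient.continuousOn (hα : IsAdmissibleCoefficient α γ) :
    ContinuousOn α (Ici 0) :=
  continuousOn_Ici_of_lipschitz fun T hT => (hα T hT).imp fun _ h => h.lipschitz

theorem IsAdmissibleCoefficient.continuousOn_deriv (hα : IsAdmissibleCoefficient α γ) :
    ContinuousOn γ (Ici 0) :=
  continuousOn_Ici_of_lipschitz fun T hT => (hα T hT).imp fun _ h => h.lipschitz_deriv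

theorem norm_le_of_rate_add_le {T C K Q t : ℝ} {u v : V} {f : H} (hC : CoeffBound α γ T C)
    (ht : t ∈ Icc 0 T) (hu : ‖u‖ ^ 2 ≤ K)
    (h : rate (α t) (γ t) u v f + K ≤ Real.exp (192 * C ^ 6 * t) * Q) :
    ‖v‖ ≤ 2 * C ^ 2 * √(Real.exp (192 * C ^ 6 * T) * Q) ∧
      ‖f‖ ≤ 2 * C ^ 2 * √(Real.exp (192 * C ^ 6 * T) * Q) := by
  have hrate : 0 ≤ rate (α t) (γ t) u v f := rate_nonneg ..
  have hK : 0 ≤ K := (sq_nonneg _).trans hu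
  have hQ : 0 ≤ Q := nonneg_of_mul_nonneg_right ((add_nonneg hrate hK).trans h) (Real.exp_pos _)
  have : 0 ≤ C := zero_le_one.trans hC.one_le
  have hexp : Real.exp (192 * C ^ 6 * t) * Q ≤ Real.exp (192 * C ^ 6 * T) * Q := by
    have := ht.2
    gcongr
  refine norm_le_of_rate_le hC.one_le (hC.pos t ht) (hC.le t ht) (hC.abs_deriv_le t ht) ?_
    (Real.le_sqrt_of_sq_le (by linarith))
  rw [Real.sq_sqrt (by positivity)]
  linarith

theorem dyadicBound_of_sq_norm_sub_le {E : Type*} [NormedAddCommGroup E] {X : ℕ → ℕ → E}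
    {T L Q : ℝ} {k₀ : ℕ} (hL : 0 ≤ L)
    (hstep : ∀ k ≥ k₀, ∀ n : ℕ, (n + 1 : ℕ) * dyadicStep k ≤ T →
      ‖X k (n + 1) - X k n‖ ≤ L * dyadicStep k)
    (hsq : ∀ k ≥ k₀, ∀ n : ℕ, n * dyadicStep k ≤ T →
      ‖X k n - X (k + 1) (2 * n)‖ ^ 2 ≤ Q * dyadicStep k) :
    DyadicBound X √(1 / 2) T (L + √Q) k₀ where
  nonneg := add_nonneg hL (Real.sqrt_nonneg Q)
  step_le k hk n hn := (hstep k hk n hn).trans <|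
    mul_le_mul_of_nonneg_right (le_add_of_nonneg_right (Real.sqrt_nonneg Q)) (dyadicStep_pos k).le
  refinement_le k hk n hn := by
    have hsqrt : √(dyadicStep k) = √(1 / 2) ^ k :=
      (Real.sqrt_eq_iff_eq_sq (dyadicStep_pos k).le (by positivity)).2 <| by
        rw [pow_right_comm, Real.sq_sqrt (by norm_num), dyadicStep]
    refine (Real.le_sqrt_of_sq_le (hsq k hk n hn)).trans ?_
    rw [Real.sqrt_mul' Q (dyadicStep_pos k).le, hsqrt]
    gcongr
    exact le_add_of_nonneg_left hL

/-- Backward Euler schemes of steps `2⁻ᵏ` with common initial values, for all levels `k`. -/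
structure IsDyadicScheme (ι : V →L[ℝ] H) (B : V → StrongDual ℝ V) (α : ℝ → ℝ) (u₀ v₀ : V) (f₀ : H)
    (U W : ℕ → ℕ → V) (G : ℕ → ℕ → H) : Prop where
  isScheme : ∀ k, IsScheme ι B α (dyadicStep k) (U k) (W k) (G k)
  u_zero : ∀ k, U k 0 = u₀
  v_zero : ∀ k, W k 0 = v₀
  f_zero : ∀ k, G k 0 = f₀

theorem exists_isDyadicScheme [CompleteSpace V] (hB : IsDampingOperator B)
    (hα : ∀ t ∈ Ici (0 : ℝ), 0 < α t) {u₀ v₀ : V} {f₀ : H} (h₀ : StateEq ι B (α 0) u₀ v₀ f₀) :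
    ∃ U W G, IsDyadicScheme ι B α u₀ v₀ f₀ U W G := by
  choose U W G hs hU hW hG using fun k =>
    exists_isScheme hB.monotone hB.hemicontinuous hα h₀ (dyadicStep_pos k)
  exact ⟨U, W, G, hs, hU, hW, hG⟩

namespace IsDyadicScheme

variable {u₀ v₀ : V} {f₀ : H} {U W : ℕ → ℕ → V} {G : ℕ → ℕ → H} {T C K : ℝ}

theorem norm_sq_le (hs : IsDyadicScheme ι B α u₀ v₀ f₀ U W G) (hB : IsDampingOperator B)
    (hα : ∀ t ∈ Ici (0 : ℝ), 0 < α t) (hK : ‖u₀‖ ^ 2 + ‖ι v₀‖ ^ 2 ≤ K) (k n : ℕ) :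
    ‖U k n‖ ^ 2 ≤ K := by
  have henergy := (hs.isScheme k).energy_le hB.monotone hB.map_zero hα (dyadicStep_pos k).le n
  rw [hs.u_zero, hs.v_zero] at henergy
  linarith [sq_nonneg ‖ι (W k n)‖]

theorem eventually_rate_add_le (hs : IsDyadicScheme ι B α u₀ v₀ f₀ U W G)
    (hB : IsDampingOperator B) (hα : ∀ t ∈ Ici (0 : ℝ), 0 < α t) (hC : CoeffBound α γ T C)
    (hK : ‖u₀‖ ^ 2 + ‖ι v₀‖ ^ 2 ≤ K) :
    ∀ᶠ k in atTop, ∀ n : ℕ, n * dyadicStep k ≤ T →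
      rate (α (n * dyadicStep k)) (γ (n * dyadicStep k)) (U k n) (W k n) (G k n) + K ≤
        Real.exp (192 * C ^ 6 * (n * dyadicStep k)) * (rate (α 0) (γ 0) u₀ v₀ f₀ + K) := by
  have hsmall : ∀ᶠ k in atTop, 64 * C ^ 6 * dyadicStep k ≤ 1 / 2 :=
    (tendsto_dyadicStep.const_mul (64 * C ^ 6)).eventually_le_const
      (by rw [mul_zero]; exact one_half_pos)
  filter_upwards [hsmall] with k hk n hn
  have hrate := (hs.isScheme k).rate_add_le hB.monotone hC (dyadicStep_pos k) hk
    (hs.norm_sq_le hB hα hK k) n hn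
  rwa [hs.u_zero, hs.v_zero, hs.f_zero] at hrate

theorem exists_bound (hs : IsDyadicScheme ι B α u₀ v₀ f₀ U W G) (hB : IsDampingOperator B)
    (hα : IsAdmissibleCoefficient α γ) (hT : 0 < T) :
    ∃ L, 0 ≤ L ∧ ∀ᶠ k in atTop, ∀ n : ℕ, n * dyadicStep k ≤ T → ‖W k n‖ ≤ L ∧ ‖G k n‖ ≤ L := by
  obtain ⟨C, hC⟩ := hα T hT
  refine ⟨2 * C ^ 2 * √(Real.exp (192 * C ^ 6 * T) *
    (rate (α 0) (γ 0) u₀ v₀ f₀ + (‖u₀‖ ^ 2 + ‖ι v₀‖ ^ 2))), by positivity, ?_⟩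
  filter_upwards [hs.eventually_rate_add_le hB hα.pos hC le_rfl] with k hk n hn
  exact norm_le_of_rate_add_le hC ⟨mul_nonneg n.cast_nonneg (dyadicStep_pos k).le, hn⟩
    (hs.norm_sq_le hB hα.pos le_rfl k n) (hk n hn)

theorem exists_sq_norm_sub_half_le (hs : IsDyadicScheme ι B α u₀ v₀ f₀ U W G)
    (hB : IsDampingOperator B) (hC : CoeffBound α γ T C) {L : ℝ} (hL₀ : 0 ≤ L) {k₀ : ℕ}
    (hL : ∀ k ≥ k₀, ∀ n : ℕ, n * dyadicStep k ≤ T → ‖W k n‖ ≤ L ∧ ‖G k n‖ ≤ L) :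
    ∃ Q, ∀ k ≥ k₀, ∀ n : ℕ, n * dyadicStep k ≤ T →
      ‖U k n - U (k + 1) (2 * n)‖ ^ 2 ≤ Q * dyadicStep k ∧
        ‖ι (W k n) - ι (W (k + 1) (2 * n))‖ ^ 2 ≤ Q * dyadicStep k := by
  obtain ⟨R, hR⟩ := hB.exists_bound L
  have hR₀ : 0 ≤ R := (norm_nonneg _).trans (hR 0 (norm_zero.trans_le hL₀))
  have : 0 ≤ C := zero_le_one.trans hC.one_le
  refine ⟨T * (C * R * L + 2 * L ^ 2), fun k hk n hn => ?_⟩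
  have hpos := dyadicStep_pos k
  have hhalf : ‖U k n - U (k + 1) (2 * n)‖ ^ 2 + ‖ι (W k n - W (k + 1) (2 * n))‖ ^ 2 ≤
      n * dyadicStep k * ((C * R * L + 2 * L ^ 2) * dyadicStep k) :=
    (hs.isScheme k).energy_sub_half_le hB.monotone hC hpos.le
      (dyadicStep_succ k ▸ hs.isScheme (k + 1)) (hL k hk)
      (dyadicStep_succ k ▸ hL (k + 1) (le_add_right hk)) hR
      ((hs.u_zero k).trans (hs.u_zero (k + 1)).symm)
      ((hs.v_zero k).trans (hs.v_zero (k + 1)).symm) n hn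
  have htotal : n * dyadicStep k * ((C * R * L + 2 * L ^ 2) * dyadicStep k) ≤
      T * (C * R * L + 2 * L ^ 2) * dyadicStep k := by
    rw [mul_assoc T]
    gcongr
  rw [map_sub] at hhalf
  constructor <;> linarith [sq_nonneg ‖U k n - U (k + 1) (2 * n)‖,
    sq_nonneg ‖ι (W k n) - ι (W (k + 1) (2 * n))‖]

theorem exists_dyadicBound (hs : IsDyadicScheme ι B α u₀ v₀ f₀ U W G) (hB : IsDampingOperator B)
    (hα : IsAdmissibleCoefficient α γ) (hT : 0 < T) :
    ∃ M k₀, DyadicBound U √(1 / 2) T M k₀ ∧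
      DyadicBound (fun k n => ι (W k n)) √(1 / 2) T M k₀ := by
  obtain ⟨C, hC⟩ := hα T hT
  obtain ⟨L, hL₀, hbound⟩ := hs.exists_bound hB hα hT
  obtain ⟨k₀, hL⟩ := eventually_atTop.1 hbound
  obtain ⟨Q, hQ⟩ := hs.exists_sq_norm_sub_half_le hB hC hL₀ hL
  refine ⟨L + √Q, k₀,
    dyadicBound_of_sq_norm_sub_le hL₀ (fun k hk n hn => ?_) fun k hk n hn => (hQ k hk n hn).1,
    dyadicBound_of_sq_norm_sub_le hL₀ (fun k hk n hn => ?_) fun k hk n hn => (hQ k hk n hn).2⟩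
  · rw [(hs.isScheme k).step_u, add_sub_cancel_left, norm_smul,
      Real.norm_of_nonneg (dyadicStep_pos k).le, mul_comm]
    exact mul_le_mul_of_nonneg_right (hL k hk _ hn).1 (dyadicStep_pos k).le
  · rw [(hs.isScheme k).step_v, sub_sub_cancel_left, norm_neg, norm_smul,
      Real.norm_of_nonneg (dyadicStep_pos k).le, mul_comm]
    exact mul_le_mul_of_nonneg_right (hL k hk _ hn).2 (dyadicStep_pos k).le

end IsDyadicScheme

/-- The limit `(u, v, f)` of dyadic schemes `(U, W, G)`: positions converge in `V`, velocities in
`H` and weakly in `V`, and the terms `A u + α B v` weakly in `H`. -/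
structure IsDyadicLimit (ι : V →L[ℝ] H) (U W : ℕ → ℕ → V) (G : ℕ → ℕ → H) (u v : ℝ → V)
    (f : ℝ → H) : Prop where
  tendsto_u : ∀ s ∈ Ici (0 : ℝ), Tendsto (dyadicInterpolation U) (dyadicFilter s) (𝓝 (u s))
  tendsto_v : ∀ s ∈ Ici (0 : ℝ),
    Tendsto (dyadicInterpolation fun k n => ι (W k n)) (dyadicFilter s) (𝓝 (ι (v s)))
  weaklyTendsto_v : ∀ s ∈ Ici (0 : ℝ),
    WeaklyTendsto (dyadicInterpolation W) (dyadicFilter s) (v s)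
  weaklyTendsto_f : ∀ s ∈ Ici (0 : ℝ),
    WeaklyTendsto (dyadicInterpolation G) (dyadicFilter s) (f s)

/-- The triple `(u, v, f)` satisfies `u' = v` and `f = A u + α B v` at all times `t ≥ 0`, and
`v' = -f` weakly in `H` at all times outside `S`. -/
structure IsWeakSolution (ι : V →L[ℝ] H) (B : V → StrongDual ℝ V) (α : ℝ → ℝ) (S : Set ℝ)
    (u v : ℝ → V) (f : ℝ → H) : Prop where
  continuousOn_u : ContinuousOn u (Ici 0)
  continuousOn_v : ContinuousOn (fun t => ι (v t)) (Ici 0)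
  deriv_u : ∀ t ∈ Ici (0 : ℝ), HasDerivWithinAt (fun s => ι (u s)) (ι (v t)) (Ici 0) t
  state : ∀ t ∈ Ici (0 : ℝ), StateEq ι B (α t) (u t) (v t) (f t)
  deriv_v : ∀ t ∈ Ici (0 : ℝ) \ S, ∀ φ,
    HasDerivWithinAt (fun s => ⟪ι (v s), φ⟫) (-⟪f t, φ⟫) (Ici 0) t

section Limit

variable [CompleteSpace V] [CompleteSpace H] {u₀ v₀ : V} {f₀ : H} {U W : ℕ → ℕ → V}
  {G : ℕ → ℕ → H}

theorem IsDyadicScheme.exists_isDyadicLimit (hs : IsDyadicScheme ι B α u₀ v₀ f₀ U W G)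
    (hι : Function.Injective ι) (hιd : DenseRange ι) (hB : IsDampingOperator B)
    (hα : IsAdmissibleCoefficient α γ) :
    ∃ u v f, IsDyadicLimit ι U W G u v f ∧
      ∀ s ∈ Ici (0 : ℝ), StateEq ι B (α s) (u s) (v s) (f s) := by
  have hhalf : (1 / 2 : ℝ) ≤ √(1 / 2) := Real.le_sqrt_of_sq_le (by norm_num)
  have hone : √(1 / 2 : ℝ) < 1 := (Real.sqrt_lt' one_pos).2 (by norm_num)
  obtain ⟨u, hu⟩ := exists_dyadic_limit hhalf hone fun T hT =>
    (hs.exists_dyadicBound hB hα hT).imp fun M => Exists.imp fun k₀ => And.left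
  obtain ⟨y, hy⟩ := exists_dyadic_limit hhalf hone fun T hT =>
    (hs.exists_dyadicBound hB hα hT).imp fun M => Exists.imp fun k₀ => And.right
  have hlim : ∀ s ∈ Ici (0 : ℝ), ∃ v f, ι v = y s ∧ StateEq ι B (α s) (u s) v f ∧
      WeaklyTendsto (dyadicInterpolation W) (dyadicFilter s) v ∧
      WeaklyTendsto (dyadicInterpolation G) (dyadicFilter s) f := by
    intro s hs₀
    have := dyadicFilter_neBot hs₀
    obtain ⟨L, -, hL⟩ := hs.exists_bound hB hα (add_pos_of_nonneg_of_pos hs₀ one_pos)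
    have hbound : ∀ᶠ p in dyadicFilter s,
        ‖dyadicInterpolation W p‖ ≤ L ∧ ‖dyadicInterpolation G p‖ ≤ L := by
      filter_upwards [eventually_level_dyadicFilter hL s,
        eventually_mem_Icc_dyadicFilter (lt_add_one s)] with p hp ht
      exact hp _ ((dyadicIndex_mul_le p.1 ht.1).trans ht.2)
    have hstate : ∀ᶠ p in dyadicFilter s, StateEq ι B (α (dyadicIndex p.1 p.2 * dyadicStep p.1))
        (dyadicInterpolation U p) (dyadicInterpolation W p) (dyadicInterpolation G p) :=
      .of_forall fun p => (hs.isScheme p.1).state (dyadicIndex p.1 p.2)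
    have hcoeff := (hα.continuousOn s hs₀).tendsto.comp (tendsto_dyadicIndex_mul s)
    obtain ⟨v, f, hv, -, -, h⟩ := StateEq.exists_limit hB.monotone hB.hemicontinuous hstate
      (hbound.mono fun _ => And.left) (hbound.mono fun _ => And.right) (hu s hs₀) (hy s hs₀)
      hcoeff (hα.pos s hs₀)
    exact ⟨v, f, hv, h, StateEq.weaklyTendsto hι hιd hB.monotone hB.hemicontinuous hstate
      (hbound.mono fun _ => And.left) (hbound.mono fun _ => And.right) (hu s hs₀)
      (hv ▸ hy s hs₀) hcoeff (hα.pos s hs₀) h⟩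
  choose! v f hv hstate hweak_v hweak_f using hlim
  exact ⟨u, v, f, ⟨hu, fun s hs₀ => hv s hs₀ ▸ hy s hs₀, hweak_v, hweak_f⟩, hstate⟩

end Limit

variable {u₀ v₀ : V} {f₀ : H} {U W : ℕ → ℕ → V} {G : ℕ → ℕ → H} {u v : ℝ → V} {f : ℝ → H}

theorem eq_of_tendsto_dyadicFilter_zero {E : Type*} [TopologicalSpace E] [T2Space E]
    {X : ℕ → ℕ → E} {x x₀ : E} (h : Tendsto (dyadicInterpolation X) (dyadicFilter 0) (𝓝 x))
    (hX : ∀ k, X k 0 = x₀) : x = x₀ := by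
  refine tendsto_nhds_unique (tendsto_level_of_tendsto_dyadicFilter le_rfl h) ?_
  simp only [dyadicInterpolation, dyadicIndex_zero, hX]
  exact tendsto_const_nhds

namespace IsDyadicLimit

theorem u_zero (hl : IsDyadicLimit ι U W G u v f) (hs : IsDyadicScheme ι B α u₀ v₀ f₀ U W G) :
    u 0 = u₀ :=
  eq_of_tendsto_dyadicFilter_zero (hl.tendsto_u 0 self_mem_Ici) hs.u_zero

theorem v_zero (hl : IsDyadicLimit ι U W G u v f) (hs : IsDyadicScheme ι B α u₀ v₀ f₀ U W G) :
    v 0 = v₀ :=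
  ext_inner_right ℝ fun φ => eq_of_tendsto_dyadicFilter_zero (X := fun k n => ⟪W k n, φ⟫)
    (hl.weaklyTendsto_v 0 self_mem_Ici φ) fun k => by rw [hs.v_zero]

theorem isWeakSolution (hl : IsDyadicLimit ι U W G u v f)
    (hs : IsDyadicScheme ι B α u₀ v₀ f₀ U W G)
    (hstate : ∀ s ∈ Ici (0 : ℝ), StateEq ι B (α s) (u s) (v s) (f s)) :
    IsWeakSolution ι B α ∅ u v f where
  continuousOn_u := continuousOn_of_tendsto_dyadicFilter hl.tendsto_u
  continuousOn_v := continuousOn_of_tendsto_dyadicFilter hl.tendsto_v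
  deriv_u t ht := by
    refine hasDerivWithinAt_dyadic_limit (X := fun k n => ι (U k n)) (fun k n => ?_)
      (fun s hs₀ => (ι.continuous.tendsto _).comp (hl.tendsto_u s hs₀)) ht (hl.tendsto_v t ht)
    rw [(hs.isScheme k).step_u, map_add, map_smul]
  state := hstate
  deriv_v t ht φ := by
    refine hasDerivWithinAt_dyadic_limit (X := fun k n => ⟪ι (W k n), φ⟫)
      (G := fun k n => -⟪G k n, φ⟫) (fun k n => ?_)
      (fun s hs₀ => (hl.tendsto_v s hs₀).inner tendsto_const_nhds) ht.1
      (hl.weaklyTendsto_f t ht.1 φ).neg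
    rw [(hs.isScheme k).step_v, inner_sub_left, real_inner_smul_left, smul_eq_mul, mul_neg,
      ← sub_eq_add_neg]

theorem rate_add_le (hl : IsDyadicLimit ι U W G u v f)
    (hs : IsDyadicScheme ι B α u₀ v₀ f₀ U W G) (hB : IsDampingOperator B)
    (hα : IsAdmissibleCoefficient α γ) {T C K : ℝ} (hC : CoeffBound α γ T C)
    (hK : ‖u₀‖ ^ 2 + ‖ι v₀‖ ^ 2 ≤ K) {t : ℝ} (ht : t ∈ Ico 0 T) :
    rate (α t) (γ t) (u t) (v t) (f t) + K ≤
      Real.exp (192 * C ^ 6 * t) * (rate (α 0) (γ 0) u₀ v₀ f₀ + K) := by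
  have := dyadicFilter_neBot ht.1
  have hgrid := tendsto_dyadicIndex_mul t
  have hinv := ((hα.continuousOn t ht.1).tendsto.comp hgrid).inv₀ (hα.pos t ht.1).ne'
  have hvel := ((hl.weaklyTendsto_v t ht.1).smul hinv).add
    ((WeaklyTendsto.of_tendsto (hl.tendsto_u t ht.1)).smul
      ((hα.continuousOn_deriv t ht.1).tendsto.comp hgrid))
  have hforce := (hl.weaklyTendsto_f t ht.1).smul hinv
  have hexp : Tendsto (fun p : ℕ × ℝ =>
      Real.exp (192 * C ^ 6 * (dyadicIndex p.1 p.2 * dyadicStep p.1)) *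
        (rate (α 0) (γ 0) u₀ v₀ f₀ + K) - K) (dyadicFilter t)
      (𝓝 (Real.exp (192 * C ^ 6 * t) * (rate (α 0) (γ 0) u₀ v₀ f₀ + K) - K)) :=
    (((hgrid.mono_right nhdsWithin_le_nhds).const_mul _).rexp.mul_const _).sub_const K
  refine le_sub_iff_add_le.1 (hvel.norm_sq_add_norm_sq_le hforce ?_ hexp)
  filter_upwards [eventually_level_dyadicFilter (hs.eventually_rate_add_le hB hα.pos hC hK) t,
    eventually_mem_Icc_dyadicFilter ht.2] with p hp htime
  exact le_sub_iff_add_le.2 (hp _ ((dyadicIndex_mul_le p.1 htime.1).trans htime.2))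

end IsDyadicLimit

theorem exists_isWeakSolution [CompleteSpace V] [CompleteSpace H] (hι : Function.Injective ι)
    (hιd : DenseRange ι) (hB : IsDampingOperator B) (hα : IsAdmissibleCoefficient α γ)
    (h₀ : StateEq ι B (α 0) u₀ v₀ f₀) :
    ∃ u v f, IsWeakSolution ι B α ∅ u v f ∧ u 0 = u₀ ∧ v 0 = v₀ ∧
      ∀ T C K, CoeffBound α γ T C → ‖u₀‖ ^ 2 + ‖ι v₀‖ ^ 2 ≤ K → ∀ t ∈ Ico 0 T,
        rate (α t) (γ t) (u t) (v t) (f t) + K ≤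
          Real.exp (192 * C ^ 6 * t) * (rate (α 0) (γ 0) u₀ v₀ f₀ + K) := by
  obtain ⟨U, W, G, hs⟩ := exists_isDyadicScheme hB hα.pos h₀
  obtain ⟨u, v, f, hl, hstate⟩ := hs.exists_isDyadicLimit hι hιd hB hα
  exact ⟨u, v, f, hl.isWeakSolution hs hstate, hl.u_zero hs, hl.v_zero hs,
    fun T C K hC hK t ht => hl.rate_add_le hs hB hα hC hK ht⟩

end Existence

section DiniDerivative

variable {G : ℝ → ℝ} {S : Set ℝ} {a b : ℝ}

/- The first time at which `G` takes a value between `G a` and `G b` cannot be a point where `G`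
is not larger than just before. -/
theorem Ioo_subset_image_of_eventually_le_left (hab : a ≤ b) (hG : ContinuousOn G (Icc a b))
    (h : ∀ t ∈ Ioc a b \ S, ∀ᶠ s in 𝓝[<] t, G t ≤ G s) : Ioo (G a) (G b) ⊆ G '' S := by
  intro c hc
  have hcompact : IsCompact (Icc a b ∩ G ⁻¹' {c}) := isCompact_Icc.of_isClosed_subset
    (hG.preimage_isClosed_of_isClosed isClosed_Icc isClosed_singleton) inter_subset_left
  obtain ⟨t₀, ht₀, hGt₀⟩ := intermediate_value_Icc hab hG ⟨hc.1.le, hc.2.le⟩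
  obtain ⟨t, ⟨ht, hGt : G t = c⟩, hmin⟩ := hcompact.exists_isLeast ⟨t₀, ht₀, hGt₀⟩
  have hat : a < t := ht.1.lt_of_ne (by rintro rfl; exact hc.1.ne hGt)
  refine ⟨t, by_contra fun htS => ?_, hGt⟩
  obtain ⟨s, hGs, hs⟩ := ((h t ⟨⟨hat, ht.2⟩, htS⟩).and (Ioo_mem_nhdsLT hat)).exists
  have hsb : s ≤ b := hs.2.le.trans ht.2
  obtain ⟨r, hr, hGr⟩ := intermediate_value_Icc hs.1.le (hG.mono (Icc_subset_Icc_right hsb))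
    ⟨hc.1.le, hGt ▸ hGs⟩
  exact ((hmin ⟨⟨hr.1, hr.2.trans hsb⟩, hGr⟩).trans hr.2).not_gt hs.2

theorem apply_le_of_eventually_le_left (hab : a ≤ b) (hG : ContinuousOn G (Icc a b))
    (hS : S.Countable) (h : ∀ t ∈ Ioc a b \ S, ∀ᶠ s in 𝓝[<] t, G t ≤ G s) : G b ≤ G a := by
  have hnull : volume (Ioo (G a) (G b)) = 0 :=
    ((hS.image G).mono (Ioo_subset_image_of_eventually_le_left hab hG h)).measure_zero _
  rwa [Real.volume_Ioo, ENNReal.ofReal_eq_zero, sub_nonpos] at hnull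

theorem apply_le_of_left_dini_nonpos (hab : a ≤ b) (hG : ContinuousOn G (Icc a b))
    (hS : S.Countable)
    (h : ∀ t ∈ Ioc a b \ S, ∀ ε > 0, ∀ᶠ s in 𝓝[<] t, G t - G s ≤ ε * (t - s)) :
    G b ≤ G a := by
  have hperturbed : ∀ ε > 0, G b ≤ G a + ε * (b - a) := fun ε hε => by
    have hle := apply_le_of_eventually_le_left (G := fun t => G t - ε * t) hab
      (hG.sub (by fun_prop)) hS fun t ht => (h t ht ε hε).mono fun s hs => by linarith
    linarith
  have hlim : Tendsto (fun ε => G a + ε * (b - a)) (𝓝[>] 0) (𝓝 (G a)) :=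
    (Continuous.tendsto' (by fun_prop) 0 (G a) (by ring)).mono_left nhdsWithin_le_nhds
  exact ge_of_tendsto hlim (eventually_mem_nhdsWithin.mono hperturbed)

end DiniDerivative

section LeftQuotient

theorem tendsto_left_quotient {E : Type*} [NormedAddCommGroup E] [NormedSpace ℝ E]
    {x : ℝ → E} {x' : E} {t : ℝ} (ht : 0 < t) (h : HasDerivWithinAt x x' (Ici 0) t) :
    Tendsto (fun s => (t - s)⁻¹ • (x t - x s)) (𝓝[<] t) (𝓝 x') := by
  have hslope := (hasDerivAt_iff_tendsto_slope.1 (h.hasDerivAt (Ici_mem_nhds ht))).mono_left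
    (nhdsWithin_mono t fun s (hs : s < t) => hs.ne)
  refine hslope.congr fun s => ?_
  rw [slope_def_module, ← neg_sub t s, ← neg_sub (x t) (x s), inv_neg, neg_smul, smul_neg, neg_neg]

theorem eventually_sq_norm_sub_sq_norm_le {E : Type*} [NormedAddCommGroup E]
    [InnerProductSpace ℝ E] {x : ℝ → E} {t l ε : ℝ}
    (h : Tendsto (fun s => ⟪(t - s)⁻¹ • (x t - x s), x t⟫) (𝓝[<] t) (𝓝 l)) (hl : 2 * l < ε) :
    ∀ᶠ s in 𝓝[<] t, ‖x t‖ ^ 2 - ‖x s‖ ^ 2 ≤ ε * (t - s) := by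
  filter_upwards [(h.const_mul 2).eventually_le_const hl, self_mem_nhdsWithin] with s hs hst
  have hpos : 0 < t - s := sub_pos.2 hst
  calc ‖x t‖ ^ 2 - ‖x s‖ ^ 2 ≤ 2 * ⟪x t, x t - x s⟫ := norm_sq_sub_norm_sq_le_two_inner _ _
    _ = 2 * ⟪(t - s)⁻¹ • (x t - x s), x t⟫ * (t - s) := by
        rw [real_inner_smul_left, real_inner_comm (x t) (x t - x s)]
        field_simp
    _ ≤ ε * (t - s) := by gcongr

end LeftQuotient

section Uniqueness

theorem norm_le_of_inner_self_le {E : Type*} [NormedAddCommGroup E] [InnerProductSpace ℝ E] {x : E}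
    {c : ℝ} (hc : 0 ≤ c) (h : ⟪x, x⟫ ≤ c * ‖x‖) : ‖x‖ ≤ c := by
  rw [real_inner_self_eq_norm_mul_norm] at h
  rcases (norm_nonneg x).eq_or_lt with hzero | hpos
  · exact hzero ▸ hc
  · exact le_of_mul_le_mul_right h hpos

theorem hasDerivWithinAt_comp_const_add {E : Type*} [NormedAddCommGroup E] [NormedSpace ℝ E]
    {x : ℝ → E} {x' : E} {a t : ℝ} (ha : 0 ≤ a) (h : HasDerivWithinAt x x' (Ici 0) (a + t)) :
    HasDerivWithinAt (fun s => x (a + s)) x' (Ici 0) t := by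
  have hadd : MapsTo (a + ·) (Ici 0) (Ici 0) := fun s hs => add_nonneg ha hs
  simpa only [one_smul, Function.comp_def] using
    h.scomp t ((hasDerivAt_id t).const_add a).hasDerivWithinAt hadd

variable {V H : Type*} [NormedAddCommGroup V] [InnerProductSpace ℝ V]
  [NormedAddCommGroup H] [InnerProductSpace ℝ H] {ι : V →L[ℝ] H} {B : V → StrongDual ℝ V}
  {α γ : ℝ → ℝ} {S S' : Set ℝ} {u v u' v' : ℝ → V} {f f' : ℝ → H}

theorem CoeffBound.shift {T C a : ℝ} (ha : 0 ≤ a) (h : CoeffBound α γ (a + T) C) :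
    CoeffBound (fun s => α (a + s)) (fun s => γ (a + s)) T C := by
  have hmem : ∀ {t}, t ∈ Icc 0 T → a + t ∈ Icc 0 (a + T) := fun ht =>
    ⟨add_nonneg ha ht.1, add_le_add_right ht.2 a⟩
  have hsub : ∀ s t, t - s = (a + t) - (a + s) := fun s t => (add_sub_add_left_eq_sub t s a).symm
  refine ⟨h.one_le, fun t ht => h.pos _ (hmem ht), fun t ht => h.le _ (hmem ht),
    fun t ht => h.inv_le _ (hmem ht), fun t ht => h.abs_deriv_le _ (hmem ht),
    fun s hs t ht => ?_, fun s hs t ht => ?_, fun s hs t ht => ?_, fun s hs t ht => ?_⟩ <;>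
  rw [hsub s t]
  exacts [h.lipschitz _ (hmem hs) _ (hmem ht), h.lipschitz_inv _ (hmem hs) _ (hmem ht),
    h.lipschitz_deriv _ (hmem hs) _ (hmem ht), h.taylor _ (hmem hs) _ (hmem ht)]

theorem IsAdmissibleCoefficient.shift (hα : IsAdmissibleCoefficient α γ) {a : ℝ} (ha : 0 ≤ a) :
    IsAdmissibleCoefficient (fun s => α (a + s)) (fun s => γ (a + s)) := fun T hT =>
  (hα (a + T) (add_pos_of_nonneg_of_pos ha hT)).imp fun _ h => h.shift ha

namespace IsWeakSolution

theorem shift (h : IsWeakSolution ι B α S u v f) {a : ℝ} (ha : 0 ≤ a) :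
    IsWeakSolution ι B (fun s => α (a + s)) ((fun s => a + s) ⁻¹' S) (fun s => u (a + s))
      (fun s => v (a + s)) (fun s => f (a + s)) := by
  have hadd : ContinuousOn (fun s => a + s) (Ici 0) := by fun_prop
  have hmaps : MapsTo (fun s => a + s) (Ici (0 : ℝ)) (Ici 0) := fun s hs => add_nonneg ha hs
  exact ⟨h.continuousOn_u.comp hadd hmaps, h.continuousOn_v.comp hadd hmaps,
    fun t ht => hasDerivWithinAt_comp_const_add ha (h.deriv_u (a + t) (hmaps ht)),
    fun t ht => h.state (a + t) (hmaps ht),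
    fun t ht φ => hasDerivWithinAt_comp_const_add ha (h.deriv_v (a + t) ⟨hmaps ht.1, ht.2⟩ φ)⟩

theorem isClosed_setOf_norm_prod_le [CompleteSpace V] [CompleteSpace H]
    (h : IsWeakSolution ι B α S u v f) (hι : Function.Injective ι)
    (hιd : DenseRange ι) (hB : IsDampingOperator B) (hα : IsAdmissibleCoefficient α γ) (L : ℝ) :
    IsClosed {t | t ∈ Ici 0 ∧ ‖(v t, f t)‖ ≤ L} := by
  simp only [norm_prod_le_iff]
  set F := {t | t ∈ Ici 0 ∧ ‖v t‖ ≤ L ∧ ‖f t‖ ≤ L}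
  have hF : F ⊆ Ici 0 := fun t ht => ht.1
  refine isClosed_of_closure_subset fun t ht => ?_
  have ht₀ : t ∈ Ici 0 := closure_minimal hF isClosed_Ici ht
  have : (𝓝[F] t).NeBot := mem_closure_iff_nhdsWithin_neBot.1 ht
  have hmem : ∀ᶠ s in 𝓝[F] t, s ∈ F := self_mem_nhdsWithin
  obtain ⟨v₀, f₀, hv₀, hv₀L, hf₀L, hstate⟩ := StateEq.exists_limit hB.monotone hB.hemicontinuous
    (hmem.mono fun s hs => h.state s hs.1) (hmem.mono fun s hs => hs.2.1)
    (hmem.mono fun s hs => hs.2.2) ((h.continuousOn_u t ht₀).mono hF)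
    ((h.continuousOn_v t ht₀).mono hF) ((hα.continuousOn t ht₀).mono hF) (hα.pos t ht₀)
  obtain rfl := hι hv₀
  obtain rfl := hstate.unique hιd (h.state t ht₀)
  exact ⟨ht₀, hv₀L, hf₀L⟩

theorem weaklyTendsto [CompleteSpace V] [CompleteSpace H] (h : IsWeakSolution ι B α S u v f)
    (hι : Function.Injective ι) (hιd : DenseRange ι)
    (hB : IsDampingOperator B) (hα : IsAdmissibleCoefficient α γ) {t : ℝ} (ht : t ∈ Ici 0)
    (hb : IsBoundedUnder (· ≤ ·) (𝓝[Ici 0] t) fun r => ‖(v r, f r)‖) :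
    WeaklyTendsto v (𝓝[Ici 0] t) (v t) ∧ WeaklyTendsto f (𝓝[Ici 0] t) (f t) := by
  obtain ⟨L, hL⟩ := hb
  rw [eventually_map] at hL
  exact StateEq.weaklyTendsto hι hιd hB.monotone hB.hemicontinuous
    (eventually_mem_nhdsWithin.mono h.state)
    (hL.mono fun r hr => (norm_fst_le (v r, f r)).trans hr)
    (hL.mono fun r hr => (norm_snd_le (v r, f r)).trans hr)
    (h.continuousOn_u t ht) (h.continuousOn_v t ht) (hα.continuousOn t ht) (hα.pos t ht)
    (h.state t ht)

theorem norm_position_sub_le [CompleteSpace V] [CompleteSpace H]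
    (h : IsWeakSolution ι B α S u v f) (hι : Function.Injective ι)
    {c b L : ℝ} (hc : 0 ≤ c) (hL : ∀ t ∈ Icc c b, ‖v t‖ ≤ L) {s t : ℝ} (hs : s ∈ Icc c b)
    (ht : t ∈ Icc c b) : ‖u t - u s‖ ≤ L * |t - s| := by
  have hL₀ : 0 ≤ L := (norm_nonneg _).trans (hL t ht)
  have hinner : ∀ z, ⟪z, u t - u s⟫ ≤ L * |t - s| * ‖z‖ := fun z => by
    refine (denseRange_adjoint hι).induction_on (p := fun z => ⟪z, u t - u s⟫ ≤ L * |t - s| * ‖z‖)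
      z (isClosed_le (by fun_prop) (by fun_prop)) fun φ => ?_
    have hderiv : ∀ r ∈ Icc c b,
        HasDerivWithinAt (fun r => ⟪φ, ι (u r)⟫) ⟪φ, ι (v r)⟫ (Icc c b) r := fun r hr => by
      simpa using (hasDerivWithinAt_const r (Icc c b) φ).inner ℝ
        ((h.deriv_u r (hc.trans hr.1)).mono fun x hx => hc.trans hx.1)
    have hbound : ∀ r ∈ Icc c b, ‖⟪φ, ι (v r)⟫‖ ≤ ‖ι.adjoint φ‖ * L := fun r hr => by
      rw [← ContinuousLinearMap.adjoint_inner_left]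
      exact (norm_inner_le_norm _ _).trans (by gcongr; exact hL r hr)
    calc ⟪ι.adjoint φ, u t - u s⟫ = ⟪φ, ι (u t)⟫ - ⟪φ, ι (u s)⟫ := by
          rw [ContinuousLinearMap.adjoint_inner_left, map_sub, inner_sub_right]
      _ ≤ ‖ι.adjoint φ‖ * L * |t - s| := (le_abs_self _).trans
          ((convex_Icc c b).norm_image_sub_le_of_norm_hasDerivWithin_le hderiv hbound hs ht)
      _ = L * |t - s| * ‖ι.adjoint φ‖ := by ring
  exact norm_le_of_inner_self_le (by positivity) (hinner _)

theorem weaklyTendsto_left_quotient [CompleteSpace V] [CompleteSpace H]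
    (h : IsWeakSolution ι B α S u v f) (hι : Function.Injective ι) {c t L : ℝ} (hc : 0 ≤ c)
    (hct : c < t) (hL : ∀ r ∈ Icc c t, ‖v r‖ ≤ L) :
    WeaklyTendsto (fun s => (t - s)⁻¹ • (u t - u s)) (𝓝[<] t) (v t) := by
  have hbound : ∀ᶠ s in 𝓝[<] t, ‖(t - s)⁻¹ • (u t - u s)‖ ≤ L := by
    filter_upwards [Ioo_mem_nhdsLT hct] with s hs
    have hpos : 0 < t - s := sub_pos.2 hs.2
    rw [norm_smul, norm_inv, inv_mul_le_iff₀' (norm_pos_iff.2 hpos.ne')]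
    exact h.norm_position_sub_le hι hc hL ⟨hs.1.le, hs.2.le⟩ ⟨hct.le, le_rfl⟩
  refine .of_map hι hbound (.of_tendsto ?_)
  simpa only [map_smul, map_sub] using
    tendsto_left_quotient (hc.trans_lt hct) (h.deriv_u t (hc.trans hct.le))

/- The energy of the difference has nonpositive left derivative, because `B` is monotone. The
velocities need to be bounded in `V` for the positions to be weakly differentiable in `V`. -/
theorem eventually_energy_sub_le [CompleteSpace V] [CompleteSpace H]
    (h : IsWeakSolution ι B α S u v f) (h' : IsWeakSolution ι B α S' u' v' f')
    (hι : Function.Injective ι) (hB : IsMonotoneOperator B) {c t L L' ε : ℝ}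
    (hα : 0 ≤ α t) (hc : 0 ≤ c) (hct : c < t) (hL : ∀ r ∈ Icc c t, ‖v r‖ ≤ L)
    (hL' : ∀ r ∈ Icc c t, ‖v' r‖ ≤ L') (htS : t ∉ S ∪ S') (hε : 0 < ε) :
    ∀ᶠ s in 𝓝[<] t, ‖u t - u' t‖ ^ 2 + ‖ι (v t) - ι (v' t)‖ ^ 2 -
      (‖u s - u' s‖ ^ 2 + ‖ι (v s) - ι (v' s)‖ ^ 2) ≤ ε * (t - s) := by
  have ht : 0 < t := hc.trans_lt hct
  set φ := ι (v t) - ι (v' t) with hφ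
  have hposition : Tendsto
      (fun s => ⟪(t - s)⁻¹ • ((u t - u' t) - (u s - u' s)), u t - u' t⟫) (𝓝[<] t)
      (𝓝 ⟪v t - v' t, u t - u' t⟫) := by
    have hlim := (h.weaklyTendsto_left_quotient hι hc hct hL (u t - u' t)).sub
      (h'.weaklyTendsto_left_quotient hι hc hct hL' (u t - u' t))
    simpa only [← inner_sub_left, ← smul_sub, sub_sub_sub_comm] using hlim
  have hvelocity : Tendsto (fun s => ⟪(t - s)⁻¹ • (φ - (ι (v s) - ι (v' s))), φ⟫) (𝓝[<] t)
      (𝓝 (-⟪f t - f' t, φ⟫)) := by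
    have hlim := (tendsto_left_quotient ht (h.deriv_v t ⟨ht.le, fun hS => htS (.inl hS)⟩ φ)).sub
      (tendsto_left_quotient ht (h'.deriv_v t ⟨ht.le, fun hS => htS (.inr hS)⟩ φ))
    rw [neg_sub_neg, ← neg_sub, ← inner_sub_left] at hlim
    refine hlim.congr fun s => ?_
    simp only [hφ, smul_eq_mul, inner_sub_left, real_inner_smul_left]
    ring
  have hdissipation : ⟪v t - v' t, u t - u' t⟫ - ⟪f t - f' t, φ⟫ ≤ 0 := by
    have hle := (h.state t ht.le).inner_sub_le hB hα (h'.state t ht.le)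
    rwa [sub_self, abs_zero, zero_mul, real_inner_comm, map_sub] at hle
  filter_upwards [
    eventually_sq_norm_sub_sq_norm_le (x := fun s => u s - u' s)
      (ε := 2 * ⟪v t - v' t, u t - u' t⟫ + ε / 2) hposition (by linarith),
    eventually_sq_norm_sub_sq_norm_le (x := fun s => ι (v s) - ι (v' s))
      (ε := 2 * -⟪f t - f' t, φ⟫ + ε / 2) hvelocity (by linarith), self_mem_nhdsWithin]
    with s hs hs' (hst : s < t)
  nlinarith [mul_nonneg (neg_nonneg.2 hdissipation) (sub_nonneg.2 hst.le)]

theorem eq_of_velocity_bounded [CompleteSpace V] [CompleteSpace H]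
    (h : IsWeakSolution ι B α S u v f) (h' : IsWeakSolution ι B α S' u' v' f')
    (hS : S.Countable) (hS' : S'.Countable) (hι : Function.Injective ι)
    (hB : IsMonotoneOperator B) (hα : ∀ t ∈ Ici (0 : ℝ), 0 < α t) (hu₀ : u 0 = u' 0)
    (hv₀ : v 0 = v' 0) {t : ℝ} (ht : t ∈ Ici 0)
    (hb : ∀ c ∈ Ioo 0 t, ∃ L, ∀ r ∈ Icc c t, ‖v r‖ ≤ L)
    (hb' : ∀ c ∈ Ioo 0 t, ∃ L, ∀ r ∈ Icc c t, ‖v' r‖ ≤ L) :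
    u t = u' t ∧ v t = v' t := by
  have hcont : ContinuousOn (fun t => ‖u t - u' t‖ ^ 2 + ‖ι (v t) - ι (v' t)‖ ^ 2) (Ici 0) :=
    ((h.continuousOn_u.sub h'.continuousOn_u).norm.pow 2).add
      ((h.continuousOn_v.sub h'.continuousOn_v).norm.pow 2)
  have henergy := apply_le_of_left_dini_nonpos ht (hcont.mono Icc_subset_Ici_self)
    (hS.union hS') fun τ hτ ε hε => by
      have hτ₀ : 0 < τ := hτ.1.1
      have hmem : τ / 2 ∈ Ioo 0 t := ⟨half_pos hτ₀, (half_lt_self hτ₀).trans_le hτ.1.2⟩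
      obtain ⟨L, hL⟩ := hb _ hmem
      obtain ⟨L', hL'⟩ := hb' _ hmem
      exact h.eventually_energy_sub_le h' hι hB (hα τ hτ₀.le).le hmem.1.le (half_lt_self hτ₀)
        (fun r hr => hL r ⟨hr.1, hr.2.trans hτ.1.2⟩)
        (fun r hr => hL' r ⟨hr.1, hr.2.trans hτ.1.2⟩) hτ.2 hε
  rw [hu₀, hv₀, sub_self, sub_self, norm_zero, norm_zero, zero_pow two_ne_zero, add_zero] at henergy
  obtain ⟨hu, hv⟩ := (add_eq_zero_iff_of_nonneg (sq_nonneg _) (sq_nonneg _)).1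
    (henergy.antisymm (add_nonneg (sq_nonneg _) (sq_nonneg _)))
  rw [sq_eq_zero_iff, norm_eq_zero, sub_eq_zero] at hu hv
  exact ⟨hu, hι hv⟩

theorem exists_energy_bound (h : IsWeakSolution ι B α S u v f) (T : ℝ) :
    ∃ K, ∀ t ∈ Icc 0 T, ‖u t‖ ^ 2 + ‖ι (v t)‖ ^ 2 ≤ K := by
  obtain ⟨K, hK⟩ := isCompact_Icc.exists_bound_of_continuousOn
    (((h.continuousOn_u.norm.pow 2).add (h.continuousOn_v.norm.pow 2)).mono
      (Icc_subset_Ici_self : Icc 0 T ⊆ Ici 0))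
  exact ⟨K, fun t ht => (le_abs_self _).trans (hK t ht)⟩

theorem exists_norm_velocity_le_of_rate_add_le (h : IsWeakSolution ι B α S u v f)
    (hα : IsAdmissibleCoefficient α γ) {Q : ℝ → ℝ}
    (hrate : ∀ T C K, CoeffBound α γ T C → ‖u 0‖ ^ 2 + ‖ι (v 0)‖ ^ 2 ≤ K → ∀ t ∈ Ico 0 T,
      rate (α t) (γ t) (u t) (v t) (f t) + K ≤ Real.exp (192 * C ^ 6 * t) * Q K)
    {T : ℝ} (hT : 0 ≤ T) : ∃ L, ∀ t ∈ Icc 0 T, ‖v t‖ ≤ L := by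
  obtain ⟨C, hC⟩ := hα (T + 1) (add_pos_of_nonneg_of_pos hT one_pos)
  obtain ⟨K, hK⟩ := h.exists_energy_bound T
  refine ⟨2 * C ^ 2 * √(Real.exp (192 * C ^ 6 * (T + 1)) * Q K), fun t ht => ?_⟩
  have htT : t < T + 1 := ht.2.trans_lt (lt_add_one T)
  exact (norm_le_of_rate_add_le hC ⟨ht.1, htT.le⟩
    ((le_add_of_nonneg_right (sq_nonneg _)).trans (hK t ht))
    (hrate _ C K hC (hK 0 ⟨le_rfl, hT⟩) t ⟨ht.1, htT⟩)).1

theorem rate_add_le_of_start_zero [CompleteSpace V] [CompleteSpace H]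
    (h : IsWeakSolution ι B α S u v f) (hS : S.Countable)
    (hι : Function.Injective ι) (hιd : DenseRange ι) (hB : IsDampingOperator B)
    (hα : IsAdmissibleCoefficient α γ) {T C K t : ℝ} (hC : CoeffBound α γ T C)
    (ht : t ∈ Ico 0 T) (hK : ‖u 0‖ ^ 2 + ‖ι (v 0)‖ ^ 2 ≤ K)
    (hb : ∀ c ∈ Ioo 0 t, ∃ L, ∀ r ∈ Icc c t, ‖v r‖ ≤ L) :
    rate (α t) (γ t) (u t) (v t) (f t) + K ≤
      Real.exp (192 * C ^ 6 * t) * (rate (α 0) (γ 0) (u 0) (v 0) (f 0) + K) := by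
  obtain ⟨u', v', f', h', hu₀, hv₀, hrate⟩ :=
    exists_isWeakSolution hι hιd hB hα (h.state 0 self_mem_Ici)
  obtain ⟨L, hL⟩ := h'.exists_norm_velocity_le_of_rate_add_le hα (by rwa [hu₀, hv₀]) ht.1
  obtain ⟨hu, hv⟩ := h.eq_of_velocity_bounded h' hS countable_empty hι hB.monotone hα.pos
    hu₀.symm hv₀.symm ht.1 hb fun c hc => ⟨L, fun r hr => hL r ⟨hc.1.le.trans hr.1, hr.2⟩⟩
  have hf : f t = f' t :=
    (h.state t ht.1).unique hιd (by rw [hu, hv]; exact h'.state t ht.1)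
  rw [hu, hv, hf]
  exact hrate T C K hC hK t ht

theorem rate_add_le [CompleteSpace V] [CompleteSpace H] (h : IsWeakSolution ι B α S u v f)
    (hS : S.Countable) (hι : Function.Injective ι) (hιd : DenseRange ι) (hB : IsDampingOperator B)
    (hα : IsAdmissibleCoefficient α γ) {T C K a t : ℝ} (hC : CoeffBound α γ T C) (ha : 0 ≤ a)
    (hat : a ≤ t) (htT : t < T) (hK : ‖u a‖ ^ 2 + ‖ι (v a)‖ ^ 2 ≤ K)
    (hb : ∀ c ∈ Ioo a t, ∃ L, ∀ r ∈ Icc c t, ‖v r‖ ≤ L) :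
    rate (α t) (γ t) (u t) (v t) (f t) + K ≤
      Real.exp (192 * C ^ 6 * (t - a)) * (rate (α a) (γ a) (u a) (v a) (f a) + K) := by
  have hrate := (h.shift ha).rate_add_le_of_start_zero (hS.preimage (add_right_injective a))
    hι hιd hB (hα.shift ha) (T := T - a) (K := K) (t := t - a) (.shift ha (by rwa [add_sub_cancel]))
    ⟨sub_nonneg.2 hat, sub_lt_sub_right htT a⟩ (by rwa [add_zero]) fun c hc => by
      obtain ⟨L, hL⟩ := hb (a + c) ⟨lt_add_of_pos_right a hc.1, lt_sub_iff_add_lt'.1 hc.2⟩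
      exact ⟨L, fun r hr => hL _ ⟨add_le_add_right hr.1 a, le_sub_iff_add_le'.1 hr.2⟩⟩
  simpa only [add_sub_cancel, add_zero] using hrate

end IsWeakSolution

end Uniqueness

section LocalBoundedness

variable {ρ : ℝ → ℝ}

/-- The times `t ≥ 0` near which the function `ρ` on `[0, ∞)` is not bounded above. -/
def unboundedTimes (ρ : ℝ → ℝ) : Set ℝ :=
  {t | t ∈ Ici 0 ∧ ¬IsBoundedUnder (· ≤ ·) (𝓝[Ici 0] t) ρ}

theorem isClosed_unboundedTimes (ρ : ℝ → ℝ) : IsClosed (unboundedTimes ρ) := by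
  have hsub : unboundedTimes ρ ⊆ Ici 0 := fun s hs => hs.1
  refine isClosed_of_closure_subset fun s hs => ⟨closure_minimal hsub isClosed_Ici hs, ?_⟩
  rintro ⟨L, hL⟩
  have hnear : ∀ᶠ r in 𝓝[unboundedTimes ρ] s, ∀ᶠ r' in 𝓝[Ici 0] r, ρ r' ≤ L :=
    nhdsWithin_mono s hsub (eventually_eventually_nhdsWithin.2 hL)
  have : (𝓝[unboundedTimes ρ] s).NeBot := mem_closure_iff_nhdsWithin_neBot.1 hs
  obtain ⟨r, hr, hunbounded⟩ := (hnear.and self_mem_nhdsWithin).exists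
  exact hunbounded.2 ⟨L, hr⟩

theorem exists_bound_of_disjoint_unboundedTimes {c b : ℝ} (hc : 0 ≤ c)
    (h : Disjoint (Icc c b) (unboundedTimes ρ)) : ∃ L, ∀ t ∈ Icc c b, ρ t ≤ L := by
  refine isCompact_Icc.induction_on (p := fun s => ∃ L, ∀ t ∈ s, ρ t ≤ L) ⟨0, by simp⟩
    (fun s t hst ⟨L, hL⟩ => ⟨L, fun r hr => hL r (hst hr)⟩) (fun s t ⟨L, hL⟩ ⟨L', hL'⟩ =>
      ⟨max L L', fun r hr => hr.elim (fun hr => le_max_of_le_left (hL r hr))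
        fun hr => le_max_of_le_right (hL' r hr)⟩) fun t ht => ?_
  obtain ⟨L, hL⟩ : IsBoundedUnder (· ≤ ·) (𝓝[Ici 0] t) ρ :=
    by_contra fun hunbounded => disjoint_left.1 h ht ⟨hc.trans ht.1, hunbounded⟩
  exact ⟨_, nhdsWithin_mono t (fun x hx => hc.trans hx.1) hL, L, fun r hr => hr⟩

/- The Baire category theorem on the closed set of times near which `ρ` is unbounded. -/
theorem exists_locally_le_on_unboundedTimes (hclosed : ∀ L, IsClosed {t | t ∈ Ici 0 ∧ ρ t ≤ L})
    (hne : (unboundedTimes ρ).Nonempty) :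
    ∃ z ∈ unboundedTimes ρ, ∃ ε > 0, ∃ L, ∀ s ∈ unboundedTimes ρ, |s - z| < ε → ρ s ≤ L := by
  have : Nonempty (unboundedTimes ρ) := hne.to_subtype
  have : CompleteSpace (unboundedTimes ρ) := (isClosed_unboundedTimes ρ).completeSpace_coe
  obtain ⟨n, z, hz⟩ := nonempty_interior_of_iUnion_of_closed
    (f := fun n : ℕ => ((↑) : unboundedTimes ρ → ℝ) ⁻¹' {t | t ∈ Ici 0 ∧ ρ t ≤ n})
    (fun n => (hclosed n).preimage continuous_subtype_val) <|
    eq_univ_of_forall fun z => mem_iUnion.2 <| (exists_nat_ge (ρ z)).imp fun n hn => ⟨z.2.1, hn⟩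
  rw [mem_interior_iff_mem_nhds, Metric.mem_nhds_iff] at hz
  obtain ⟨ε, hε, hball⟩ := hz
  refine ⟨z, z.2, ε, hε, n, fun s hs hsz => (@hball ⟨s, hs⟩ ?_).2⟩
  rwa [Metric.mem_ball, Subtype.dist_eq, Real.dist_eq]

theorem isBoundedUnder_of_propagation (hclosed : ∀ L, IsClosed {t | t ∈ Ici 0 ∧ ρ t ≤ L})
    (hprop : ∀ T L, ∃ M, ∀ a t, 0 ≤ a → a ≤ t → t ≤ T → ρ a ≤ L →
      (∀ c ∈ Ioo a t, ∃ L', ∀ r ∈ Icc c t, ρ r ≤ L') → ρ t ≤ M)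
    {t : ℝ} (ht : t ∈ Ici 0) : IsBoundedUnder (· ≤ ·) (𝓝[Ici 0] t) ρ := by
  by_contra hunbounded
  obtain ⟨z, hz, ε, hε, L, hL⟩ := exists_locally_le_on_unboundedTimes hclosed ⟨t, ht, hunbounded⟩
  set s := max 0 (z - ε / 2)
  obtain ⟨M, hM⟩ := hprop (z + ε / 2) (max L (ρ s))
  refine hz.2 ⟨M, eventually_map.2 ?_⟩
  have hIoo : Ioo (z - ε / 2) (z + ε / 2) ∈ 𝓝 z := Ioo_mem_nhds (by linarith) (by linarith)
  filter_upwards [self_mem_nhdsWithin, mem_nhdsWithin_of_mem_nhds hIoo] with r hr₀ hr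
  have hsr : s ≤ r := max_le hr₀ hr.1.le
  obtain ⟨a, ⟨ha, har⟩, hmax⟩ := (isCompact_Icc.inter_left
    ((isClosed_unboundedTimes ρ).union (isClosed_singleton (x := s)))).exists_isGreatest
    (⟨s, .inr rfl, le_rfl, hsr⟩ : ((unboundedTimes ρ ∪ {s}) ∩ Icc s r).Nonempty)
  have ha₀ : 0 ≤ a := (le_max_left _ _).trans har.1
  have hρa : ρ a ≤ max L (ρ s) := by
    rcases ha with ha | rfl
    · have hza : z - ε / 2 ≤ a := (le_max_right _ _).trans har.1
      exact le_max_of_le_left (hL a ha (abs_lt.2 ⟨by linarith, by linarith [har.2, hr.2]⟩))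
    · exact le_max_right _ _
  refine hM a r ha₀ har.2 hr.2.le hρa fun c hc => ?_
  refine exists_bound_of_disjoint_unboundedTimes (ha₀.trans hc.1.le)
    (disjoint_left.2 fun x hx hxZ => ?_)
  have hax : a < x := hc.1.trans_le hx.1
  exact (hmax ⟨.inl hxZ, har.1.trans hax.le, hx.2⟩).not_gt hax

end LocalBoundedness

section Regularity

/- Jump discontinuities of antitone functions are countable, and `ρ` is recovered from such a
function by continuous operations. -/
theorem countable_not_continuousWithinAt_of_antitoneOn_exp_mul {ρ : ℝ → ℝ}
    (h : ∀ T > 0, ∃ c K, AntitoneOn (fun t => Real.exp (-(c * t)) * (ρ t + K)) (Icc 0 T)) :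
    {t | t ∈ Ici 0 ∧ ¬ContinuousWithinAt ρ (Ici 0) t}.Countable := by
  have hcompact : ∀ T > 0, {t | t ∈ Icc 0 T ∧ ¬ContinuousWithinAt ρ (Icc 0 T) t}.Countable := by
    intro T hT
    obtain ⟨c, K, hanti⟩ := h T hT
    refine hanti.countable_not_continuousWithinAt.mono ?_
    rintro t ⟨ht, hjump⟩
    refine ⟨ht, fun hcont => hjump ?_⟩
    have hexp : Continuous fun t => Real.exp (c * t) := by fun_prop
    have hρ : ∀ t, ρ t = Real.exp (c * t) * (Real.exp (-(c * t)) * (ρ t + K)) - K := fun t => by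
      rw [← mul_assoc, ← Real.exp_add, add_neg_cancel, Real.exp_zero, one_mul, add_sub_cancel_right]
    exact ((hexp.continuousWithinAt.mul hcont).sub continuousWithinAt_const).congr
      (fun s _ => hρ s) (hρ t)
  refine (countable_iUnion fun n : ℕ => hcompact (n + 1) n.cast_add_one_pos).mono fun t ht => ?_
  obtain ⟨n, hn⟩ := exists_nat_ge t
  have htn : t < n + 1 := hn.trans_lt (lt_add_one _)
  refine mem_iUnion.2 ⟨n, ⟨ht.1, htn.le⟩, fun hcont => ht.2 (hcont.mono_of_mem_nhdsWithin ?_)⟩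
  exact inter_mem self_mem_nhdsWithin (mem_nhdsWithin_of_mem_nhds (Iic_mem_nhds htn))

theorem hasDerivWithinAt_of_inner {E : Type*} [NormedAddCommGroup E] [InnerProductSpace ℝ E]
    {y y' : ℝ → E} {s : Set ℝ} (hs : Convex ℝ s)
    (h : ∀ t ∈ s, ∀ φ, HasDerivWithinAt (fun r => ⟪y r, φ⟫) ⟪y' t, φ⟫ s t) {t : ℝ} (ht : t ∈ s)
    (hy' : ContinuousWithinAt y' s t) : HasDerivWithinAt y (y' t) s t := by
  rw [hasDerivWithinAt_iff_isLittleO, Asymptotics.isLittleO_iff]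
  intro c hc
  obtain ⟨δ, hδ, hball⟩ := Metric.continuousWithinAt_iff.1 hy' c hc
  filter_upwards [self_mem_nhdsWithin, mem_nhdsWithin_of_mem_nhds (Metric.ball_mem_nhds t hδ)]
    with r hrs hrδ
  refine norm_le_of_inner_self_le (by positivity) ?_
  set φ := y r - y t - (r - t) • y' t with hφ
  have hderiv : ∀ q ∈ s ∩ Metric.ball t δ, HasDerivWithinAt (fun q => ⟪y q, φ⟫ - q * ⟪y' t, φ⟫)
      (⟪y' q, φ⟫ - 1 * ⟪y' t, φ⟫) (s ∩ Metric.ball t δ) q := fun q hq =>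
    ((h q hq.1 φ).mono inter_subset_left).sub ((hasDerivWithinAt_id q _).mul_const _)
  have hbound : ∀ q ∈ s ∩ Metric.ball t δ, ‖⟪y' q, φ⟫ - 1 * ⟪y' t, φ⟫‖ ≤ c * ‖φ‖ := fun q hq => by
    rw [one_mul, ← inner_sub_left]
    refine (norm_inner_le_norm _ _).trans ?_
    gcongr
    exact (dist_eq_norm (y' q) (y' t) ▸ hball hq.1 hq.2).le
  calc ⟪φ, φ⟫ = ⟪y r, φ⟫ - r * ⟪y' t, φ⟫ - (⟪y t, φ⟫ - t * ⟪y' t, φ⟫) := by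
        conv_lhs => rw [hφ, inner_sub_left, inner_sub_left, real_inner_smul_left, ← hφ]
        ring
    _ ≤ c * ‖φ‖ * ‖r - t‖ := (le_abs_self _).trans
        ((hs.inter (convex_ball t δ)).norm_image_sub_le_of_norm_hasDerivWithin_le hderiv hbound
          ⟨ht, Metric.mem_ball_self hδ⟩ ⟨hrs, hrδ⟩)
    _ = c * ‖r - t‖ * ‖φ‖ := by ring

variable {V H : Type*} [NormedAddCommGroup V] [InnerProductSpace ℝ V]
  [NormedAddCommGroup H] [InnerProductSpace ℝ H] {ι : V →L[ℝ] H} {B : V → StrongDual ℝ V}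
  {α γ : ℝ → ℝ} {S S' : Set ℝ} {u v u' v' : ℝ → V} {f f' : ℝ → H}

theorem CoeffBound.rate_le_of_norm_le {T C M t : ℝ} {u v : V} {f : H} (hC : CoeffBound α γ T C)
    (ht : t ∈ Icc 0 T) (hu : ‖u‖ ≤ M) (hv : ‖v‖ ≤ M) (hf : ‖f‖ ≤ M) :
    rate (α t) (γ t) u v f ≤ 5 * (C * M) ^ 2 := by
  have hC₀ : 0 ≤ C := zero_le_one.trans hC.one_le
  have hinv : ‖(α t)⁻¹‖ ≤ C :=
    (Real.norm_of_nonneg (inv_nonneg.2 (hC.pos t ht).le)).trans_le (hC.inv_le t ht)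
  have hvelocity : ‖(α t)⁻¹ • v + γ t • u‖ ≤ C * M + C * M := by
    refine (norm_add_le _ _).trans ?_
    rw [norm_smul, norm_smul]
    gcongr
    exact hC.abs_deriv_le t ht
  have hforce : ‖(α t)⁻¹ • f‖ ≤ C * M := by
    rw [norm_smul]
    gcongr
  calc rate (α t) (γ t) u v f ≤ (C * M + C * M) ^ 2 + (C * M) ^ 2 := by
        unfold rate
        gcongr
    _ = 5 * (C * M) ^ 2 := by ring

namespace IsWeakSolution

variable [CompleteSpace V] [CompleteSpace H]

theorem exists_bound_of_start_le (h : IsWeakSolution ι B α S u v f) (hS : S.Countable)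
    (hι : Function.Injective ι) (hιd : DenseRange ι) (hB : IsDampingOperator B)
    (hα : IsAdmissibleCoefficient α γ) (T L : ℝ) :
    ∃ M, ∀ a t, 0 ≤ a → a ≤ t → t ≤ T → ‖(v a, f a)‖ ≤ L →
      (∀ c ∈ Ioo a t, ∃ L', ∀ r ∈ Icc c t, ‖(v r, f r)‖ ≤ L') → ‖(v t, f t)‖ ≤ M := by
  obtain ⟨C, hC⟩ := hα (max T 0 + 1) (by positivity)
  obtain ⟨K, hK⟩ := h.exists_energy_bound T
  set Q := 5 * (C * max L √K) ^ 2 + K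
  refine ⟨2 * C ^ 2 * √(Real.exp (192 * C ^ 6 * (max T 0 + 1)) * Q),
    fun a t ha hat htT hstart hb => ?_⟩
  have htT' : t < max T 0 + 1 := (htT.trans (le_max_left T 0)).trans_lt (lt_add_one _)
  have hu : ∀ r ∈ Icc 0 T, ‖u r‖ ^ 2 ≤ K := fun r hr =>
    (le_add_of_nonneg_right (sq_nonneg _)).trans (hK r hr)
  have haT : a ∈ Icc 0 T := ⟨ha, hat.trans htT⟩
  have hrate_start : rate (α a) (γ a) (u a) (v a) (f a) ≤ 5 * (C * max L √K) ^ 2 :=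
    hC.rate_le_of_norm_le ⟨ha, hat.trans htT'.le⟩
      (le_max_of_le_right (Real.le_sqrt_of_sq_le (hu a haT)))
      (le_max_of_le_left ((norm_fst_le (v a, f a)).trans hstart))
      (le_max_of_le_left ((norm_snd_le (v a, f a)).trans hstart))
  have hQ : 0 ≤ Q := add_nonneg (by positivity) ((sq_nonneg _).trans (hu a haT))
  have hrate : rate (α t) (γ t) (u t) (v t) (f t) + K ≤ Real.exp (192 * C ^ 6 * t) * Q :=
    calc _ ≤ Real.exp (192 * C ^ 6 * (t - a)) * (rate (α a) (γ a) (u a) (v a) (f a) + K) :=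
          h.rate_add_le hS hι hιd hB hα hC ha hat htT' (hK a haT) fun c hc =>
            (hb c hc).imp fun L' hL' r hr => (norm_fst_le (v r, f r)).trans (hL' r hr)
      _ ≤ Real.exp (192 * C ^ 6 * (t - a)) * Q := by
          gcongr
          exact add_le_add_left hrate_start K
      _ ≤ Real.exp (192 * C ^ 6 * t) * Q := by
          gcongr
          exact sub_le_self t ha
  exact norm_prod_le_iff.2 (norm_le_of_rate_add_le hC ⟨ha.trans hat, htT'.le⟩
    (hu t ⟨ha.trans hat, htT⟩) hrate)

theorem isBoundedUnder_norm_prod (h : IsWeakSolution ι B α S u v f) (hS : S.Countable)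
    (hι : Function.Injective ι) (hιd : DenseRange ι) (hB : IsDampingOperator B)
    (hα : IsAdmissibleCoefficient α γ) {t : ℝ} (ht : t ∈ Ici 0) :
    IsBoundedUnder (· ≤ ·) (𝓝[Ici 0] t) fun r => ‖(v r, f r)‖ :=
  isBoundedUnder_of_propagation (h.isClosed_setOf_norm_prod_le hι hιd hB hα)
    (h.exists_bound_of_start_le hS hι hιd hB hα) ht

theorem exists_norm_velocity_le (h : IsWeakSolution ι B α S u v f) (hS : S.Countable)
    (hι : Function.Injective ι) (hιd : DenseRange ι) (hB : IsDampingOperator B)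
    (hα : IsAdmissibleCoefficient α γ) {c : ℝ} (hc : 0 ≤ c) (b : ℝ) :
    ∃ L, ∀ t ∈ Icc c b, ‖v t‖ ≤ L := by
  obtain ⟨L, hL⟩ := exists_bound_of_disjoint_unboundedTimes (b := b) hc <|
    disjoint_left.2 fun t _ ht => ht.2 (h.isBoundedUnder_norm_prod hS hι hιd hB hα ht.1)
  exact ⟨L, fun t ht => (norm_fst_le (v t, f t)).trans (hL t ht)⟩

theorem eqOn_position (h : IsWeakSolution ι B α S u v f) (hS : S.Countable)
    (h' : IsWeakSolution ι B α S' u' v' f') (hS' : S'.Countable) (hι : Function.Injective ι)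
    (hιd : DenseRange ι) (hB : IsDampingOperator B) (hα : IsAdmissibleCoefficient α γ)
    (hu₀ : u 0 = u' 0) (hv₀ : v 0 = v' 0) : EqOn u u' (Ici 0) := fun t ht =>
  (h.eq_of_velocity_bounded h' hS hS' hι hB.monotone hα.pos hu₀ hv₀ ht
    (fun _ hc => h.exists_norm_velocity_le hS hι hιd hB hα hc.1.le t)
    fun _ hc => h'.exists_norm_velocity_le hS' hι hιd hB hα hc.1.le t).1

theorem exists_antitoneOn_exp_mul_rate_add (h : IsWeakSolution ι B α S u v f) (hS : S.Countable)
    (hι : Function.Injective ι) (hιd : DenseRange ι) (hB : IsDampingOperator B)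
    (hα : IsAdmissibleCoefficient α γ) {T : ℝ} (hT : 0 < T) :
    ∃ c K, AntitoneOn
      (fun t => Real.exp (-(c * t)) * (rate (α t) (γ t) (u t) (v t) (f t) + K)) (Icc 0 T) := by
  obtain ⟨C, hC⟩ := hα (T + 1) (by positivity)
  obtain ⟨K, hK⟩ := h.exists_energy_bound T
  refine ⟨192 * C ^ 6, K, fun a ha t ht hat => ?_⟩
  have hrate := h.rate_add_le hS hι hιd hB hα hC ha.1 hat (ht.2.trans_lt (lt_add_one T)) (hK a ha)
    fun c hc => h.exists_norm_velocity_le hS hι hιd hB hα (ha.1.trans hc.1.le) t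
  calc Real.exp (-(192 * C ^ 6 * t)) * (rate (α t) (γ t) (u t) (v t) (f t) + K)
      ≤ Real.exp (-(192 * C ^ 6 * t)) *
          (Real.exp (192 * C ^ 6 * (t - a)) * (rate (α a) (γ a) (u a) (v a) (f a) + K)) := by
        gcongr
    _ = Real.exp (-(192 * C ^ 6 * a)) * (rate (α a) (γ a) (u a) (v a) (f a) + K) := by
        rw [← mul_assoc, ← Real.exp_add]
        ring_nf

/- Weak convergence together with convergence of norms is strong convergence. -/
theorem continuousWithinAt_of_rate (h : IsWeakSolution ι B α S u v f) (hS : S.Countable)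
    (hι : Function.Injective ι) (hιd : DenseRange ι) (hB : IsDampingOperator B)
    (hα : IsAdmissibleCoefficient α γ) {t : ℝ} (ht : t ∈ Ici 0)
    (hrate : ContinuousWithinAt (fun r => rate (α r) (γ r) (u r) (v r) (f r)) (Ici 0) t) :
    ContinuousWithinAt f (Ici 0) t := by
  obtain ⟨hv, hf⟩ := h.weaklyTendsto hι hιd hB hα ht (h.isBoundedUnder_norm_prod hS hι hιd hB hα ht)
  have hαt := (hα.continuousOn t ht).tendsto
  have hinv := hαt.inv₀ (hα.pos t ht).ne'
  have hforce : Tendsto (fun r => (α r)⁻¹ • f r) (𝓝[Ici 0] t) (𝓝 ((α t)⁻¹ • f t)) :=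
    ((hv.smul hinv).add ((WeaklyTendsto.of_tendsto (h.continuousOn_u t ht).tendsto).smul
      (hα.continuousOn_deriv t ht).tendsto)).tendsto_snd_of_norm_sq_add_norm_sq (hf.smul hinv) hrate
  have hlim := hαt.smul hforce
  rw [smul_inv_smul₀ (hα.pos t ht).ne'] at hlim
  refine hlim.congr' ?_
  filter_upwards [self_mem_nhdsWithin] with r hr
  rw [smul_inv_smul₀ (hα.pos r hr).ne']

theorem countable_not_continuousWithinAt (h : IsWeakSolution ι B α S u v f) (hS : S.Countable)
    (hι : Function.Injective ι) (hιd : DenseRange ι) (hB : IsDampingOperator B)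
    (hα : IsAdmissibleCoefficient α γ) :
    {t | t ∈ Ici 0 ∧ ¬ContinuousWithinAt f (Ici 0) t}.Countable := by
  refine (countable_not_continuousWithinAt_of_antitoneOn_exp_mul fun _ hT =>
    h.exists_antitoneOn_exp_mul_rate_add hS hι hιd hB hα hT).mono ?_
  rintro t ⟨ht, hf⟩
  exact ⟨ht, mt (h.continuousWithinAt_of_rate hS hι hιd hB hα ht) hf⟩

end IsWeakSolution

end Regularity

section Superposition

variable {X : Type*} [MeasurableSpace X] {μ : Measure X} [IsFiniteMeasure μ] {n : ℕ}
  (g : Feedback n)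

theorem Feedback.coeFn_superposition (f : L2 μ n) :
    g.superposition f =ᵐ[μ] fun x => g.toFun (f x) :=
  (g.memLp_comp f).coeFn_toLp

theorem Feedback.inner_superposition_sub_nonneg (f f' : L2 μ n) :
    0 ≤ ⟪g.superposition f - g.superposition f', f - f'⟫ := by
  rw [L2.inner_def]
  refine integral_nonneg_of_ae ?_
  filter_upwards [Lp.coeFn_sub (g.superposition f) (g.superposition f'), Lp.coeFn_sub f f',
    g.coeFn_superposition f, g.coeFn_superposition f'] with x hg_sub hsub hg hg'
  rw [hg_sub, hsub, Pi.sub_apply, Pi.sub_apply, hg, hg']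
  exact g.monotone _ _

theorem Feedback.superposition_zero : g.superposition (0 : L2 μ n) = 0 := by
  refine Lp.ext ?_
  filter_upwards [g.coeFn_superposition (0 : L2 μ n),
    Lp.coeFn_zero (EuclideanSpace ℝ (Fin n)) 2 μ] with x hg hzero
  rw [hg, hzero, Pi.zero_apply, g.map_zero]

theorem Feedback.norm_superposition_le {M : ℝ} (hM : 0 ≤ M)
    (hg : ∀ x, ‖g.toFun x‖ ≤ M * (1 + ‖x‖)) (f : L2 μ n) :
    ‖g.superposition f‖ ≤ M * (‖Lp.const 2 μ (1 : ℝ)‖ + ‖f‖) := by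
  set normf : Lp ℝ 2 μ := (Lp.memLp f).norm.toLp
  have hnormf : ‖normf‖ = ‖f‖ := by rw [Lp.norm_toLp, eLpNorm_norm, Lp.norm_def]
  have hae : ∀ᵐ x ∂μ, ‖g.superposition f x‖ ≤ M * ‖(Lp.const 2 μ (1 : ℝ) + normf) x‖ := by
    filter_upwards [g.coeFn_superposition f, Lp.coeFn_add (Lp.const 2 μ (1 : ℝ)) normf,
      Lp.coeFn_const 2 μ (1 : ℝ), (Lp.memLp f).norm.coeFn_toLp] with x hgx hadd hconst hnorm
    rw [hgx, hadd, Pi.add_apply, hconst, hnorm, Function.const_apply]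
    exact (hg (f x)).trans (by gcongr; exact le_abs_self _)
  refine (Lp.norm_le_mul_norm_of_ae_le_mul hae).trans ?_
  rw [← hnormf]
  gcongr
  exact norm_add_le _ _

theorem Feedback.inner_superposition_add_smul (f e : L2 μ n) (t : ℝ) :
    ⟪g.superposition (f + t • e), e⟫ = ∫ x, ⟪g.toFun (f x + t • e x), e x⟫ ∂μ := by
  rw [L2.inner_def]
  refine integral_congr_ae ?_
  filter_upwards [g.coeFn_superposition (f + t • e), Lp.coeFn_add f (t • e),
    Lp.coeFn_smul t e] with x hg hadd hsmul
  rw [hg, hadd, Pi.add_apply, hsmul, Pi.smul_apply]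

theorem Feedback.tendsto_inner_superposition (f e : L2 μ n) :
    Tendsto (fun t : ℝ => ⟪g.superposition (f + t • e), e⟫) (𝓝[>] 0)
      (𝓝 ⟪g.superposition f, e⟫) := by
  obtain ⟨M, hM, hg⟩ := g.growth
  have hzero := g.inner_superposition_add_smul f e 0
  simp only [zero_smul, add_zero] at hzero
  simp only [g.inner_superposition_add_smul, hzero]
  refine tendsto_integral_filter_of_dominated_convergence
    (fun x => M * (1 + ‖f x‖ + ‖e x‖) * ‖e x‖) (.of_forall fun t => ?_) ?_ ?_
    (.of_forall fun x => ?_)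
  · exact (g.continuous_toFun.comp_aestronglyMeasurable
      ((Lp.memLp f).1.add ((Lp.memLp e).1.const_smul t))).inner (Lp.memLp e).1
  · filter_upwards [Ioo_mem_nhdsGT one_pos] with t ht
    refine .of_forall fun x => ?_
    have hsmul : ‖t • e x‖ ≤ ‖e x‖ := by
      rw [norm_smul, Real.norm_of_nonneg ht.1.le]
      exact mul_le_of_le_one_left (norm_nonneg _) ht.2.le
    calc ‖⟪g.toFun (f x + t • e x), e x⟫‖ ≤ ‖g.toFun (f x + t • e x)‖ * ‖e x‖ :=
          norm_inner_le_norm _ _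
      _ ≤ M * (1 + ‖f x‖ + ‖e x‖) * ‖e x‖ := by
          gcongr
          refine (hg _).trans ?_
          rw [add_assoc]
          gcongr
          exact norm_add_le_of_le le_rfl hsmul
  · exact ((((memLp_const (1 : ℝ)).add (Lp.memLp f).norm).add (Lp.memLp e).norm).const_mul
      M).integrable_mul (Lp.memLp e).norm
  · have hcont : Continuous fun t : ℝ => ⟪g.toFun (f x + t • e x), e x⟫ :=
      (g.continuous_toFun.comp (by fun_prop)).inner continuous_const
    exact (hcont.tendsto' 0 _ (by rw [zero_smul, add_zero])).mono_left nhdsWithin_le_nhds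

end Superposition

section Damping

variable {V : Type*} [NormedAddCommGroup V] [InnerProductSpace ℝ V] {J : ℕ}
  {X : Fin J → Type*} [∀ j, MeasurableSpace (X j)] {μ : ∀ j, Measure (X j)}
  [∀ j, IsFiniteMeasure (μ j)] {N : Fin J → ℕ} {U : ∀ j, Submodule ℝ (L2 (μ j) (N j))}
  (g : ∀ j, Feedback (N j)) (JU : V →L[ℝ] (∀ j, U j))

theorem damping_eq_sum_inner (u v : V) :
    damping g JU u v =
      ∑ j, ⟪(g j).superposition (JU u j : L2 (μ j) (N j)), (JU v j : L2 (μ j) (N j))⟫ := by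
  simp only [damping, sum_apply]
  rfl

theorem isMonotoneOperator_damping : IsMonotoneOperator (damping g JU) := fun x y => by
  rw [sub_apply, damping_eq_sum_inner, damping_eq_sum_inner, ← Finset.sum_sub_distrib]
  refine Finset.sum_nonneg fun j _ => ?_
  rw [← inner_sub_left, map_sub, Pi.sub_apply, Submodule.coe_sub]
  exact (g j).inner_superposition_sub_nonneg _ _

theorem hemicontinuous_damping : Hemicontinuous (damping g JU) := fun x h => by
  simp only [damping_eq_sum_inner]
  refine tendsto_finsetSum _ fun j _ => ?_
  simp only [map_add, map_smul, Pi.add_apply, Pi.smul_apply, Submodule.coe_add, Submodule.coe_smul]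
  exact (g j).tendsto_inner_superposition _ _

theorem damping_zero : damping g JU 0 = 0 := by
  ext v
  rw [damping_eq_sum_inner]
  refine Finset.sum_eq_zero fun j _ => ?_
  rw [map_zero, Pi.zero_apply, Submodule.coe_zero, (g j).superposition_zero, inner_zero_left]

theorem exists_norm_damping_le (L : ℝ) : ∃ R, ∀ x, ‖x‖ ≤ L → ‖damping g JU x‖ ≤ R := by
  choose M hM hg using fun j => (g j).growth
  have hJU : ∀ j x, ‖(JU x j : L2 (μ j) (N j))‖ ≤ ‖JU‖ * ‖x‖ := fun j x =>
    (norm_le_pi_norm (JU x) j).trans (JU.le_opNorm x)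
  refine ⟨∑ j, M j * (‖Lp.const 2 (μ j) (1 : ℝ)‖ + ‖JU‖ * L) * ‖JU‖, fun x hx => ?_⟩
  have hL : 0 ≤ L := (norm_nonneg _).trans hx
  refine ContinuousLinearMap.opNorm_le_bound _ (Finset.sum_nonneg fun j _ => by
    have := (hM j).le
    positivity) fun v => ?_
  rw [damping_eq_sum_inner, Finset.sum_mul]
  refine norm_sum_le_of_le _ fun j _ => (norm_inner_le_norm _ _).trans ?_
  have hMj : 0 ≤ M j := (hM j).le
  calc ‖(g j).superposition (JU x j : L2 (μ j) (N j))‖ * ‖(JU v j : L2 (μ j) (N j))‖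
      ≤ M j * (‖Lp.const 2 (μ j) (1 : ℝ)‖ + ‖JU‖ * ‖x‖) * (‖JU‖ * ‖v‖) := by
        gcongr
        · refine ((g j).norm_superposition_le hMj (hg j) _).trans ?_
          gcongr
          exact hJU j x
        · exact hJU j v
    _ ≤ M j * (‖Lp.const 2 (μ j) (1 : ℝ)‖ + ‖JU‖ * L) * ‖JU‖ * ‖v‖ := by
        rw [← mul_assoc]
        gcongr

theorem isDampingOperator_damping : IsDampingOperator (damping g JU) :=
  ⟨isMonotoneOperator_damping g JU, hemicontinuous_damping g JU, damping_zero g JU,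
    exists_norm_damping_le g JU⟩

end Damping

section AdmissibleCoefficient

theorem abs_sub_sub_le_of_lipschitz_deriv {a a' : ℝ → ℝ} {s : Set ℝ} {C : ℝ} (hs : Convex ℝ s)
    (hC : 0 ≤ C) (ha : ∀ t ∈ s, HasDerivWithinAt a (a' t) s t)
    (hlip : ∀ r ∈ s, ∀ t ∈ s, |a' t - a' r| ≤ C * |t - r|) {r t : ℝ} (hr : r ∈ s) (ht : t ∈ s) :
    |a t - a r - a' t * (t - r)| ≤ C * (t - r) ^ 2 := by
  have hrt : uIcc r t ⊆ s := segment_eq_uIcc r t ▸ hs.segment_subset hr ht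
  have hderiv : ∀ x ∈ uIcc r t,
      HasDerivWithinAt (fun x => a x - a' t * x) (a' x - a' t * 1) (uIcc r t) x := fun x hx =>
    ((ha x (hrt hx)).mono hrt).sub ((hasDerivWithinAt_id x _).const_mul _)
  have hbound : ∀ x ∈ uIcc r t, ‖a' x - a' t * 1‖ ≤ C * |t - r| := fun x hx => by
    rw [mul_one, Real.norm_eq_abs]
    refine (hlip t ht x (hrt hx)).trans ?_
    rw [abs_sub_comm t r]
    exact mul_le_mul_of_nonneg_left (abs_sub_left_of_mem_uIcc (uIcc_comm r t ▸ hx)) hC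
  calc |a t - a r - a' t * (t - r)| = |a t - a' t * t - (a r - a' t * r)| := by ring_nf
    _ ≤ C * |t - r| * |t - r| := (convex_uIcc r t).norm_image_sub_le_of_norm_hasDerivWithin_le
        hderiv hbound left_mem_uIcc right_mem_uIcc
    _ = C * (t - r) ^ 2 := by rw [mul_assoc, abs_mul_abs_self, sq]

theorem abs_neg_div_sq_sub_le {a a' d d' b D x y : ℝ} (ha : a ≠ 0) (ha' : a' ≠ 0)
    (hb : |a⁻¹| ≤ b) (hb' : |a'⁻¹| ≤ b) (hD : |d| ≤ D) (hd : |d' - d| ≤ x)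
    (hinv : |a'⁻¹ - a⁻¹| ≤ y) : |-d' / a' ^ 2 - -d / a ^ 2| ≤ x * b ^ 2 + D * (2 * b * y) :=
  calc |-d' / a' ^ 2 - -d / a ^ 2|
      = |-(d' - d) * (a'⁻¹ * a'⁻¹) - d * ((a'⁻¹ + a⁻¹) * (a'⁻¹ - a⁻¹))| := by
        congr 1
        field_simp
        ring
    _ ≤ |d' - d| * (|a'⁻¹| * |a'⁻¹|) + |d| * (|a'⁻¹ + a⁻¹| * |a'⁻¹ - a⁻¹|) := by
        refine (abs_sub _ _).trans_eq ?_
        simp only [abs_mul, abs_neg]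
    _ ≤ x * (b * b) + D * ((b + b) * y) := by
        have hadd : |a'⁻¹ + a⁻¹| ≤ b + b := (abs_add_le _ _).trans (add_le_add hb' hb)
        have hb₀ : 0 ≤ b := (abs_nonneg _).trans hb
        have hx₀ : 0 ≤ x := (abs_nonneg _).trans hd
        have hD₀ : 0 ≤ D := (abs_nonneg _).trans hD
        gcongr
    _ = x * b ^ 2 + D * (2 * b * y) := by ring

variable {α α' γ : ℝ → ℝ} {T C ν : ℝ}

theorem coeffBound_of_hasDerivWithinAt (hC : 1 ≤ C) (hpos : ∀ t ∈ Icc 0 T, 0 < α t)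
    (hα : ∀ t ∈ Icc 0 T, HasDerivWithinAt α (α' t) (Icc 0 T) t)
    (hinv : ∀ t ∈ Icc 0 T, HasDerivWithinAt (fun s => (α s)⁻¹) (γ t) (Icc 0 T) t)
    (hα_le : ∀ t ∈ Icc 0 T, α t ≤ C) (hinv_le : ∀ t ∈ Icc 0 T, (α t)⁻¹ ≤ C)
    (hα'_le : ∀ t ∈ Icc 0 T, |α' t| ≤ C) (hγ_le : ∀ t ∈ Icc 0 T, |γ t| ≤ C)
    (hγ_lip : ∀ s ∈ Icc 0 T, ∀ t ∈ Icc 0 T, |γ t - γ s| ≤ C * |t - s|) : CoeffBound α γ T C where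
  one_le := hC
  pos := hpos
  le := hα_le
  inv_le := hinv_le
  abs_deriv_le := hγ_le
  lipschitz _ hs _ ht :=
    (convex_Icc 0 T).norm_image_sub_le_of_norm_hasDerivWithin_le hα hα'_le hs ht
  lipschitz_inv _ hs _ ht :=
    (convex_Icc 0 T).norm_image_sub_le_of_norm_hasDerivWithin_le hinv hγ_le hs ht
  lipschitz_deriv := hγ_lip
  taylor _ hs _ ht := abs_sub_sub_le_of_lipschitz_deriv (convex_Icc 0 T)
    (zero_le_one.trans hC) hinv hγ_lip hs ht

theorem exists_coeffBound (hpos : ∀ t ∈ Icc 0 T, 0 < α t)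
    (hα : ∀ t ∈ Icc 0 T, HasDerivWithinAt α (α' t) (Icc 0 T) t)
    (hlip : ∀ s ∈ Icc 0 T, ∀ t ∈ Icc 0 T, |α' t - α' s| ≤ ν * |t - s|) :
    ∃ C, CoeffBound α (fun t => -α' t / α t ^ 2) T C := by
  have hinv : ∀ t ∈ Icc 0 T,
      HasDerivWithinAt (fun s => (α s)⁻¹) (-α' t / α t ^ 2) (Icc 0 T) t := fun t ht =>
    (hα t ht).fun_inv (hpos t ht).ne'
  have hαc : ContinuousOn α (Icc 0 T) := HasDerivWithinAt.continuousOn hα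
  have hα'c : ContinuousOn α' (Icc 0 T) :=
    (LipschitzOnWith.of_dist_le' fun t ht s hs => hlip s hs t ht).continuousOn
  obtain ⟨A, hA⟩ := isCompact_Icc.exists_bound_of_continuousOn hαc
  obtain ⟨b, hb⟩ := isCompact_Icc.exists_bound_of_continuousOn (HasDerivWithinAt.continuousOn hinv)
  obtain ⟨D, hD⟩ := isCompact_Icc.exists_bound_of_continuousOn hα'c
  obtain ⟨G, hG⟩ := isCompact_Icc.exists_bound_of_continuousOn
    (hα'c.neg.div (hαc.pow 2) fun t ht => pow_ne_zero 2 (hpos t ht).ne')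
  obtain ⟨C, hC⟩ := Finset.exists_le {1, A, b, D, G, ν * b ^ 2 + D * (2 * b * G)}
  simp only [Finset.forall_mem_insert, Finset.mem_singleton, forall_eq] at hC
  obtain ⟨hC, hAC, hbC, hDC, hGC, hlipC⟩ := hC
  refine ⟨C, coeffBound_of_hasDerivWithinAt hC hpos hα hinv
    (fun t ht => (le_abs_self _).trans ((hA t ht).trans hAC))
    (fun t ht => (le_abs_self _).trans ((hb t ht).trans hbC))
    (fun t ht => (hD t ht).trans hDC) (fun t ht => (hG t ht).trans hGC) fun s hs t ht => ?_⟩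
  calc |-α' t / α t ^ 2 - -α' s / α s ^ 2|
      ≤ ν * |t - s| * b ^ 2 + D * (2 * b * (G * |t - s|)) :=
        abs_neg_div_sq_sub_le (hpos s hs).ne' (hpos t ht).ne' (hb s hs) (hb t ht) (hD s hs)
          (hlip s hs t ht)
          ((convex_Icc 0 T).norm_image_sub_le_of_norm_hasDerivWithin_le hinv hG hs ht)
    _ = (ν * b ^ 2 + D * (2 * b * G)) * |t - s| := by ring
    _ ≤ C * |t - s| := by gcongr

theorem isAdmissibleCoefficient_of_contDiffOn (hpos : ∀ t ∈ Ici (0 : ℝ), 0 < α t)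
    (hα : ContDiffOn ℝ 1 α (Ici 0))
    (hlip : ∀ T > 0, ∃ ν, ∀ s ∈ Icc 0 T, ∀ t ∈ Icc 0 T,
      |derivWithin α (Ici 0) t - derivWithin α (Ici 0) s| ≤ ν * |t - s|) :
    IsAdmissibleCoefficient α fun t => -derivWithin α (Ici 0) t / α t ^ 2 := fun T hT => by
  obtain ⟨ν, hν⟩ := hlip T hT
  exact exists_coeffBound (fun t ht => hpos t ht.1) (fun t ht =>
    (hα.differentiableOn one_ne_zero t ht.1).hasDerivWithinAt.mono Icc_subset_Ici_self) hν

end AdmissibleCoefficient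

section WellPosedness

variable {V H : Type*} [NormedAddCommGroup V] [InnerProductSpace ℝ V]
  [NormedAddCommGroup H] [InnerProductSpace ℝ H] {ι : V →L[ℝ] H} {B : V → StrongDual ℝ V}
  {α γ : ℝ → ℝ} {S : Set ℝ} {u₀ u₁ : V} {u v : ℝ → V} {f : ℝ → H}

theorem IsSolution.exists_isWeakSolution (h : IsSolution ι (stiffness V) B α u₀ u₁ u) :
    ∃ v f S, S.Countable ∧ IsWeakSolution ι B α S u v f ∧ u 0 = u₀ ∧ v 0 = u₁ := by
  obtain ⟨hu, hu₀, v, hderiv_u, hv, hv₀, f, hstate, S, hS, hderiv_v⟩ := h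
  refine ⟨v, f, S, hS, ⟨hu, hv, hderiv_u, fun t ht => pivot_eq_iff_stateEq.1 (hstate t ht),
    fun t ht φ => ?_⟩, hu₀, hv₀⟩
  simpa using (hderiv_v t ht).1.inner ℝ (hasDerivWithinAt_const t (Ici 0) φ)

theorem IsWeakSolution.isSolution [CompleteSpace V] [CompleteSpace H]
    (h : IsWeakSolution ι B α ∅ u v f) (hι : Function.Injective ι) (hιd : DenseRange ι)
    (hB : IsDampingOperator B) (hα : IsAdmissibleCoefficient α γ) :
    IsSolution ι (stiffness V) B α (u 0) (v 0) u := by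
  refine ⟨h.continuousOn_u, rfl, v, h.deriv_u, h.continuousOn_v, rfl, f,
    fun t ht => pivot_eq_iff_stateEq.2 (h.state t ht), _,
    h.countable_not_continuousWithinAt countable_empty hι hιd hB hα, ?_⟩
  rintro t ⟨ht, hnot⟩
  have hf : ContinuousWithinAt f (Ici 0) t := by_contra fun hf => hnot ⟨ht, hf⟩
  refine ⟨hasDerivWithinAt_of_inner (y' := -f) (convex_Ici 0) (fun s hs φ => ?_) ht hf.neg, hf⟩
  rw [Pi.neg_apply, inner_neg_left]
  exact h.deriv_v s ⟨hs, notMem_empty s⟩ φ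

end WellPosedness

theorem mainTheorem8_general {V H : Type*}
    [NormedAddCommGroup V] [InnerProductSpace ℝ V] [CompleteSpace V]
    [NormedAddCommGroup H] [InnerProductSpace ℝ H] [CompleteSpace H]
    (ι : V →L[ℝ] H) (hι_inj : Function.Injective ι) (hι_dense : DenseRange ι)
    (B : V → StrongDual ℝ V) (hB : IsDampingOperator B)
    (α : ℝ → ℝ) (hα_pos : ∀ t ∈ Ici (0 : ℝ), 0 < α t) (hα_C1 : ContDiffOn ℝ 1 α (Ici 0))
    (hα_lip : ∀ T > 0, ∃ ν, ∀ s ∈ Icc 0 T, ∀ t ∈ Icc 0 T,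
      |derivWithin α (Ici 0) t - derivWithin α (Ici 0) s| ≤ ν * |t - s|)
    (u₀ u₁ : V) (hu : ∃ h : H, pivot ι h = stiffness V u₀ + α 0 • B u₁) :
    ∃ u : ℝ → V, IsSolution ι (stiffness V) B α u₀ u₁ u ∧
      ∀ w : ℝ → V, IsSolution ι (stiffness V) B α u₀ u₁ w → EqOn w u (Ici 0) := by
  obtain ⟨f₀, hf₀⟩ := hu
  have hα := isAdmissibleCoefficient_of_contDiffOn hα_pos hα_C1 hα_lip
  obtain ⟨u, v, f, h, rfl, rfl, -⟩ :=
    exists_isWeakSolution hι_inj hι_dense hB hα (pivot_eq_iff_stateEq.1 hf₀)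
  refine ⟨u, h.isSolution hι_inj hι_dense hB hα, fun w hw => ?_⟩
  obtain ⟨v', f', S, hS, h', hu₀, hu₁⟩ := hw.exists_isWeakSolution
  exact h'.eqOn_position hS h countable_empty hι_inj hι_dense hB hα hu₀ hu₁

end

theorem mainTheorem8
    {V H : Type*}
    [NormedAddCommGroup V] [InnerProductSpace ℝ V] [CompleteSpace V]
    [TopologicalSpace.SeparableSpace V]
    [NormedAddCommGroup H] [InnerProductSpace ℝ H] [CompleteSpace H]
    [TopologicalSpace.SeparableSpace H]
    (ι : V →L[ℝ] H) (hι_inj : Function.Injective ι) (hι_dense : DenseRange ι)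
    {J : ℕ} {X : Fin J → Type*} [∀ j, MeasurableSpace (X j)]
    (μ : ∀ j, Measure (X j)) [∀ j, IsFiniteMeasure (μ j)] (N : Fin J → ℕ)
    (U : ∀ j, Submodule ℝ (L2 (μ j) (N j)))
    (hU : ∀ j, IsClosed (U j : Set (L2 (μ j) (N j))))
    (JU : V →L[ℝ] (∀ j, U j)) (g : ∀ j, Feedback (N j))
    (α : ℝ → ℝ) (hα_pos : ∀ t ∈ Ici (0 : ℝ), 0 < α t) (hα_C1 : ContDiffOn ℝ 1 α (Ici 0))
    (hα_lip : ∀ T : ℝ, 0 < T → ∃ ν : ℝ, 0 < ν ∧ ∀ s ∈ Icc (0 : ℝ) T, ∀ t ∈ Icc (0 : ℝ) T,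
      |derivWithin α (Ici 0) t - derivWithin α (Ici 0) s| ≤ ν * |t - s|)
    (u₀ u₁ : V)
    (hu : ∃ h : H, pivot ι h = stiffness V u₀ + α 0 • damping g JU u₁) :
    ∃ u : ℝ → V, IsSolution ι (stiffness V) (damping g JU) α u₀ u₁ u ∧
      ∀ w : ℝ → V, IsSolution ι (stiffness V) (damping g JU) α u₀ u₁ w →
        EqOn w u (Ici 0) :=
  mainTheorem8_general ι hι_inj hι_dense (damping g JU) (isDampingOperator_damping g JU) α hα_pos
    hα_C1 (fun T hT => (hα_lip T hT).imp fun _ => And.right) u₀ u₁ hu
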